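/- Conventions. A gauge is a continuous, strictly increasing function $\varphi:[0,\infty)\to[0,\infty)$ with $\varphi(0)=0$ and $\varphi(t)\ge t$ for $t>0$; it is a homeomorphism of $[0,\infty)$. A bounded domain is a nonempty, bounded, connected open set $\Omega\subset\mathbb R^n$; $d(x,\partial\Omega)$ is the distance from $x$ to the boundary, $l$ denotes length, and curves are continuous. A quasihyperbolic geodesic from $x$ to $y$ is a rectifiable curve in $\Omega$ from $x$ to $y$ that minimizes $\int_\gamma ds/d(\cdot,\partial\Omega)$ among all such curves. * $\Omega$ has the ball separation property with constant $C_0>0$ if for all $x,y\in\Omega$, every quasihyperbolic geodesic $[x,y]$ from $x$ to $y$, every $z\in[x,y]$ and every curve $\gamma$ in $\Omega$ from $x$ to $y$, one has $B_\Omega(z,C_0\,d(z,\partial\Omega))\cap\gamma\neq\varnothing$, where $B_\Omega$ denotes open balls of the intrinsic length metric of $\Omega$. * $\Omega$ is $\varphi$-LC-2 if for all $x\in\mathbb R^n$ and $r>0$ each pair of points of $\Omega\setminus B(x,\varphi(r))$ can be joined by a path in $\Omega\setminus B(x,r)$, with Euclidean open balls $B$. * For a gauge $\eta$, $\Omega$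 is $\eta$-length John with John constant $C>0$ if there is a point $x_0\in\Omega$ such that every $x\in\Omega$ can be joined to $x_0$ by a rectifiable curve $\gamma:[0,1]\to\Omega$, $\gamma(0)=x$, $\gamma(1)=x_0$, with $l(\gamma([0,t]))\le\eta(C\,d(\gamma(t),\partial\Omega))$ for all $t\in[0,1]$; it is $\eta$-length John if this holds for some $C>0$. For a gauge $\varphi$ and $C>0$ put $$\eta_{\varphi,C}(t)=C\int_0^{\varphi(Ct)}\Big(\frac{s}{\varphi^{-1}(s)}\Big)^{n-1}ds .$$ Theorem. Let $n\ge1$. (1) For every $C_0>0$ there is a constant $C\ge1$, depending only on $n$ and $C_0$, such that for every gauge $\varphi$ for which $\int_0^T(s/\varphi^{-1}(s))^{n-1}ds$ converges for all $T>0$, the function $\eta_{\varphi,C}$ is a gauge, and every bounded domain $\Omega\subset\mathbb R^n$ that has the ball separation property with constant $C_0$ and is $\varphi$-LC-2 is $\eta_{\varphi,C}$-length John with John constant $C$. (2) If $n\ge2$, then $\eta$ is essentially best possible: there are constants $C_0>0$ and $K\ge1$, depending only on $n$, such that for every gauge $\varphi$ as in (1) there is a bounded domain $\Omega\subset\mathbb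 R^n$ that has the ball separation property with constant $C_0$ and is $\varphi(K\,\cdot)$-LC-2, with the following property. If $\mu$ is a gauge and $\Omega$ is $\mu$-length John, then there is a constant $C\ge1$ such that $\eta_{\varphi,1/C}(t)\le\mu(Ct)$ for all $0<t\le1$. -/

import Mathlib

open Set MeasureTheory

/-- Euclidean `n`-space with the Euclidean norm. -/
abbrev En (n : ℕ) : Type := EuclideanSpace ℝ (Fin n)

/-- A bounded domain: a nonempty connected open set that is bounded. -/
structure IsBoundedDomain {n : ℕ} (Ω : Set (En n)) : Prop where
  isOpen : IsOpen Ω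
  isConnected : IsConnected Ω
  isBounded : Bornology.IsBounded Ω

/-- A continuous, (strictly) increasing `φ : [0,∞) → [0,∞)` with `φ 0 = 0` and `φ t ≥ t`.
Only the values on `[0,∞)` matter. Such a `φ` is a homeomorphism of `[0,∞)`. -/
structure IsGauge (φ : ℝ → ℝ) : Prop where
  continuousOn : ContinuousOn φ (Ici 0)
  strictMonoOn : StrictMonoOn φ (Ici 0)
  map_zero : φ 0 = 0
  le_self : ∀ t, 0 < t → t ≤ φ t

/-- The inverse `φ⁻¹ : [0,∞) → [0,∞)` of a gauge. -/
noncomputable def gaugeInv (φ : ℝ → ℝ) : ℝ → ℝ := Function.invFunOn φ (Ici 0)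

/-- `d(x, ∂Ω)`. -/
noncomputable def bdryDist {n : ℕ} (Ω : Set (En n)) (x : En n) : ℝ :=
  Metric.infDist x (frontier Ω)

/-- `γ : [0, L] → Ω` is a rectifiable curve from `x` to `y`, parametrized by arc length
(so `L` is its length). -/
structure IsArclengthCurve {n : ℕ} (Ω : Set (En n)) (x y : En n) (L : ℝ) (γ : ℝ → En n) :
    Prop where
  nonneg : 0 ≤ L
  source : γ 0 = x
  target : γ L = y
  unitSpeed : HasUnitSpeedOn γ (Icc 0 L)
  mapsTo : MapsTo γ (Icc 0 L) Ω

/-- The quasihyperbolic length `∫_γ ds / d(·, ∂Ω)` of a curve parametrized by arc length on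
`[0, L]`. -/
noncomputable def qhLength {n : ℕ} (Ω : Set (En n)) (L : ℝ) (γ : ℝ → En n) : ENNReal :=
  ∫⁻ s in Icc 0 L, ENNReal.ofReal (1 / bdryDist Ω (γ s))

/-- The quasihyperbolic distance: the infimum of the quasihyperbolic lengths of the rectifiable
curves in `Ω` from `x` to `y`. -/
noncomputable def qhDist {n : ℕ} (Ω : Set (En n)) (x y : En n) : ENNReal :=
  ⨅ (L : ℝ) (γ : ℝ → En n) (_ : IsArclengthCurve Ω x y L γ), qhLength Ω L γ

/-- A quasihyperbolic geodesic in `Ω` from `x` to `y`. -/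
def IsQHGeodesic {n : ℕ} (Ω : Set (En n)) (x y : En n) (L : ℝ) (γ : ℝ → En n) : Prop :=
  IsArclengthCurve Ω x y L γ ∧ qhLength Ω L γ = qhDist Ω x y

/-- The intrinsic length metric of `Ω`: the infimum of the lengths of the curves in `Ω` from `x`
to `y`. -/
noncomputable def innerDist {n : ℕ} (Ω : Set (En n)) (x y : En n) : ENNReal :=
  ⨅ (γ : Path x y) (_ : ∀ t, γ t ∈ Ω), eVariationOn γ univ

/-- The ball `B_Ω(z, r)` of the intrinsic length metric. -/
def innerBall {n : ℕ} (Ω : Set (En n)) (z : En n) (r : ℝ) : Set (En n) :=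
  {w | w ∈ Ω ∧ innerDist Ω z w < ENNReal.ofReal r}

/-- The ball separation property with constant `C`: for every quasihyperbolic geodesic `[x, y]`,
every `z ∈ [x, y]` and every curve in `Ω` from `x` to `y`, the curve meets
`B_Ω(z, C d(z, ∂Ω))`. -/
def HasBallSeparation {n : ℕ} (C : ℝ) (Ω : Set (En n)) : Prop :=
  ∀ x ∈ Ω, ∀ y ∈ Ω, ∀ (L : ℝ) (g : ℝ → En n), IsQHGeodesic Ω x y L g →
    ∀ z ∈ g '' Icc 0 L, ∀ γ : Path x y, (∀ t, γ t ∈ Ω) →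
      (innerBall Ω z (C * bdryDist Ω z) ∩ range γ).Nonempty

/-- `φ`-LC-2, for `φ t ≥ t`: each pair of points of `E \ B(x, φ r)` can be joined by a path in
`E \ B(x, r)`. -/
def IsLC2 {n : ℕ} (φ : ℝ → ℝ) (E : Set (En n)) : Prop :=
  ∀ (x : En n) (r : ℝ), 0 < r →
    ∀ a ∈ E \ Metric.ball x (φ r), ∀ b ∈ E \ Metric.ball x (φ r),
      JoinedIn (E \ Metric.ball x r) a b

/-- `Ω` is `η`-length John with John constant `C`: there is a center `x₀ ∈ Ω` such that every
`x ∈ Ω` can be joined to `x₀` by a curve `γ` in `Ω` such that the length of each initial piece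
`γ([0,t])` is at most `η(C d(γ t, ∂Ω))`. (For `t = 1` this makes `γ` rectifiable.) -/
def IsLengthJohnWith {n : ℕ} (C : ℝ) (η : ℝ → ℝ) (Ω : Set (En n)) : Prop :=
  ∃ x₀ ∈ Ω, ∀ x ∈ Ω, ∃ γ : Path x x₀, (∀ t, γ t ∈ Ω) ∧
    ∀ t, eVariationOn γ (Iic t) ≤ ENNReal.ofReal (η (C * bdryDist Ω (γ t)))

/-- `Ω` is `η`-length John. -/
def IsLengthJohn {n : ℕ} (η : ℝ → ℝ) (Ω : Set (En n)) : Prop :=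
  ∃ C : ℝ, 0 < C ∧ IsLengthJohnWith C η Ω

/-- The integrand `(s / φ⁻¹(s))^(n-1)`; used for `n ≥ 1` only. -/
noncomputable def etaIntegrand (n : ℕ) (φ : ℝ → ℝ) (s : ℝ) : ℝ := (s / gaugeInv φ s) ^ (n - 1)

/-- Convergence of `∫_0^T (s / φ⁻¹(s))^(n-1) ds`. -/
def EtaConverges (n : ℕ) (φ : ℝ → ℝ) : Prop :=
  ∀ T : ℝ, 0 < T → IntervalIntegrable (etaIntegrand n φ) volume 0 T

/-- `η(t) = C ∫_0^{φ(Ct)} (s / φ⁻¹(s))^(n-1) ds`. -/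
noncomputable def etaFun (n : ℕ) (φ : ℝ → ℝ) (C t : ℝ) : ℝ :=
  C * ∫ s in (0 : ℝ)..φ (C * t), etaIntegrand n φ s

/-! Part (1). The John curves are quasihyperbolic geodesics ending at a fixed center; they exist by
the direct method (`exists_geodesic`). Let z lie on such a geodesic. Ball separation forbids joining
an earlier point y to the center outside the ball of radius r = C₀ d(z), while LC-2 allows it as
soon as both lie outside the ball of radius φ(r). So y is within a multiple of φ of a multiple of
d(z), unless the center is itself close to z; the center is taken in the middle of a geodesic of
nearly maximal extent, which excludes this second case too (`exists_center`). This bounds diameters.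

Lengths follow by counting. In a ball of radius R the part of a geodesic at distance at least δ from
the boundary is covered by about (R/δ)^n cells of size δ, and each cell contains an arc of length at
most about δ, because geodesics are quasiconvex in Whitney balls. Hence its length is at most a
constant times R (R/δ)^(n-1) (`volume_le_of_bdryDist_ge`). On the shell of radius s about the
starting point the diameter bound allows δ comparable to φ⁻¹(s), and summing over dyadic shells
gives the integral that defines η (`arc_length_le_integral`).

Part (2). The domain is a chain of cubes joined through open faces ("gates"). It fills a sequence of
blocks; the k-th consists of cubes of side 2⁻ᵏ, visited along a Gray code path. The block sizes are
as large as possible under the requirement that everything after a cube of side s has diameter at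
most φ(12ns)/2. This requirement yields LC-2 (`CubeChain.isLC2`). A curve to the center has to pass
all cubes on its way, so its length is at least a multiple of the sum of their sides, which is
comparable to η (`exists_sum_le_of_isLengthJohnWith`, `exists_cubeChain_of_isGauge`).

Ball separation holds for all bounded chains with one constant. A geodesic point much closer to the
boundary than the size of its cube is near an endpoint (`exists_endpoint_near`). At any other point
the ball contains many neighbouring cubes, so it suffices that a competing curve visits one of them:
it does if the endpoints lie on different sides of the cube, and otherwise the geodesic makes a
detour through a gate and back, which can only be short (`exists_excursion_bound`). -/

namespace QH
variable {n : ℕ} {Ω : Set (En n)}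

/-! ### Distance to the boundary -/

theorem ball_bdryDist_subset {u : En n} (hu : u ∈ Ω) (ho : IsOpen Ω) :
    Metric.ball u (bdryDist Ω u) ⊆ Ω := by
  by_cases hpos : 0 < bdryDist Ω u
  · have hc : IsPreconnected (Metric.ball u (bdryDist Ω u)) := (convex_ball u _).isPreconnected
    rw [isPreconnected_iff_subset_of_disjoint] at hc
    have key := hc Ω (closure Ω)ᶜ ho isClosed_closure.isOpen_compl ?_ ?_
    · rcases key with h | h
      · exact h
      · exact absurd (subset_closure hu) (h (Metric.mem_ball_self hpos))
    · intro v hv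
      by_contra hcon
      simp only [mem_union, mem_compl_iff, not_or, not_not] at hcon
      have hf : v ∈ frontier Ω := by
        rw [frontier, ho.interior_eq]; exact ⟨hcon.2, hcon.1⟩
      have := Metric.infDist_le_dist_of_mem (x := u) hf
      rw [Metric.mem_ball, dist_comm] at hv
      exact absurd hv (not_lt.mpr this)
    · ext v
      simp only [mem_inter_iff, mem_compl_iff, mem_empty_iff_false, iff_false]
      rintro ⟨-, h1, h2⟩
      exact h2 (subset_closure h1)
  -- This branch also covers an empty frontier, for which `Metric.infDist` has the default value 0.
  · rw [Metric.ball_eq_empty.mpr (not_lt.mp hpos)]; exact empty_subset _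

theorem bdryDist_le_add (u v : En n) : bdryDist Ω u ≤ bdryDist Ω v + dist u v :=
  Metric.infDist_le_infDist_add_dist

theorem continuous_bdryDist : Continuous (bdryDist Ω) := Metric.continuous_infDist_pt _

theorem frontier_nonempty (hn : 1 ≤ n) (hΩ : IsBoundedDomain Ω) : (frontier Ω).Nonempty := by
  rw [nonempty_frontier_iff]
  refine ⟨hΩ.isConnected.nonempty, fun h => ?_⟩
  have hb := hΩ.isBounded
  rw [h] at hb
  have : Nonempty (Fin n) := ⟨⟨0, hn⟩⟩
  have : Nontrivial (En n) := by infer_instance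
  exact NormedSpace.unbounded_univ ℝ (En n) hb

theorem bdryDist_pos (hn : 1 ≤ n) (hΩ : IsBoundedDomain Ω) {u : En n} (hu : u ∈ Ω) :
    0 < bdryDist Ω u := by
  refine (isClosed_frontier.notMem_iff_infDist_pos (frontier_nonempty hn hΩ)).mp ?_
  intro h
  rw [frontier, hΩ.isOpen.interior_eq] at h
  exact h.2 hu

theorem le_bdryDist_of_ball_subset (hn : 1 ≤ n) (hΩ : IsBoundedDomain Ω) {u : En n} {ρ : ℝ}
    (h : Metric.ball u ρ ⊆ Ω) : ρ ≤ bdryDist Ω u := by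
  refine (Metric.le_infDist (frontier_nonempty hn hΩ)).mpr fun v hv => ?_
  by_contra hlt
  push Not at hlt
  rw [frontier, hΩ.isOpen.interior_eq] at hv
  exact hv.2 (h (by rwa [Metric.mem_ball, dist_comm]))

/-! ### Lipschitz curves -/

/-- A `1`-Lipschitz curve in `Ω` from `x` to `y`, parametrized on `[0, L]`. -/
structure LipCurve (Ω : Set (En n)) (x y : En n) (L : ℝ) (f : ℝ → En n) : Prop where
  nonneg : 0 ≤ L
  source : f 0 = x
  target : f L = y
  dist_le : ∀ s t, 0 ≤ s → s ≤ t → t ≤ L → dist (f s) (f t) ≤ t - s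
  mem : ∀ t, 0 ≤ t → t ≤ L → f t ∈ Ω

theorem LipCurve.lipschitzOnWith {x y : En n} {L : ℝ} {f : ℝ → En n} (h : LipCurve Ω x y L f) :
    LipschitzOnWith 1 f (Icc 0 L) := by
  refine LipschitzOnWith.of_dist_le_mul fun s hs t ht => ?_
  rw [NNReal.coe_one, one_mul, Real.dist_eq]
  rcases le_total s t with hst | hst
  · have := h.dist_le s t hs.1 hst ht.2
    rw [abs_sub_comm, abs_of_nonneg (by linarith)]; exact this
  · have := h.dist_le t s ht.1 hst hs.2
    rw [abs_of_nonneg (by linarith), dist_comm]; exact this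

theorem LipCurve.continuousOn {x y : En n} {L : ℝ} {f : ℝ → En n} (h : LipCurve Ω x y L f) :
    ContinuousOn f (Icc 0 L) := h.lipschitzOnWith.continuousOn

theorem dist_le_of_hasUnitSpeedOn {g : ℝ → En n} {L : ℝ} (h : HasUnitSpeedOn g (Icc 0 L))
    {s t : ℝ} (hs : 0 ≤ s) (hst : s ≤ t) (ht : t ≤ L) : dist (g s) (g t) ≤ t - s := by
  have h1 := h (x := s) ⟨hs, hst.trans ht⟩ (y := t) ⟨hs.trans hst, ht⟩
  have h2 := eVariationOn.edist_le g (s := Icc 0 L ∩ Icc s t) (x := s) (y := t)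
    ⟨⟨hs, hst.trans ht⟩, le_rfl, hst⟩ ⟨⟨hs.trans hst, ht⟩, hst, le_rfl⟩
  rw [h1, NNReal.coe_one, one_mul, edist_dist] at h2
  exact (ENNReal.ofReal_le_ofReal_iff (by linarith)).mp h2

theorem _root_.IsArclengthCurve.lipCurve {x y : En n} {L : ℝ} {g : ℝ → En n}
    (h : IsArclengthCurve Ω x y L g) : LipCurve Ω x y L g where
  nonneg := h.nonneg
  source := h.source
  target := h.target
  dist_le _ _ hs hst ht := dist_le_of_hasUnitSpeedOn h.unitSpeed hs hst ht
  mem _ h0 hL := h.mapsTo ⟨h0, hL⟩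

/-- The arc of a Lipschitz curve between the parameters `a` and `b`. -/
theorem LipCurve.sub {x y : En n} {L : ℝ} {f : ℝ → En n} (h : LipCurve Ω x y L f) {a b : ℝ}
    (ha : 0 ≤ a) (hab : a ≤ b) (hb : b ≤ L) :
    LipCurve Ω (f a) (f b) (b - a) (fun t => f (t + a)) where
  nonneg := by linarith
  source := by simp
  target := by simp
  dist_le s t hs hst ht := by
    have := h.dist_le (s + a) (t + a) (by linarith) (by linarith) (by linarith)
    linarith
  mem t h0 hL := h.mem _ (by linarith) (by linarith)

theorem LipCurve.symm {x y : En n} {L : ℝ} {f : ℝ → En n} (h : LipCurve Ω x y L f) :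
    LipCurve Ω y x L (fun t => f (L - t)) where
  nonneg := h.nonneg
  source := by simpa using h.target
  target := by simpa using h.source
  dist_le s t hs hst ht := by
    have := h.dist_le (L - t) (L - s) (by linarith) (by linarith) (by linarith)
    rw [dist_comm]; linarith
  mem t h0 hL := h.mem _ (by linarith) (by linarith)

/-- Concatenation of curves parametrized on `[0, L₁]` and `[0, L₂]`. -/
noncomputable def concat (L₁ : ℝ) (f g : ℝ → En n) (t : ℝ) : En n :=
  if t ≤ L₁ then f t else g (t - L₁)

theorem LipCurve.trans {x y z : En n} {L₁ L₂ : ℝ} {f g : ℝ → En n} (hf : LipCurve Ω x y L₁ f)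
    (hg : LipCurve Ω y z L₂ g) : LipCurve Ω x z (L₁ + L₂) (concat L₁ f g) where
  nonneg := add_nonneg hf.nonneg hg.nonneg
  source := by rw [concat, if_pos hf.nonneg, hf.source]
  target := by
    rw [concat]
    split_ifs with h
    · have : L₂ = 0 := le_antisymm (by linarith) hg.nonneg
      subst this
      rw [add_zero, hf.target, ← hg.source, hg.target]
    · rw [add_sub_cancel_left, hg.target]
  dist_le s t hs hst ht := by
    rw [concat, concat]
    split_ifs with h1 h2 h2
    · exact hf.dist_le s t hs hst h2
    · have e1 := hf.dist_le s L₁ hs h1 le_rfl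
      have e2 := hg.dist_le 0 (t - L₁) le_rfl (by linarith) (by linarith)
      rw [hf.target] at e1
      rw [hg.source] at e2
      have := dist_triangle (f s) y (g (t - L₁))
      linarith
    · exact absurd (hst.trans h2) h1
    · have := hg.dist_le (s - L₁) (t - L₁) (by linarith) (by linarith) (by linarith)
      linarith
  mem t h0 hL := by
    rw [concat]
    split_ifs with h
    · exact hf.mem t h0 h
    · exact hg.mem _ (by linarith) (by linarith)

/-- Unit speed parametrization of the segment from `u` to `v`. -/
noncomputable def segCurve (u v : En n) (t : ℝ) : En n := u + (t / dist u v) • (v - u)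

theorem lipCurve_segment {u v : En n} (h : segment ℝ u v ⊆ Ω) :
    LipCurve Ω u v (dist u v) (segCurve u v) where
  nonneg := dist_nonneg
  source := by simp [segCurve]
  target := by
    rcases eq_or_ne u v with rfl | huv
    · simp [segCurve]
    · rw [segCurve, div_self (dist_ne_zero.mpr huv)]; simp
  dist_le s t hs hst ht := by
    rcases eq_or_ne u v with rfl | huv
    · simp [segCurve, hst]
    · have hd : 0 < dist u v := dist_pos.mpr huv
      rw [segCurve, segCurve, dist_add_left, dist_eq_norm, ← sub_smul, norm_smul, ← dist_eq_norm v u,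
        dist_comm v u, ← sub_div, Real.norm_eq_abs, abs_div, abs_of_pos hd, div_mul_cancel₀ _ hd.ne',
        abs_sub_comm, abs_of_nonneg (by linarith)]
  mem t h0 hL := by
    apply h
    rw [segment_eq_image']
    refine ⟨t / dist u v, ⟨div_nonneg h0 dist_nonneg, div_le_one_of_le₀ hL dist_nonneg⟩, rfl⟩

theorem exists_lipCurve (ho : IsOpen Ω) (hc : IsPreconnected Ω) {x y : En n} (hx : x ∈ Ω)
    (hy : y ∈ Ω) : ∃ L f, LipCurve Ω x y L f := by
  refine hc.induction₂ (fun x y => ∃ L f, LipCurve Ω x y L f) (fun u hu => ?_) ?_ ?_ hx hy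
  · obtain ⟨ε, hε, hsub⟩ := Metric.isOpen_iff.mp ho u hu
    filter_upwards [mem_nhdsWithin_of_mem_nhds (Metric.ball_mem_nhds u hε)] with v hv
    exact ⟨_, _, lipCurve_segment
      (((convex_ball u ε).segment_subset (Metric.mem_ball_self hε) hv).trans hsub)⟩
  · rintro u v w - - - ⟨_, _, h1⟩ ⟨_, _, h2⟩
    exact ⟨_, _, h1.trans h2⟩
  · rintro u v - - ⟨_, _, h1⟩
    exact ⟨_, _, h1.symm⟩

/-! ### Reparametrization by arc length -/

theorem setLIntegral_comp_sub (F : ℝ → ENNReal) (a b c : ℝ) :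
    ∫⁻ s in Icc a b, F (s - c) = ∫⁻ s in Icc (a - c) (b - c), F s := by
  have := (measurePreserving_sub_right (volume : Measure ℝ) c).setLIntegral_comp_preimage_emb
    (MeasurableEquiv.subRight c).measurableEmbedding F (Icc (a - c) (b - c))
  rw [← this]
  congr 2
  ext s; simp

theorem setLIntegral_comp_add (F : ℝ → ENNReal) (a b c : ℝ) :
    ∫⁻ s in Icc a b, F (s + c) = ∫⁻ s in Icc (a + c) (b + c), F s := by
  simpa using setLIntegral_comp_sub F a b (-c)

theorem setLIntegral_comp_sub_left (F : ℝ → ENNReal) (a b c : ℝ) :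
    ∫⁻ s in Icc a b, F (c - s) = ∫⁻ s in Icc (c - b) (c - a), F s := by
  have := (Measure.measurePreserving_sub_left (volume : Measure ℝ) c).setLIntegral_comp_preimage_emb
    (MeasurableEquiv.subLeft c).measurableEmbedding F (Icc (c - b) (c - a))
  rw [← this]
  congr 2
  ext s; simp

/-- The variation function of a 1-Lipschitz curve is itself 1-Lipschitz, so passing to arc length
shortens parameter intervals and cannot increase the weighted integral. Hence 1-Lipschitz curves may
replace arc length curves in the infimum `qhDist`; unlike the latter they are stable under uniform
limits and need no reparametrization when concatenated. -/
theorem LipCurve.exists_isArclengthCurve {x y : En n} {L : ℝ} {f : ℝ → En n}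
    (h : LipCurve Ω x y L f) :
    ∃ (ℓ : ℝ) (g : ℝ → En n), ℓ ≤ L ∧ IsArclengthCurve Ω x y ℓ g ∧
      qhLength Ω ℓ g ≤ qhLength Ω L f := by
  have hbv := h.lipschitzOnWith.locallyBoundedVariationOn
  have h0 : (0 : ℝ) ∈ Icc 0 L := ⟨le_rfl, h.nonneg⟩
  have hL : L ∈ Icc 0 L := ⟨h.nonneg, le_rfl⟩
  set v := variationOnFromTo f (Icc 0 L) 0 with hv
  have hmono : MonotoneOn v (Icc 0 L) := variationOnFromTo.monotoneOn hbv h0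
  have hstep : ∀ s ∈ Icc 0 L, ∀ t ∈ Icc 0 L, s ≤ t → v t - v s ≤ t - s := by
    intro s hs t ht hst
    have e1 : v t - v s = variationOnFromTo f (Icc 0 L) s t := by
      rw [hv, ← variationOnFromTo.add hbv h0 hs ht]; ring
    rw [e1, variationOnFromTo.eq_of_le _ _ hst]
    have e2 : eVariationOn f (Icc 0 L ∩ Icc s t) ≤ ENNReal.ofReal (t - s) := by
      have := h.lipschitzOnWith.comp_eVariationOn_le (g := id) (s := Icc 0 L ∩ Icc s t)
        (fun r hr => hr.1)
      rw [Function.comp_id, ENNReal.coe_one, one_mul] at this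
      exact (this.trans (eVariationOn.mono _ inter_subset_right)).trans_eq (eVariationOn_id_Icc s t)
    exact ENNReal.toReal_le_of_le_ofReal (by linarith) e2
  have hlip : LipschitzOnWith 1 v (Icc 0 L) := by
    refine LipschitzOnWith.of_dist_le_mul fun s hs t ht => ?_
    rw [NNReal.coe_one, one_mul, Real.dist_eq, Real.dist_eq]
    rcases le_total s t with hst | hst
    · rw [abs_sub_comm, abs_sub_comm s t, abs_of_nonneg (by linarith [hmono hs ht hst]),
        abs_of_nonneg (by linarith)]
      exact hstep s hs t ht hst
    · rw [abs_of_nonneg (by linarith [hmono ht hs hst]), abs_of_nonneg (by linarith)]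
      exact hstep t ht s hs hst
  have hv0 : v 0 = 0 := variationOnFromTo.self f _ 0
  have himg : v '' Icc 0 L = Icc 0 (v L) := by
    apply Subset.antisymm
    · rintro _ ⟨s, hs, rfl⟩
      exact ⟨hv0 ▸ hmono h0 hs hs.1, hmono hs hL hs.2⟩
    · have := intermediate_value_Icc h.nonneg hlip.continuousOn
      rwa [hv0] at this
  set g := naturalParameterization f (Icc 0 L) 0 with hg
  have hgv : ∀ s ∈ Icc 0 L, g (v s) = f s := fun s hs =>
    edist_eq_zero.mp (edist_naturalParameterization_eq_zero hbv h0 hs)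
  have hℓ : 0 ≤ v L := hv0 ▸ hmono h0 hL h.nonneg
  refine ⟨v L, g, ?_, ⟨hℓ, ?_, ?_, ?_, ?_⟩, ?_⟩
  · have := hstep 0 h0 L hL h.nonneg; rw [hv0] at this; linarith
  · rw [← hv0, hgv 0 h0, h.source]
  · rw [hgv L hL, h.target]
  · rw [← himg]; exact has_unit_speed_naturalParameterization f hbv h0
  · intro τ hτ
    rw [← himg] at hτ
    obtain ⟨s, hs, rfl⟩ := hτ
    rw [hgv s hs]; exact h.mem s hs.1 hs.2
  -- Monotonicity of `v` is known on `[0, L]` only; freezing it outside makes it monotone, hence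
  -- measurable, on the whole line.
  · set v' : ℝ → ℝ := fun s => v (max 0 (min s L)) with hv'
    have hcl : ∀ s, max 0 (min s L) ∈ Icc 0 L := fun s =>
      ⟨le_max_left _ _, max_le h.nonneg (min_le_right _ _)⟩
    have hv'm : Monotone v' := fun s t hst =>
      hmono (hcl s) (hcl t) (max_le_max le_rfl (min_le_min hst le_rfl))
    have hv'e : ∀ s ∈ Icc 0 L, v' s = v s := fun s hs => by
      simp only [hv']; rw [min_eq_left hs.2, max_eq_right hs.1]
    -- A 1-Lipschitz map does not increase one-dimensional Hausdorff measure, so a subset of `[0, v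
    -- L]` is no larger than its preimage.
    have hmeas : volume.restrict (Icc 0 (v L)) ≤ Measure.map v' (volume.restrict (Icc 0 L)) := by
      rw [Measure.le_iff]
      intro A hA
      rw [Measure.map_apply hv'm.measurable hA, Measure.restrict_apply hA,
        Measure.restrict_apply (hv'm.measurable hA)]
      have hsub : A ∩ Icc 0 (v L) ⊆ v '' (v' ⁻¹' A ∩ Icc 0 L) := by
        rintro τ ⟨hτA, hτ⟩
        rw [← himg] at hτ
        obtain ⟨s, hs, rfl⟩ := hτ
        exact ⟨s, ⟨by rw [mem_preimage, hv'e s hs]; exact hτA, hs⟩, rfl⟩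
      refine (measure_mono hsub).trans ?_
      have := (hlip.mono (s := v' ⁻¹' A ∩ Icc 0 L) inter_subset_right).hausdorffMeasure_image_le
        (d := 1) zero_le_one
      rw [hausdorffMeasure_real] at this
      simpa using this
    calc qhLength Ω (v L) g
        = ∫⁻ τ, ENNReal.ofReal (1 / bdryDist Ω (g τ)) ∂(volume.restrict (Icc 0 (v L))) := rfl
      _ ≤ ∫⁻ τ, ENNReal.ofReal (1 / bdryDist Ω (g τ)) ∂(Measure.map v' (volume.restrict (Icc 0 L))) :=
          lintegral_mono' hmeas le_rfl
      _ ≤ ∫⁻ s in Icc 0 L, ENNReal.ofReal (1 / bdryDist Ω (g (v' s))) := lintegral_map_le _ _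
      _ = qhLength Ω L f := by
          refine setLIntegral_congr_fun measurableSet_Icc fun s hs => ?_
          simp only [hv'e s hs, hgv s hs]

theorem qhDist_le {x y : En n} {L : ℝ} {f : ℝ → En n} (h : LipCurve Ω x y L f) :
    qhDist Ω x y ≤ qhLength Ω L f := by
  obtain ⟨ℓ, g, -, hg, hle⟩ := h.exists_isArclengthCurve
  exact (iInf_le_of_le ℓ (iInf_le_of_le g (iInf_le _ hg))).trans hle

theorem le_qhDist {x y : En n} {c : ENNReal} (h : ∀ L f, LipCurve Ω x y L f → c ≤ qhLength Ω L f) :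
    c ≤ qhDist Ω x y :=
  le_iInf fun L => le_iInf fun f => le_iInf fun hf => h L f hf.lipCurve

theorem qhLength_concat_le (L₁ L₂ : ℝ) (h1 : 0 ≤ L₁) (f g : ℝ → En n) (hfg : f L₁ = g 0) :
    qhLength Ω (L₁ + L₂) (concat L₁ f g) ≤ qhLength Ω L₁ f + qhLength Ω L₂ g := by
  have hsub : Icc 0 (L₁ + L₂) ⊆ Icc 0 L₁ ∪ Icc L₁ (L₁ + L₂) := fun s hs => by
    rcases le_total s L₁ with h | h
    · exact Or.inl ⟨hs.1, h⟩
    · exact Or.inr ⟨h, hs.2⟩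
  refine (lintegral_mono_set hsub).trans ((lintegral_union_le _ _ _).trans (add_le_add ?_ ?_))
  · refine (setLIntegral_congr_fun measurableSet_Icc fun s hs => ?_).le
    simp only [concat, if_pos hs.2]
  · have := setLIntegral_comp_sub (fun t => ENNReal.ofReal (1 / bdryDist Ω (g t))) L₁ (L₁ + L₂) L₁
    rw [sub_self, add_sub_cancel_left] at this
    rw [qhLength, ← this]
    refine (setLIntegral_congr_fun measurableSet_Icc fun s hs => ?_).le
    simp only [concat]
    split_ifs with h
    · have : s = L₁ := le_antisymm h hs.1
      subst this; simp [hfg]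
    · rfl

theorem qhDist_triangle (x y z : En n) : qhDist Ω x z ≤ qhDist Ω x y + qhDist Ω y z := by
  have key : ∀ L f, LipCurve Ω x y L f → qhDist Ω x z - qhLength Ω L f ≤ qhDist Ω y z :=
    fun L f hf => le_qhDist fun L' g hg => tsub_le_iff_left.mpr <|
      (qhDist_le (hf.trans hg)).trans
        (qhLength_concat_le L L' hf.nonneg f g (hf.target.trans hg.source.symm))
  rw [← tsub_le_iff_right]
  exact le_qhDist fun L f hf => tsub_le_iff_left.mpr (tsub_le_iff_left.mp (key L f hf) |>.trans_eq
    (add_comm _ _))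

theorem qhDist_comm (x y : En n) : qhDist Ω x y = qhDist Ω y x := by
  have key : ∀ x y : En n, qhDist Ω x y ≤ qhDist Ω y x := by
    intro x y
    refine le_qhDist fun L f hf => (qhDist_le hf.symm).trans_eq ?_
    have := setLIntegral_comp_sub_left (fun t => ENNReal.ofReal (1 / bdryDist Ω (f t))) 0 L L
    rw [sub_self, sub_zero] at this
    exact this
  exact le_antisymm (key x y) (key y x)

/-! ### The intrinsic length metric -/

theorem innerDist_le {x y : En n} {L : ℝ} {f : ℝ → En n} (h : LipCurve Ω x y L f) :
    innerDist Ω x y ≤ ENNReal.ofReal L := by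
  have hmaps : ∀ t : unitInterval, (t : ℝ) * L ∈ Icc 0 L := fun t =>
    ⟨mul_nonneg t.2.1 h.nonneg, mul_le_of_le_one_left h.nonneg t.2.2⟩
  let γ : Path x y :=
    { toFun := fun t => f (t * L)
      continuous_toFun := h.continuousOn.comp_continuous (by fun_prop) hmaps
      source' := by simp [h.source]
      target' := by simp [h.target] }
  refine iInf_le_of_le γ (iInf_le_of_le (fun t => h.mem _ (hmaps t).1 (hmaps t).2) ?_)
  have hm : MonotoneOn (fun t : unitInterval => (t : ℝ) * L) univ := fun s _ t _ hst =>
    mul_le_mul_of_nonneg_right hst h.nonneg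
  have e1 : eVariationOn γ univ ≤ eVariationOn f (Icc 0 L) :=
    eVariationOn.comp_le_of_monotoneOn f (fun t : unitInterval => (t : ℝ) * L) hm
      (fun t _ => hmaps t)
  refine e1.trans ?_
  have := h.lipschitzOnWith.comp_eVariationOn_le (g := id) (s := Icc 0 L) (fun r hr => hr)
  rw [Function.comp_id, ENNReal.coe_one, one_mul, eVariationOn_id_Icc, sub_zero] at this
  exact this

theorem edist_le_innerDist (x y : En n) : edist x y ≤ innerDist Ω x y := by
  refine le_iInf fun γ => le_iInf fun _ => ?_
  have := eVariationOn.edist_le γ (s := univ) (mem_univ (0 : unitInterval)) (mem_univ 1)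
  rwa [γ.source, γ.target] at this

theorem innerBall_subset_ball (z : En n) (r : ℝ) : innerBall Ω z r ⊆ Metric.ball z r := by
  rintro w ⟨-, hw⟩
  have := (edist_le_innerDist z w).trans_lt hw
  rw [edist_dist] at this
  rw [Metric.mem_ball, dist_comm]
  exact lt_of_not_ge fun h => absurd this (not_lt.mpr (ENNReal.ofReal_le_ofReal h))

end QH

/-! ### Quasihyperbolic length estimates, and existence of geodesics -/

namespace QH
variable {n : ℕ} {Ω : Set (En n)}

/-! ### Quasihyperbolic length of arcs -/

theorem lintegral_one_div_add_mul {h c L : ℝ} (hh : 0 < h) (hc : 0 < c) (hL : 0 ≤ L) :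
    ∫⁻ s in Icc 0 L, ENNReal.ofReal (1 / (h + c * s)) =
      ENNReal.ofReal (Real.log (1 + c * L / h) / c) := by
  have hpos : ∀ s ∈ Icc 0 L, 0 < h + c * s := fun s hs => by
    have := mul_nonneg hc.le hs.1; linarith
  have hcont : ContinuousOn (fun s => 1 / (h + c * s)) (Icc 0 L) :=
    ContinuousOn.div₀ continuousOn_const (by fun_prop) fun s hs => (hpos s hs).ne'
  rw [← ofReal_integral_eq_lintegral_ofReal (hcont.integrableOn_compact isCompact_Icc)
    ((ae_restrict_iff' measurableSet_Icc).mpr (Filter.Eventually.of_forall fun s hs =>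
      one_div_nonneg.mpr (hpos s hs).le)),
    integral_Icc_eq_integral_Ioc, ← intervalIntegral.integral_of_le hL]
  congr 1
  have hd : ∀ s ∈ uIcc 0 L, HasDerivAt (fun s => Real.log (h + c * s) / c) (1 / (h + c * s)) s := by
    intro s hs
    rw [uIcc_of_le hL] at hs
    have h1 : HasDerivAt (fun s => h + c * s) c s := by
      simpa using ((hasDerivAt_id s).const_mul c).const_add h
    have h2 := (h1.log (hpos s hs).ne').div_const c
    rwa [div_right_comm, div_self hc.ne'] at h2
  rw [intervalIntegral.integral_eq_sub_of_hasDerivAt hd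
    (by rw [← uIcc_of_le hL] at hcont; exact hcont.intervalIntegrable)]
  rw [mul_zero, add_zero, ← sub_div, ← Real.log_div (hpos L ⟨hL, le_rfl⟩).ne' hh.ne', add_div,
    div_self hh.ne']

/-- After the time s the distance to the boundary has grown to at most d(x) + s; the logarithm is
the integral of 1/(d(x) + s). -/
theorem LipCurve.log_le_qhLength {x y : En n} {L : ℝ} {f : ℝ → En n} (h : LipCurve Ω x y L f)
    (hn : 1 ≤ n) (hΩ : IsBoundedDomain Ω) :
    ENNReal.ofReal (Real.log (1 + L / bdryDist Ω x)) ≤ qhLength Ω L f := by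
  have hx : 0 < bdryDist Ω x := bdryDist_pos hn hΩ (h.source ▸ h.mem 0 le_rfl h.nonneg)
  have := lintegral_one_div_add_mul hx one_pos h.nonneg
  rw [one_mul, div_one] at this
  rw [← this]
  refine setLIntegral_mono' measurableSet_Icc fun s hs => ENNReal.ofReal_le_ofReal ?_
  refine one_div_le_one_div_of_le (bdryDist_pos hn hΩ (h.mem s hs.1 hs.2)) ?_
  have h1 := bdryDist_le_add (Ω := Ω) (f s) x
  have h2 := h.dist_le 0 s le_rfl hs.1 hs.2
  rw [h.source, dist_comm] at h2
  linarith

theorem qhLength_symm (L : ℝ) (f : ℝ → En n) :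
    qhLength Ω L (fun t => f (L - t)) = qhLength Ω L f := by
  have := setLIntegral_comp_sub_left (fun t => ENNReal.ofReal (1 / bdryDist Ω (f t))) 0 L L
  rwa [sub_self, sub_zero] at this

theorem LipCurve.log_le_qhLength' {x y : En n} {L : ℝ} {f : ℝ → En n} (h : LipCurve Ω x y L f)
    (hn : 1 ≤ n) (hΩ : IsBoundedDomain Ω) :
    ENNReal.ofReal (Real.log (1 + L / bdryDist Ω y)) ≤ qhLength Ω L f := by
  rw [← qhLength_symm]
  exact h.symm.log_le_qhLength hn hΩ

theorem LipCurve.exists_pos_le {x y : En n} {L : ℝ} {f : ℝ → En n} (h : LipCurve Ω x y L f)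
    (hn : 1 ≤ n) (hΩ : IsBoundedDomain Ω) :
    ∃ m, 0 < m ∧ ∀ t ∈ Icc 0 L, m ≤ bdryDist Ω (f t) := by
  obtain ⟨t, ht, hmin⟩ := isCompact_Icc.exists_isMinOn (nonempty_Icc.mpr h.nonneg)
    (continuous_bdryDist.comp_continuousOn h.continuousOn)
  exact ⟨_, bdryDist_pos hn hΩ (h.mem t ht.1 ht.2), fun s hs => hmin hs⟩

theorem LipCurve.qhLength_lt_top {x y : En n} {L : ℝ} {f : ℝ → En n} (h : LipCurve Ω x y L f)
    (hn : 1 ≤ n) (hΩ : IsBoundedDomain Ω) : qhLength Ω L f < ⊤ := by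
  obtain ⟨m, hm, hle⟩ := h.exists_pos_le hn hΩ
  calc qhLength Ω L f ≤ ∫⁻ _ in Icc 0 L, ENNReal.ofReal (1 / m) :=
        setLIntegral_mono' measurableSet_Icc fun s hs =>
          ENNReal.ofReal_le_ofReal (one_div_le_one_div_of_le hm (hle s hs))
    _ < ⊤ := by
        rw [setLIntegral_const]
        exact ENNReal.mul_lt_top ENNReal.ofReal_lt_top (by simp)

theorem qhDist_lt_top (hn : 1 ≤ n) (hΩ : IsBoundedDomain Ω) {x y : En n} (hx : x ∈ Ω)
    (hy : y ∈ Ω) : qhDist Ω x y < ⊤ := by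
  obtain ⟨L, f, h⟩ := exists_lipCurve hΩ.isOpen hΩ.isConnected.isPreconnected hx hy
  exact (qhDist_le h).trans_lt (h.qhLength_lt_top hn hΩ)

/-- The quasihyperbolic distance along a segment that stays away from the boundary. -/
theorem qhDist_le_div (hn : 1 ≤ n) (hΩ : IsBoundedDomain Ω) {u v : En n} {ρ : ℝ} (hρ : 0 < ρ)
    (h : ∀ w ∈ segment ℝ u v, Metric.ball w ρ ⊆ Ω) :
    qhDist Ω u v ≤ ENNReal.ofReal (dist u v / ρ) := by
  have hc : LipCurve Ω u v _ _ :=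
    lipCurve_segment fun w hw => h w hw (Metric.mem_ball_self hρ)
  refine (qhDist_le hc).trans ?_
  have hle : ∀ s ∈ Icc 0 (dist u v), 1 / bdryDist Ω (segCurve u v s) ≤ 1 / ρ := fun s hs => by
    refine one_div_le_one_div_of_le hρ (le_bdryDist_of_ball_subset hn hΩ (h _ ?_))
    rw [segment_eq_image']
    exact ⟨s / dist u v, ⟨div_nonneg hs.1 dist_nonneg, div_le_one_of_le₀ hs.2 dist_nonneg⟩, rfl⟩
  calc qhLength Ω (dist u v) (segCurve u v) ≤ ∫⁻ _ in Icc 0 (dist u v), ENNReal.ofReal (1 / ρ) :=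
        setLIntegral_mono' measurableSet_Icc fun s hs => ENNReal.ofReal_le_ofReal (hle s hs)
    _ = ENNReal.ofReal (dist u v / ρ) := by
        rw [setLIntegral_const, Real.volume_Icc, sub_zero, ← ENNReal.ofReal_mul (by positivity)]
        congr 1; ring

/-! ### Geodesics -/

theorem _root_.IsQHGeodesic.lipCurve {x y : En n} {L : ℝ} {g : ℝ → En n}
    (h : IsQHGeodesic Ω x y L g) : LipCurve Ω x y L g := h.1.lipCurve

theorem setLIntegral_Icc_add (F : ℝ → ENNReal) {a b c : ℝ} (hab : a ≤ b) (hbc : b ≤ c) :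
    ∫⁻ s in Icc a c, F s = (∫⁻ s in Icc a b, F s) + ∫⁻ s in Icc b c, F s := by
  have h : Icc a c = Icc a b ∪ Ioc b c := (Icc_union_Ioc_eq_Icc hab hbc).symm
  rw [h, lintegral_union measurableSet_Ioc
    (disjoint_left.mpr fun s h1 h2 => not_lt.mpr h1.2 h2.1),
    setLIntegral_congr (Ioc_ae_eq_Icc (μ := volume) (a := b) (b := c))]

theorem qhLength_sub (f : ℝ → En n) (a b : ℝ) :
    qhLength Ω (b - a) (fun t => f (t + a)) =
      ∫⁻ s in Icc a b, ENNReal.ofReal (1 / bdryDist Ω (f s)) := by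
  have := setLIntegral_comp_add (fun t => ENNReal.ofReal (1 / bdryDist Ω (f t))) 0 (b - a) a
  rw [zero_add, sub_add_cancel] at this
  exact this

/-- Subarcs of minimizers minimize: by the triangle inequality a shorter middle piece would shorten
the whole. Cancelling the outer pieces needs the total length to be finite. -/
theorem _root_.IsQHGeodesic.arc_le {x y : En n} {L : ℝ} {g : ℝ → En n}
    (h : IsQHGeodesic Ω x y L g) (hn : 1 ≤ n) (hΩ : IsBoundedDomain Ω) {a b : ℝ} (ha : 0 ≤ a)
    (hab : a ≤ b) (hb : b ≤ L) :
    ∫⁻ s in Icc a b, ENNReal.ofReal (1 / bdryDist Ω (g s)) ≤ qhDist Ω (g a) (g b) := by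
  have hc := h.lipCurve
  set F : ℝ → ENNReal := fun s => ENNReal.ofReal (1 / bdryDist Ω (g s)) with hF
  have htot : qhLength Ω L g =
      (∫⁻ s in Icc 0 a, F s) + ((∫⁻ s in Icc a b, F s) + ∫⁻ s in Icc b L, F s) := by
    rw [← setLIntegral_Icc_add F hab hb, ← setLIntegral_Icc_add F ha (hab.trans hb)]; rfl
  have h1 : qhDist Ω x (g a) ≤ ∫⁻ s in Icc 0 a, F s := by
    have := qhDist_le (hc.sub le_rfl ha (hab.trans hb))
    rwa [hc.source, qhLength_sub] at this
  have h2 : qhDist Ω (g b) y ≤ ∫⁻ s in Icc b L, F s := by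
    have := qhDist_le (hc.sub (ha.trans hab) hb le_rfl)
    rwa [hc.target, qhLength_sub] at this
  have h3 : qhLength Ω L g ≤
      (∫⁻ s in Icc 0 a, F s) + (qhDist Ω (g a) (g b) + ∫⁻ s in Icc b L, F s) := by
    rw [h.2]
    exact (qhDist_triangle _ (g a) _).trans
      (add_le_add h1 ((qhDist_triangle _ (g b) _).trans (add_le_add le_rfl h2)))
  have hfin := hc.qhLength_lt_top hn hΩ
  rw [htot] at h3 hfin
  rw [ENNReal.add_lt_top, ENNReal.add_lt_top] at hfin
  exact (ENNReal.add_le_add_iff_right hfin.2.2.ne).mp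
    ((ENNReal.add_le_add_iff_left hfin.1.ne).mp h3)

theorem hasUnitSpeedOn_shift {g : ℝ → En n} {L : ℝ} (h : HasUnitSpeedOn g (Icc 0 L)) {a b : ℝ}
    (ha : 0 ≤ a) (hb : b ≤ L) : HasUnitSpeedOn (fun t => g (t + a)) (Icc 0 (b - a)) := by
  intro s hs t ht
  have hm : Monotone fun t : ℝ => t + a := fun s t hst => by simpa using hst
  have e := eVariationOn.comp_eq_of_monotoneOn g (t := Icc 0 (b - a) ∩ Icc s t) (fun t => t + a)
    (hm.monotoneOn _)
  have himg : (fun t => t + a) '' (Icc 0 (b - a) ∩ Icc s t) = Icc 0 L ∩ Icc (s + a) (t + a) := by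
    ext r
    simp only [mem_image, mem_inter_iff, mem_Icc] at hs ht ⊢
    constructor
    · rintro ⟨q, ⟨⟨h1, h2⟩, h3, h4⟩, rfl⟩
      refine ⟨⟨?_, ?_⟩, ?_, ?_⟩ <;> linarith
    · rintro ⟨⟨h1, h2⟩, h3, h4⟩
      refine ⟨r - a, ⟨⟨?_, ?_⟩, ?_, ?_⟩, ?_⟩ <;> linarith [hs.1, ht.2]
  rw [himg] at e
  have := h (x := s + a) ⟨by linarith [hs.1], by linarith [hs.2]⟩ (y := t + a)
    ⟨by linarith [ht.1], by linarith [ht.2]⟩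
  rw [add_sub_add_right_eq_sub] at this
  exact e.trans this

theorem _root_.IsQHGeodesic.sub {x y : En n} {L : ℝ} {g : ℝ → En n}
    (h : IsQHGeodesic Ω x y L g) (hn : 1 ≤ n) (hΩ : IsBoundedDomain Ω) {a b : ℝ} (ha : 0 ≤ a)
    (hab : a ≤ b) (hb : b ≤ L) :
    IsQHGeodesic Ω (g a) (g b) (b - a) (fun t => g (t + a)) := by
  have hc := h.lipCurve.sub ha hab hb
  refine ⟨⟨hc.nonneg, hc.source, hc.target, hasUnitSpeedOn_shift h.1.unitSpeed ha hb,
    fun t ht => hc.mem t ht.1 ht.2⟩, le_antisymm ?_ (qhDist_le hc)⟩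
  rw [qhLength_sub]
  exact h.arc_le hn hΩ ha hab hb

theorem _root_.IsQHGeodesic.log_le {x y : En n} {L : ℝ} {g : ℝ → En n}
    (h : IsQHGeodesic Ω x y L g) (hn : 1 ≤ n) (hΩ : IsBoundedDomain Ω) {a b : ℝ} (ha : 0 ≤ a)
    (hab : a ≤ b) (hb : b ≤ L) :
    ENNReal.ofReal (Real.log (1 + (b - a) / bdryDist Ω (g a))) ≤ qhDist Ω (g a) (g b) := by
  have h' := h.sub hn hΩ ha hab hb
  rw [← h'.2]
  exact h'.lipCurve.log_le_qhLength hn hΩ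

theorem _root_.IsQHGeodesic.log_le' {x y : En n} {L : ℝ} {g : ℝ → En n}
    (h : IsQHGeodesic Ω x y L g) (hn : 1 ≤ n) (hΩ : IsBoundedDomain Ω) {a b : ℝ} (ha : 0 ≤ a)
    (hab : a ≤ b) (hb : b ≤ L) :
    ENNReal.ofReal (Real.log (1 + (b - a) / bdryDist Ω (g b))) ≤ qhDist Ω (g a) (g b) := by
  have h' := h.sub hn hΩ ha hab hb
  rw [← h'.2]
  exact h'.lipCurve.log_le_qhLength' hn hΩ

/-- A quasihyperbolic geodesic is locally quasiconvex: inside a Whitney ball its arcs are at most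
twice as long as their chords. -/
theorem _root_.IsQHGeodesic.arc_le_two_mul_dist {x y : En n} {L : ℝ} {g : ℝ → En n}
    (h : IsQHGeodesic Ω x y L g) (hn : 1 ≤ n) (hΩ : IsBoundedDomain Ω) {a b : ℝ} (ha : 0 ≤ a)
    (hab : a ≤ b) (hb : b ≤ L) (hd : dist (g a) (g b) ≤ bdryDist Ω (g a) / 4) :
    b - a ≤ 2 * dist (g a) (g b) := by
  have hga : g a ∈ Ω := h.lipCurve.mem a ha (hab.trans hb)
  set d := bdryDist Ω (g a) with hdd
  set τ := dist (g a) (g b) with hτ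
  have hpos : 0 < d := bdryDist_pos hn hΩ hga
  have hτ0 : 0 ≤ τ := dist_nonneg
  have h1 : qhDist Ω (g a) (g b) ≤ ENNReal.ofReal (τ / (3 / 4 * d)) := by
    -- The chord stays within d/4 of `g a`, so balls of radius 3d/4 about its points lie in Ω.
    refine qhDist_le_div hn hΩ (by positivity) fun w hw => ?_
    refine Subset.trans (Metric.ball_subset_ball' ?_) (ball_bdryDist_subset hga hΩ.isOpen)
    have : dist w (g a) ≤ τ := by
      have : w ∈ Metric.closedBall (g a) τ :=
        (convex_closedBall (g a) τ).segment_subset (Metric.mem_closedBall_self hτ0)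
          (by rw [Metric.mem_closedBall, dist_comm]) hw
      exact this
    linarith
  have h2 := (h.log_le hn hΩ ha hab hb).trans h1
  rw [ENNReal.ofReal_le_ofReal_iff (by positivity)] at h2
  have hp : 0 < 1 + (b - a) / d := by
    have : 0 ≤ (b - a) / d := div_nonneg (by linarith) hpos.le
    linarith
  rw [Real.log_le_iff_le_exp hp] at h2
  set q := τ / (3 / 4 * d) with hq
  have hq0 : 0 ≤ q := by positivity
  have hq1 : q ≤ 1 / 3 := by
    rw [hq, div_le_iff₀ (by positivity)]; linarith
  have hexp : Real.exp q ≤ 1 + q + q ^ 2 := by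
    have := Real.abs_exp_sub_one_sub_id_le (x := q) (by rw [abs_of_nonneg hq0]; linarith)
    have := (abs_le.mp this).2
    linarith
  -- As q ≤ 1/3, one has exp q - 1 ≤ q + q² ≤ (4/3) q. With q = (4/3) τ/d this gives b - a ≤ (16/9)
  -- τ.
  have h3 : (b - a) / d ≤ 4 / 3 * q := by nlinarith
  have h4 : q * d = 4 / 3 * τ := by rw [hq]; field_simp
  rw [div_le_iff₀ hpos] at h3
  nlinarith

/-! ### Existence of geodesics -/

open Filter Topology in
-- Direct method. Curves of bounded quasihyperbolic length have bounded length and stay away from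
-- the boundary, by the two logarithmic lower bounds. A minimizing sequence of 1-Lipschitz curves
-- thus lives in a compact subset of Ω, Arzelà–Ascoli gives a limit, and Fatou's lemma gives lower
-- semicontinuity of the length.
theorem exists_geodesic (hn : 1 ≤ n) (hΩ : IsBoundedDomain Ω) {x y : En n} (hx : x ∈ Ω)
    (hy : y ∈ Ω) : ∃ L g, IsQHGeodesic Ω x y L g := by
  suffices h : ∃ L f, LipCurve Ω x y L f ∧ qhLength Ω L f ≤ qhDist Ω x y by
    obtain ⟨L, f, hf, hle⟩ := h
    obtain ⟨ℓ, g, -, hg, hgle⟩ := hf.exists_isArclengthCurve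
    exact ⟨ℓ, g, hg, le_antisymm (hgle.trans hle) (qhDist_le hg.lipCurve)⟩
  set κ := (qhDist Ω x y).toReal with hκ
  have hκ' : qhDist Ω x y = ENNReal.ofReal κ :=
    (ENNReal.ofReal_toReal (qhDist_lt_top hn hΩ hx hy).ne).symm
  have hκ0 : 0 ≤ κ := ENNReal.toReal_nonneg
  have hdx : 0 < bdryDist Ω x := bdryDist_pos hn hΩ hx
  have hseq : ∀ k : ℕ, ∃ L f, LipCurve Ω x y L f ∧
      qhLength Ω L f ≤ ENNReal.ofReal (κ + 1 / (k + 1)) := by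
    intro k
    by_contra hcon
    push Not at hcon
    have := le_qhDist fun L f hf => (hcon L f hf).le
    rw [hκ', ENNReal.ofReal_le_ofReal_iff hκ0] at this
    have : (0 : ℝ) < 1 / (k + 1) := by positivity
    linarith
  choose L f hf hlen using hseq
  have hlen1 : ∀ k, qhLength Ω (L k) (f k) ≤ ENNReal.ofReal (κ + 1) := fun k =>
    (hlen k).trans (ENNReal.ofReal_le_ofReal (by
      have : (1 : ℝ) / (k + 1) ≤ 1 := by
        rw [div_le_one (by positivity)]; linarith [(Nat.cast_nonneg k : (0 : ℝ) ≤ k)]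
      linarith))
  set M := bdryDist Ω x * Real.exp (κ + 1) with hM
  have hM0 : 0 ≤ M := by positivity
  have hLM : ∀ k, L k ∈ Icc 0 M := fun k => by
    refine ⟨(hf k).nonneg, ?_⟩
    have h1 := ((hf k).log_le_qhLength hn hΩ).trans (hlen1 k)
    rw [ENNReal.ofReal_le_ofReal_iff (by linarith), Real.log_le_iff_le_exp (by
      have := div_nonneg (hf k).nonneg hdx.le; linarith)] at h1
    have h2 : L k / bdryDist Ω x ≤ Real.exp (κ + 1) := by linarith
    rw [div_le_iff₀ hdx] at h2
    rw [hM]; linarith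
  set c := bdryDist Ω x * Real.exp (-(κ + 1)) with hc
  have hc0 : 0 < c := by positivity
  have hcd : ∀ k t, 0 ≤ t → t ≤ L k → c ≤ bdryDist Ω (f k t) := fun k t h0 ht => by
    have hpos := bdryDist_pos hn hΩ ((hf k).mem t h0 ht)
    have h1 := ((hf k).sub le_rfl h0 ht).log_le_qhLength' hn hΩ
    have h2 : qhLength Ω (t - 0) (fun s => f k (s + 0)) ≤ qhLength Ω (L k) (f k) := by
      simp only [sub_zero, add_zero]
      exact lintegral_mono_set (Icc_subset_Icc le_rfl ht)
    have h3 := h1.trans (h2.trans (hlen1 k))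
    rw [ENNReal.ofReal_le_ofReal_iff (by linarith), Real.log_le_iff_le_exp (by
      have := div_nonneg (by linarith : 0 ≤ t - 0) hpos.le; linarith)] at h3
    have h4 := bdryDist_le_add (Ω := Ω) x (f k t)
    have h5 := (hf k).dist_le 0 t le_rfl h0 ht
    rw [(hf k).source] at h5
    have h6 : bdryDist Ω x ≤ bdryDist Ω (f k t) * Real.exp (κ + 1) := by
      have : bdryDist Ω (f k t) * (1 + (t - 0) / bdryDist Ω (f k t)) = bdryDist Ω (f k t) + t := by
        field_simp; ring
      nlinarith
    rw [hc, Real.exp_neg, ← div_eq_mul_inv, div_le_iff₀ (Real.exp_pos _)]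
    exact h6
  set K : Set (En n) := closure Ω ∩ {u | c ≤ bdryDist Ω u} with hK
  have hKc : IsCompact K := hΩ.isBounded.isCompact_closure.inter_right
    (isClosed_le continuous_const continuous_bdryDist)
  have hKΩ : K ⊆ Ω := by
    rintro u ⟨hu, hcu⟩
    by_contra hcon
    have : u ∈ frontier Ω := by rw [frontier, hΩ.isOpen.interior_eq]; exact ⟨hu, hcon⟩
    have h0 : bdryDist Ω u = 0 := Metric.infDist_zero_of_mem this
    rw [mem_ofPred_eq, h0] at hcu
    linarith
  have hmin : ∀ k (s : Icc 0 M), 0 ≤ min (s : ℝ) (L k) ∧ min (s : ℝ) (L k) ≤ L k := fun k s =>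
    ⟨le_min s.2.1 (hf k).nonneg, min_le_right _ _⟩
  have hlipF : ∀ k (s t : Icc 0 M),
      dist (f k (min (s : ℝ) (L k))) (f k (min (t : ℝ) (L k))) ≤ dist s t := by
    intro k s t
    have := (hf k).lipschitzOnWith.dist_le_mul _ (hmin k s) _ (hmin k t)
    rw [NNReal.coe_one, one_mul] at this
    refine this.trans ?_
    rw [Real.dist_eq, Subtype.dist_eq, Real.dist_eq]
    have := abs_min_sub_min_le_max (s : ℝ) (L k) t (L k)
    simpa using this
  -- The curves are put on the common interval `[0, M]` by resting at their endpoint.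
  let F : ℕ → BoundedContinuousFunction (Icc 0 M) (En n) := fun k =>
    BoundedContinuousFunction.mkOfCompact
      ⟨fun s => f k (min (s : ℝ) (L k)), (LipschitzWith.of_dist_le' (K := 1) (by
        simpa using hlipF k)).continuous⟩
  have hF : ∀ k s, F k s = f k (min (s : ℝ) (L k)) := fun _ _ => rfl
  let A : Set (BoundedContinuousFunction (Icc 0 M) (En n)) :=
    {G | (∀ s, G s ∈ K) ∧ ∀ s t, dist (G s) (G t) ≤ dist s t}
  have hev : ∀ s : Icc 0 M, Continuous fun G : BoundedContinuousFunction (Icc 0 M) (En n) => G s :=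
    fun s => continuous_eval_const s
  have hA : IsCompact A := by
    refine BoundedContinuousFunction.arzela_ascoli₂ K hKc A ?_ (fun G s hG => hG.1 s) ?_
    · have e : A = (⋂ s, {G | G s ∈ K}) ∩ ⋂ s, ⋂ t, {G | dist (G s) (G t) ≤ dist s t} := by
        ext G; simp only [A, mem_ofPred_eq, mem_inter_iff, mem_iInter]
      rw [e]
      exact (isClosed_iInter fun s => hKc.isClosed.preimage (hev s)).inter
        (isClosed_iInter fun s => isClosed_iInter fun t =>
          isClosed_le ((hev s).dist (hev t)) continuous_const)
    · refine (LipschitzWith.uniformEquicontinuous (fun G : A => (G : Icc 0 M → En n)) 1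
        fun G => LipschitzWith.of_dist_le_mul ?_).equicontinuous
      intro s t; rw [NNReal.coe_one, one_mul]; exact G.2.2 s t
  have hmemA : ∀ k, F k ∈ A := fun k =>
    ⟨fun s => ⟨subset_closure ((hf k).mem _ (hmin k s).1 (hmin k s).2),
      hcd k _ (hmin k s).1 (hmin k s).2⟩, hlipF k⟩
  obtain ⟨⟨L₀, F₀⟩, ⟨hL₀, hF₀⟩, φ, hφ, hlim⟩ := (isCompact_Icc.prod hA).tendsto_subseq
    (x := fun k => (L k, F k)) (fun k => ⟨hLM k, hmemA k⟩)
  have hlimL : Tendsto (fun k => L (φ k)) atTop (𝓝 L₀) := (continuous_fst.tendsto _).comp hlim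
  have hlimF : Tendsto (fun k => F (φ k)) atTop (𝓝 F₀) := (continuous_snd.tendsto _).comp hlim
  have hpt : ∀ s, Tendsto (fun k => F (φ k) s) atTop (𝓝 (F₀ s)) := fun s =>
    ((hev s).tendsto _).comp hlimF
  let p : ℝ → Icc 0 M := projIcc 0 M hM0
  have hp : ∀ s ∈ Icc 0 M, (p s : ℝ) = s := fun s hs => by
    simp only [p, projIcc_of_mem hM0 hs]
  have hpm : Measurable p := continuous_projIcc.measurable
  refine ⟨L₀, fun s => F₀ (p s), ⟨hL₀.1, ?_, ?_, ?_, fun t _ _ => hKΩ (hF₀.1 _)⟩, ?_⟩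
  · refine tendsto_nhds_unique (hpt (p 0)) ?_
    refine tendsto_const_nhds.congr fun k => ?_
    rw [hF, hp 0 ⟨le_rfl, hM0⟩, min_eq_left (hf _).nonneg, (hf _).source]
  · have hFL : ∀ k, F (φ k) (p (L (φ k))) = y := fun k => by
      rw [hF, hp _ (hLM _), min_self, (hf _).target]
    refine tendsto_nhds_unique (f := fun k => F (φ k) (p (L₀))) (hpt _) ?_
    rw [tendsto_iff_dist_tendsto_zero]
    refine squeeze_zero (fun _ => dist_nonneg) (g := fun k => dist L₀ (L (φ k))) (fun k => ?_) ?_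
    · have := (hmemA (φ k)).2 (p L₀) (p (L (φ k)))
      rwa [hFL, Subtype.dist_eq, hp _ hL₀, hp _ (hLM _)] at this
    · have := (tendsto_const_nhds (x := L₀)).dist hlimL
      rwa [dist_self] at this
  · intro s t hs hst ht
    have := hF₀.2 (p s) (p t)
    rw [Subtype.dist_eq, hp s ⟨hs, hst.trans (ht.trans hL₀.2)⟩,
      hp t ⟨hs.trans hst, ht.trans hL₀.2⟩, Real.dist_eq, abs_sub_comm, abs_of_nonneg (by linarith)] at this
    exact this
  · have hmeas : ∀ G : BoundedContinuousFunction (Icc 0 M) (En n),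
        Measurable fun s => ENNReal.ofReal (1 / bdryDist Ω (G (p s))) := fun G =>
      ENNReal.measurable_ofReal.comp (measurable_const.div
        (continuous_bdryDist.measurable.comp (G.continuous.measurable.comp hpm)))
    -- Dropping the right endpoint costs nothing and ensures that each remaining s belongs to `[0, L
    -- k]` eventually, so that the integrands converge pointwise.
    have e1 : qhLength Ω L₀ (fun s => F₀ (p s)) = ∫⁻ s, (Ico 0 L₀).indicator
        (fun s => ENNReal.ofReal (1 / bdryDist Ω (F₀ (p s)))) s := by
      rw [lintegral_indicator measurableSet_Ico, qhLength,
        setLIntegral_congr (Ico_ae_eq_Icc (μ := volume) (a := 0) (b := L₀))]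
    have e2 : ∀ k, ∫⁻ s, (Icc 0 (L (φ k))).indicator
        (fun s => ENNReal.ofReal (1 / bdryDist Ω (F (φ k) (p s)))) s = qhLength Ω (L (φ k)) (f (φ k)) := by
      intro k
      rw [lintegral_indicator measurableSet_Icc]
      refine setLIntegral_congr_fun measurableSet_Icc fun s hs => ?_
      simp only [hF]
      rw [hp s ⟨hs.1, hs.2.trans (hLM _).2⟩, min_eq_left hs.2]
    rw [e1]
    calc _ ≤ ∫⁻ s, liminf (fun k => (Icc 0 (L (φ k))).indicator
          (fun s => ENNReal.ofReal (1 / bdryDist Ω (F (φ k) (p s)))) s) atTop := by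
          refine lintegral_mono fun s => ?_
          by_cases hs : s ∈ Ico 0 L₀
          · rw [indicator_of_mem hs]
            have ht : Tendsto (fun k => ENNReal.ofReal (1 / bdryDist Ω (F (φ k) (p s)))) atTop
                (𝓝 (ENNReal.ofReal (1 / bdryDist Ω (F₀ (p s))))) := by
              refine (ENNReal.continuous_ofReal.tendsto _).comp (Tendsto.div tendsto_const_nhds
                ((continuous_bdryDist.tendsto _).comp (hpt _)) ?_)
              exact (bdryDist_pos hn hΩ (hKΩ (hF₀.1 _))).ne'
            have hev : ∀ᶠ k in atTop, ENNReal.ofReal (1 / bdryDist Ω (F (φ k) (p s))) =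
                (Icc 0 (L (φ k))).indicator
                  (fun s => ENNReal.ofReal (1 / bdryDist Ω (F (φ k) (p s)))) s := by
              filter_upwards [hlimL.eventually_const_lt hs.2] with k hk
              rw [indicator_of_mem (show s ∈ Icc 0 (L (φ k)) from ⟨hs.1, hk.le⟩)]
            exact ((ht.congr' hev).liminf_eq).ge
          · rw [indicator_of_notMem hs]; exact bot_le
      _ ≤ liminf (fun k => ∫⁻ s, (Icc 0 (L (φ k))).indicator
          (fun s => ENNReal.ofReal (1 / bdryDist Ω (F (φ k) (p s)))) s) atTop :=
          lintegral_liminf_le fun k => (hmeas _).indicator measurableSet_Icc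
      _ ≤ liminf (fun k => ENNReal.ofReal (κ + 1 / ((φ k : ℕ) + 1))) atTop := by
          refine liminf_le_liminf (Eventually.of_forall fun k => ?_)
          rw [e2]; exact hlen _
      _ = qhDist Ω x y := by
          rw [hκ']
          refine Tendsto.liminf_eq ((ENNReal.continuous_ofReal.tendsto _).comp ?_)
          have := (tendsto_one_div_add_atTop_nhds_zero_nat (𝕜 := ℝ)).comp hφ.tendsto_atTop
          simpa using this.const_add κ

end QH

/-! ### Part (1): from ball separation and LC-2 to the length John property -/

namespace QH
variable {n : ℕ} {Ω : Set (En n)} {φ : ℝ → ℝ}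

/-! ### Gauges -/

theorem _root_.IsGauge.exists_eq (h : IsGauge φ) {s : ℝ} (hs : 0 ≤ s) : ∃ t, 0 ≤ t ∧ φ t = s := by
  rcases hs.eq_or_lt with rfl | hs
  · exact ⟨0, le_rfl, h.map_zero⟩
  · have := intermediate_value_Icc hs.le (h.continuousOn.mono Icc_subset_Ici_self)
    rw [h.map_zero] at this
    obtain ⟨t, ht, e⟩ := this ⟨hs.le, h.le_self s hs⟩
    exact ⟨t, ht.1, e⟩

theorem _root_.IsGauge.inv_nonneg (h : IsGauge φ) {s : ℝ} (hs : 0 ≤ s) : 0 ≤ gaugeInv φ s :=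
  Function.invFunOn_mem (h.exists_eq hs)

theorem _root_.IsGauge.apply_inv (h : IsGauge φ) {s : ℝ} (hs : 0 ≤ s) : φ (gaugeInv φ s) = s :=
  Function.invFunOn_eq (h.exists_eq hs)

theorem _root_.IsGauge.mono (h : IsGauge φ) {s t : ℝ} (hs : 0 ≤ s) (hst : s ≤ t) : φ s ≤ φ t :=
  h.strictMonoOn.monotoneOn hs (mem_Ici.mpr (hs.trans hst)) hst

theorem _root_.IsGauge.lt_of_lt (h : IsGauge φ) {s t : ℝ} (ht : 0 ≤ t) (hst : φ s < φ t)
    (hs : 0 ≤ s) : s < t :=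
  (h.strictMonoOn.lt_iff_lt hs ht).mp hst

theorem _root_.IsGauge.nonneg (h : IsGauge φ) {t : ℝ} (ht : 0 ≤ t) : 0 ≤ φ t :=
  h.map_zero ▸ h.mono le_rfl ht

theorem _root_.IsGauge.le_apply (h : IsGauge φ) {t : ℝ} (ht : 0 ≤ t) : t ≤ φ t := by
  rcases ht.eq_or_lt with rfl | ht
  · exact h.map_zero.ge
  · exact h.le_self t ht

theorem _root_.IsGauge.inv_le_self (h : IsGauge φ) {s : ℝ} (hs : 0 ≤ s) : gaugeInv φ s ≤ s :=
  (h.le_apply (h.inv_nonneg hs)).trans_eq (h.apply_inv hs)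

theorem _root_.IsGauge.inv_pos (h : IsGauge φ) {s : ℝ} (hs : 0 < s) : 0 < gaugeInv φ s := by
  refine h.lt_of_lt (h.inv_nonneg hs.le) ?_ le_rfl
  rwa [h.map_zero, h.apply_inv hs.le]

theorem _root_.IsGauge.inv_mono (h : IsGauge φ) {s t : ℝ} (hs : 0 ≤ s) (hst : s ≤ t) :
    gaugeInv φ s ≤ gaugeInv φ t := by
  by_contra hlt
  push Not at hlt
  have := h.strictMonoOn (h.inv_nonneg (hs.trans hst)) (h.inv_nonneg hs) hlt
  rw [h.apply_inv hs, h.apply_inv (hs.trans hst)] at this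
  linarith

theorem _root_.IsGauge.inv_lt (h : IsGauge φ) {s t : ℝ} (hs : 0 ≤ s) (ht : 0 ≤ t) (hst : s < φ t) :
    gaugeInv φ s < t :=
  h.lt_of_lt ht (by rwa [h.apply_inv hs]) (h.inv_nonneg hs)

theorem one_le_etaIntegrand (h : IsGauge φ) {s : ℝ} (hs : 0 < s) : 1 ≤ etaIntegrand n φ s :=
  one_le_pow₀ ((one_le_div (h.inv_pos hs)).mpr (h.inv_le_self hs.le))

theorem etaIntegrand_intervalIntegrable (hc : EtaConverges n φ) {a b : ℝ} (ha : 0 ≤ a)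
    (hb : 0 ≤ b) : IntervalIntegrable (etaIntegrand n φ) volume a b := by
  have key : ∀ c, 0 ≤ c → IntervalIntegrable (etaIntegrand n φ) volume 0 c := fun c hc0 => by
    rcases hc0.eq_or_lt with rfl | hc0
    · exact IntervalIntegrable.refl
    · exact hc c hc0
  exact (key a ha).symm.trans (key b hb)

/-- Numerator and φ⁻¹ are both monotone, so the integrand is bounded below by the left value of one
over the right value of the other. -/
theorem mul_le_integral_etaIntegrand (h : IsGauge φ) (hc : EtaConverges n φ) {a b : ℝ}
    (ha : 0 < a) (hab : a ≤ b) :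
    (b - a) * (a / gaugeInv φ b) ^ (n - 1) ≤ ∫ s in a..b, etaIntegrand n φ s := by
  have := intervalIntegral.integral_mono_on hab (intervalIntegrable_const (c := (a / gaugeInv φ b) ^ (n - 1)))
    (etaIntegrand_intervalIntegrable hc ha.le (ha.le.trans hab)) fun s hs => by
      have hs0 : 0 < s := ha.trans_le hs.1
      refine pow_le_pow_left₀ (div_nonneg ha.le (h.inv_nonneg (ha.le.trans hab))) ?_ _
      exact div_le_div₀ hs0.le hs.1 (h.inv_pos hs0) (h.inv_mono hs0.le hs.2)
  rwa [intervalIntegral.integral_const, smul_eq_mul] at this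

theorem sub_le_integral_etaIntegrand (h : IsGauge φ) (hc : EtaConverges n φ) {a b : ℝ}
    (ha : 0 ≤ a) (hab : a ≤ b) : b - a ≤ ∫ s in a..b, etaIntegrand n φ s := by
  have := intervalIntegral.integral_mono_on_of_le_Ioo hab (intervalIntegrable_const (c := (1 : ℝ)))
    (etaIntegrand_intervalIntegrable hc ha (ha.trans hab))
    fun s hs => one_le_etaIntegrand h (ha.trans_lt hs.1)
  rwa [intervalIntegral.integral_const, smul_eq_mul, mul_one] at this

theorem integral_etaIntegrand_mono (h : IsGauge φ) (hc : EtaConverges n φ) {a b : ℝ}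
    (ha : 0 ≤ a) (hab : a ≤ b) :
    ∫ s in (0 : ℝ)..a, etaIntegrand n φ s ≤ ∫ s in (0 : ℝ)..b, etaIntegrand n φ s := by
  rw [← intervalIntegral.integral_add_adjacent_intervals
    (etaIntegrand_intervalIntegrable hc le_rfl ha)
    (etaIntegrand_intervalIntegrable hc ha (ha.trans hab))]
  have := sub_le_integral_etaIntegrand h hc ha hab
  linarith

theorem isGauge_etaFun (h : IsGauge φ) (hc : EtaConverges n φ) {C : ℝ} (hC : 1 ≤ C) :
    IsGauge (etaFun n φ C) := by
  have hC0 : 0 < C := by linarith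
  refine ⟨?_, ?_, ?_, ?_⟩
  · intro t ht
    have ht : 0 ≤ t := ht
    set T := φ (C * (t + 1)) with hT
    have hprim : ContinuousOn (fun x => ∫ s in (0 : ℝ)..x, etaIntegrand n φ s) (Icc 0 T) := by
      have hT0 : 0 ≤ T := h.nonneg (by positivity)
      have := intervalIntegral.continuousOn_primitive_interval' (μ := volume)
        (etaIntegrand_intervalIntegrable (n := n) hc le_rfl hT0) left_mem_uIcc
      rwa [uIcc_of_le hT0] at this
    have hco : ContinuousOn (etaFun n φ C) (Icc 0 (t + 1)) := by
      refine ContinuousOn.mul continuousOn_const (hprim.comp ?_ ?_)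
      · exact h.continuousOn.comp (by fun_prop) fun s hs => mul_nonneg hC0.le hs.1
      · intro s hs
        exact ⟨h.nonneg (mul_nonneg hC0.le hs.1), h.mono (mul_nonneg hC0.le hs.1)
          (mul_le_mul_of_nonneg_left hs.2 hC0.le)⟩
    have := hco t ⟨ht, by linarith⟩
    refine this.mono_of_mem_nhdsWithin ?_
    filter_upwards [self_mem_nhdsWithin, mem_nhdsWithin_of_mem_nhds (Iio_mem_nhds (lt_add_one t))]
      with s h1 h2
    exact ⟨h1, le_of_lt h2⟩
  · intro s hs t ht hst
    have hs : 0 ≤ s := hs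
    have h1 : φ (C * s) < φ (C * t) := h.strictMonoOn (mul_nonneg hC0.le hs)
      (mul_nonneg hC0.le (hs.trans hst.le)) (mul_lt_mul_of_pos_left hst hC0)
    have h0 : 0 ≤ φ (C * s) := h.nonneg (mul_nonneg hC0.le hs)
    refine mul_lt_mul_of_pos_left ?_ hC0
    rw [← intervalIntegral.integral_add_adjacent_intervals
      (etaIntegrand_intervalIntegrable hc le_rfl h0)
      (etaIntegrand_intervalIntegrable hc h0 (h0.trans h1.le))]
    have := sub_le_integral_etaIntegrand (n := n) h hc h0 h1.le
    linarith
  · simp [etaFun, h.map_zero]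
  · intro t ht
    have h1 := sub_le_integral_etaIntegrand (n := n) h hc le_rfl (h.nonneg (mul_nonneg hC0.le ht.le))
    have h2 := h.le_apply (mul_nonneg hC0.le ht.le)
    have h3 : t ≤ C * t := le_mul_of_one_le_left ht.le hC
    rw [etaFun]
    nlinarith

/-! ### The diameter estimate -/

theorem joinedIn_of_arc {x y : En n} {L : ℝ} {g : ℝ → En n} (h : LipCurve Ω x y L g) {a b : ℝ}
    (ha : 0 ≤ a) (hab : a ≤ b) (hb : b ≤ L) {S : Set (En n)} (hS : ∀ t ∈ Icc a b, g t ∈ S) :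
    JoinedIn S (g a) (g b) := by
  have hp : IsPathConnected (g '' Icc a b) :=
    ((convex_Icc a b).isPathConnected (nonempty_Icc.mpr hab)).image'
      (h.continuousOn.mono (Icc_subset_Icc ha hb))
  refine (hp.joinedIn _ (mem_image_of_mem g ⟨le_rfl, hab⟩) _ (mem_image_of_mem g ⟨hab, le_rfl⟩)).mono ?_
  rintro _ ⟨t, ht, rfl⟩
  exact hS t ht

/-- Intrinsic balls lie in Euclidean balls. This weaker, Euclidean form of separation is the one
that can be played against LC-2. -/
theorem not_joinedIn_of_hasBallSeparation {C₀ : ℝ} (hsep : HasBallSeparation C₀ Ω) {x y : En n}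
    {L : ℝ} {g : ℝ → En n} (hg : IsQHGeodesic Ω x y L g) {t : ℝ} (ht : t ∈ Icc 0 L) :
    ¬ JoinedIn (Ω \ Metric.ball (g t) (C₀ * bdryDist Ω (g t))) x y := by
  rintro ⟨γ, hγ⟩
  have hx := hg.lipCurve.mem 0 le_rfl hg.lipCurve.nonneg
  have hy := hg.lipCurve.mem L hg.lipCurve.nonneg le_rfl
  rw [hg.lipCurve.source] at hx
  rw [hg.lipCurve.target] at hy
  obtain ⟨w, hw, s, rfl⟩ := hsep x hx y hy L g hg _ (mem_image_of_mem g ht) γ fun t => (hγ t).1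
  exact (hγ s).2 (innerBall_subset_ball _ _ hw)

theorem exists_dist_ge_half_diam (hn : 1 ≤ n) (hΩ : IsBoundedDomain Ω) :
    0 < Metric.diam Ω ∧ ∃ p ∈ Ω, ∃ q ∈ Ω, Metric.diam Ω / 2 < dist p q := by
  obtain ⟨u, hu⟩ := hΩ.isConnected.nonempty
  obtain ⟨ε, hε, hsub⟩ := Metric.isOpen_iff.mp hΩ.isOpen u hu
  have : Nonempty (Fin n) := ⟨⟨0, hn⟩⟩
  have : Nontrivial (En n) := by infer_instance
  obtain ⟨v, hv⟩ := exists_norm_eq (En n) (half_pos hε).le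
  have hvΩ : u + v ∈ Ω := hsub (by rw [Metric.mem_ball, dist_self_add_left, hv]; linarith)
  have hpos : 0 < Metric.diam Ω := by
    refine lt_of_lt_of_le (half_pos hε) ?_
    have := Metric.dist_le_diam_of_mem hΩ.isBounded hu hvΩ
    rwa [dist_self_add_right, hv] at this
  refine ⟨hpos, ?_⟩
  by_contra hcon
  push Not at hcon
  have := Metric.diam_le_of_forall_dist_le (by positivity) hcon
  linarith

/-- The center is the point equidistant from p and q on a geodesic `g₁` between points p, q more
than half the diameter apart. If y = `g s` is too far from z = `g t`, ball separation says that y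
and the center cannot be joined outside B(z, r), r = C₀ d(z). By LC-2 the center is then close to z.
One of p, q is still outside B(z, φ(r)); LC-2 leads from y to it, and `g₁` leads on to the center.
That path must hit B(z, r) on `g₁`, near the center, where `g₁` is far from the boundary compared
with d(z): a contradiction. -/
theorem exists_center (hn : 1 ≤ n) (hΩ : IsBoundedDomain Ω) {C₀ : ℝ} (hC₀ : 0 < C₀)
    (hsep : HasBallSeparation C₀ Ω) (hφ : IsGauge φ) (hlc : IsLC2 φ Ω) :
    ∃ x₀ ∈ Ω, ∀ x L g, IsQHGeodesic Ω x x₀ L g → ∀ s t, 0 ≤ s → s ≤ t → t ≤ L →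
      dist (g s) (g t) ≤ 100 * φ ((1 + C₀) ^ 2 * bdryDist Ω (g t)) := by
  obtain ⟨hΔ, p, hp, q, hq, hpq⟩ := exists_dist_ge_half_diam hn hΩ
  set Δ := Metric.diam Ω with hΔdef
  obtain ⟨L₁, g₁, hg₁⟩ := exists_geodesic hn hΩ hp hq
  have hc₁ := hg₁.lipCurve
  have hmid : ∃ t₁ ∈ Icc 0 L₁, dist (g₁ t₁) p = dist (g₁ t₁) q := by
    have hcont : ContinuousOn (fun t => dist (g₁ t) p - dist (g₁ t) q) (Icc 0 L₁) :=
      ((continuous_id.dist continuous_const).comp_continuousOn hc₁.continuousOn).sub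
        ((continuous_id.dist continuous_const).comp_continuousOn hc₁.continuousOn)
    have := intermediate_value_Icc hc₁.nonneg hcont
    simp only [hc₁.source, hc₁.target, dist_self, zero_sub, sub_zero] at this
    obtain ⟨t, ht, e⟩ := this (show (0 : ℝ) ∈ _ from
      ⟨neg_nonpos.mpr dist_nonneg, dist_nonneg⟩)
    exact ⟨t, ht, sub_eq_zero.mp e⟩
  obtain ⟨t₁, ht₁, heq⟩ := hmid
  set x₀ := g₁ t₁ with hx₀
  have hx₀Ω : x₀ ∈ Ω := hc₁.mem t₁ ht₁.1 ht₁.2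
  have hx₀p : Δ / 4 < dist x₀ p := by
    have := dist_triangle_left p q x₀; linarith
  -- Otherwise LC-2 would join p to q outside the ball that separates them.
  have hmiddle : ∀ t ∈ Icc 0 L₁, Δ / 8 ≤ dist (g₁ t) p → Δ / 8 ≤ dist (g₁ t) q →
      Δ / 8 < φ (C₀ * bdryDist Ω (g₁ t)) := by
    intro t ht h1 h2
    by_contra hle
    push Not at hle
    have hpos := bdryDist_pos hn hΩ (hc₁.mem t ht.1 ht.2)
    refine not_joinedIn_of_hasBallSeparation hsep hg₁ ht
      (hlc (g₁ t) (C₀ * bdryDist Ω (g₁ t)) (by positivity) p ⟨hp, ?_⟩ q ⟨hq, ?_⟩)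
    · rw [Metric.mem_ball, not_lt, dist_comm]; linarith
    · rw [Metric.mem_ball, not_lt, dist_comm]; linarith
  refine ⟨x₀, hx₀Ω, fun x L g hg s t hs hst ht => ?_⟩
  have hc := hg.lipCurve
  have hzΩ : g t ∈ Ω := hc.mem t (hs.trans hst) ht
  have hyΩ : g s ∈ Ω := hc.mem s hs (hst.trans ht)
  set z := g t with hz
  set y := g s with hy
  set d := bdryDist Ω z with hd
  have hd0 : 0 < d := bdryDist_pos hn hΩ hzΩ
  by_contra hfar
  push Not at hfar
  have hyz : dist y z ≤ Δ := Metric.dist_le_diam_of_mem hΩ.isBounded hyΩ hzΩ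
  have hsmall : φ ((1 + C₀) ^ 2 * d) < Δ / 100 := by linarith
  set r := C₀ * d with hr
  have hr0 : 0 < r := by positivity
  have hφr : φ r ≤ φ ((1 + C₀) ^ 2 * d) := hφ.mono hr0.le (by rw [hr]; nlinarith)
  have hrφ : r ≤ φ r := hφ.le_apply hr0.le
  have hgL : g L = x₀ := hc.target
  have hnot : ¬ JoinedIn (Ω \ Metric.ball z r) y x₀ := by
    have h1 := not_joinedIn_of_hasBallSeparation hsep (hg.sub hn hΩ hs (hst.trans ht) le_rfl)
      (t := t - s) ⟨by linarith, by linarith⟩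
    simp only [sub_add_cancel] at h1
    rw [← hgL]; exact h1
  have hyout : y ∈ Ω \ Metric.ball z (φ r) := by
    refine ⟨hyΩ, ?_⟩
    rw [Metric.mem_ball, not_lt]
    have := hφ.nonneg (show 0 ≤ (1 + C₀) ^ 2 * d by positivity)
    linarith
  have hx₀z : dist x₀ z < φ r := by
    by_contra hge
    exact hnot (hlc z r hr0 y hyout x₀ ⟨hx₀Ω, by rwa [Metric.mem_ball]⟩)
  -- an arc of `g₁` from an end point outside the ball leads to `x₀`
  have harc : ∀ e ∈ Ω \ Metric.ball z (φ r), ∀ a b, 0 ≤ a → a ≤ b → b ≤ L₁ →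
      (g₁ a = e ∧ g₁ b = x₀ ∨ g₁ a = x₀ ∧ g₁ b = e) → False := by
    intro e he a b ha hab hb hends
    by_cases havoid : ∀ τ ∈ Icc a b, g₁ τ ∉ Metric.ball z r
    · have hj : JoinedIn (Ω \ Metric.ball z r) (g₁ a) (g₁ b) :=
        joinedIn_of_arc hc₁ ha hab hb fun τ hτ =>
          ⟨hc₁.mem τ (ha.trans hτ.1) (hτ.2.trans hb), havoid τ hτ⟩
      have hye := hlc z r hr0 y hyout e he
      rcases hends with ⟨h1, h2⟩ | ⟨h1, h2⟩
      · rw [h1, h2] at hj; exact hnot (hye.trans hj)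
      · rw [h1, h2] at hj; exact hnot (hye.trans hj.symm)
    · push Not at havoid
      obtain ⟨τ, hτ, hw⟩ := havoid
      rw [Metric.mem_ball] at hw
      have hτL : τ ∈ Icc 0 L₁ := ⟨ha.trans hτ.1, hτ.2.trans hb⟩
      have h1 : dist (g₁ τ) x₀ < Δ / 50 := by
        have := dist_triangle_right (g₁ τ) x₀ z; linarith
      have h2 := dist_triangle_left x₀ p (g₁ τ)
      have h3 := dist_triangle_left x₀ q (g₁ τ)
      have h4 := hmiddle τ hτL (by linarith) (by linarith)
      -- Since d + r = (1 + C₀) d, the separating radius at `g₁ τ` is at most C₀ (1 + C₀) d; this is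
      -- the origin of the factor (1 + C₀)².
      have h5 : bdryDist Ω (g₁ τ) ≤ d + r := by
        have := bdryDist_le_add (Ω := Ω) (g₁ τ) z; linarith
      have h6 : φ (C₀ * bdryDist Ω (g₁ τ)) ≤ φ ((1 + C₀) ^ 2 * d) := by
        refine hφ.mono (mul_nonneg hC₀.le Metric.infDist_nonneg) ?_
        have := mul_le_mul_of_nonneg_left h5 hC₀.le
        rw [hr] at this
        nlinarith
      linarith
  by_cases hpz : p ∈ Metric.ball z (φ r)
  · have hqz : q ∉ Metric.ball z (φ r) := fun hqz => by
      rw [Metric.mem_ball] at hpz hqz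
      have := dist_triangle_right p q z
      linarith
    exact harc q ⟨hq, hqz⟩ t₁ L₁ ht₁.1 ht₁.2 le_rfl (Or.inr ⟨rfl, hc₁.target⟩)
  · exact harc p ⟨hp, hpz⟩ 0 t₁ le_rfl ht₁.1 ht₁.2 (Or.inl ⟨hc₁.source, rfl⟩)

end QH

namespace QH
variable {n : ℕ} {Ω : Set (En n)} {φ : ℝ → ℝ}

theorem dist_le_card_mul {u v : En n} {h : ℝ} (hh : 0 ≤ h) (huv : ∀ l, |u l - v l| ≤ h) :
    dist u v ≤ n * h := by
  rw [EuclideanSpace.dist_eq]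
  refine (Real.sqrt_le_left (by positivity)).mpr ?_
  calc ∑ l, dist (u l) (v l) ^ 2 ≤ ∑ _l : Fin n, h ^ 2 :=
        Finset.sum_le_sum fun l _ => pow_le_pow_left₀ dist_nonneg (huv l) 2
    _ = n * h ^ 2 := by simp
    _ ≤ (n * h) ^ 2 := by
        rw [mul_pow]
        refine mul_le_mul_of_nonneg_right ?_ (sq_nonneg h)
        exact_mod_cast Nat.le_self_pow two_ne_zero n

theorem abs_sub_le_dist (u v : En n) (l : Fin n) : |u l - v l| ≤ dist u v := by
  rw [dist_eq_norm]
  exact PiLp.norm_apply_le (u - v) l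

/-! ### The length estimate -/

/-- The part of a geodesic inside a ball of radius `R` and at distance at least `δ` from the
boundary. -/
theorem volume_le_of_bdryDist_ge (hn : 1 ≤ n) (hΩ : IsBoundedDomain Ω) {x y : En n} {L : ℝ}
    {g : ℝ → En n} (hg : IsQHGeodesic Ω x y L g) {S : Set ℝ} (hS : S ⊆ Icc 0 L) {R δ : ℝ}
    (hδ : 0 < δ) (hδR : δ ≤ R) (c : En n) (hR : ∀ s ∈ S, dist (g s) c ≤ R)
    (hd : ∀ s ∈ S, δ ≤ bdryDist Ω (g s)) :
    volume S ≤ ENNReal.ofReal ((20 * n) ^ n * (R * (R / δ) ^ (n - 1))) := by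
  have hn0 : (1 : ℝ) ≤ n := by exact_mod_cast hn
  -- Grid cells of side h have diameter at most n h = δ/4, the range of
  -- `IsQHGeodesic.arc_le_two_mul_dist`. So the parameters with values in one cell span at most δ/2.
  set h := δ / (4 * n) with hh
  have hh0 : 0 < h := by positivity
  have hhR : h ≤ R := by
    refine le_trans ?_ hδR
    rw [hh, div_le_iff₀ (by positivity)]; nlinarith
  set N : ℤ := ⌈R / h⌉ with hN
  let cell : ℝ → Fin n → ℤ := fun s l => ⌊(g s l - c l) / h⌋
  have hR0 : 0 < R := hδ.trans_le hδR
  have hcell : ∀ s ∈ S, cell s ∈ Fintype.piFinset fun _ : Fin n => Finset.Icc (-N) N := by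
    intro s hs
    rw [Fintype.mem_piFinset]
    intro l
    have h1 := abs_le.mp ((abs_sub_le_dist (g s) c l).trans (hR s hs))
    rw [Finset.mem_Icc]
    constructor
    · rw [Int.le_floor, Int.cast_neg, neg_le, ← neg_div]
      refine le_trans ?_ (Int.le_ceil (R / h))
      gcongr; linarith
    · have h2 : (g s l - c l) / h ≤ R / h := by gcongr; exact h1.2
      have h3 : ((cell s l : ℤ) : ℝ) ≤ N := (Int.floor_le _).trans (h2.trans (Int.le_ceil _))
      exact_mod_cast h3
  have hfib : ∀ k, volume {s ∈ S | cell s = k} ≤ ENNReal.ofReal (δ / 2) := by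
    intro k
    refine (Real.volume_le_diam _).trans (Metric.ediam_le ?_)
    have key : ∀ s ∈ {s ∈ S | cell s = k}, ∀ t ∈ {s ∈ S | cell s = k}, s ≤ t → t - s ≤ δ / 2 := by
      rintro s ⟨hs, hks⟩ t ⟨ht, hkt⟩ hst
      have hdist : dist (g s) (g t) ≤ δ / 4 := by
        have : dist (g s) (g t) ≤ n * h := by
          refine dist_le_card_mul hh0.le fun l => ?_
          have e : ⌊(g s l - c l) / h⌋ = ⌊(g t l - c l) / h⌋ := congr_fun (hks.trans hkt.symm) l
          have := Int.abs_sub_lt_one_of_floor_eq_floor e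
          rw [← sub_div, sub_sub_sub_cancel_right, abs_div, abs_of_pos hh0, div_lt_one hh0] at this
          exact this.le
        refine this.trans_eq ?_
        rw [hh]; field_simp
      have := hg.arc_le_two_mul_dist hn hΩ (hS hs).1 hst (hS ht).2 (by linarith [hd s hs])
      linarith
    intro s hs t ht
    rw [edist_dist, Real.dist_eq]
    refine ENNReal.ofReal_le_ofReal ?_
    rcases le_total s t with hst | hst
    · rw [abs_sub_comm, abs_of_nonneg (by linarith)]; exact key s hs t ht hst
    · rw [abs_of_nonneg (by linarith)]; exact key t ht s hs hst
  have hcover : S ⊆ ⋃ k ∈ Fintype.piFinset fun _ : Fin n => Finset.Icc (-N) N,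
      {s ∈ S | cell s = k} := fun s hs => mem_biUnion (hcell s hs) ⟨hs, rfl⟩
  have hN0 : 0 ≤ N := Int.ceil_nonneg (by positivity)
  -- 2N + 1 ≤ 2R/h + 3 ≤ 5R/h, because h ≤ R.
  have hNle : ((2 * N + 1 : ℤ) : ℝ) ≤ 20 * n * (R / δ) := by
    have h1 := (Int.ceil_lt_add_one (R / h)).le
    have h2 : 1 ≤ R / h := (one_le_div hh0).mpr hhR
    have h3 : 20 * n * (R / δ) = 5 * (R / h) := by rw [hh]; field_simp; ring
    rw [h3]; push_cast; linarith
  calc volume S ≤ ∑ k ∈ Fintype.piFinset fun _ : Fin n => Finset.Icc (-N) N,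
        volume {s ∈ S | cell s = k} := (measure_mono hcover).trans (measure_biUnion_finset_le _ _)
    _ ≤ ∑ _k ∈ Fintype.piFinset fun _ : Fin n => Finset.Icc (-N) N, ENNReal.ofReal (δ / 2) :=
        Finset.sum_le_sum fun k _ => hfib k
    _ = ENNReal.ofReal (((2 * N + 1 : ℤ) : ℝ) ^ n * (δ / 2)) := by
        rw [Finset.sum_const, Fintype.card_piFinset_const, Int.card_Icc, nsmul_eq_mul,
          ENNReal.ofReal_mul (by positivity)]
        congr 1
        have : ((N + 1 - -N).toNat : ℤ) = 2 * N + 1 := by omega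
        rw [Nat.cast_pow, ENNReal.ofReal_pow (by positivity)]
        congr 1
        rw [← this, Int.cast_natCast, ENNReal.ofReal_natCast]
    _ ≤ ENNReal.ofReal ((20 * n) ^ n * (R * (R / δ) ^ (n - 1))) := by
        refine ENNReal.ofReal_le_ofReal ?_
        have h1 : ((2 * N + 1 : ℤ) : ℝ) ^ n ≤ (20 * n * (R / δ)) ^ n :=
          pow_le_pow_left₀ (by positivity) hNle n
        have h2 : (20 * n * (R / δ)) ^ n * δ = (20 * n) ^ n * (R * (R / δ) ^ (n - 1)) := by
          obtain ⟨m, rfl⟩ : ∃ m, n = m + 1 := ⟨n - 1, by omega⟩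
          rw [mul_pow, pow_succ (R / δ), Nat.add_sub_cancel]
          field_simp
        have h3 : 0 ≤ (20 * n * (R / δ)) ^ n := by positivity
        nlinarith

/-- The arc before t is cut into the dyadic shells 100 r_j < |g(s) - g(0)| ≤ 200 r_j with r_j = 2⁻ʲ
φ(C₁ d). In the j-th shell the diameter bound for the arc from 0 to s gives d(g(s)) > φ⁻¹(r_j)/C₁,
and the counting estimate bounds the length there by a multiple of the integral over [r_j/2, r_j].
These integrals telescope. -/
theorem arc_length_le_integral (hn : 1 ≤ n) (hΩ : IsBoundedDomain Ω) (hφ : IsGauge φ)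
    (hconv : EtaConverges n φ) {C₁ : ℝ} (hC₁ : 1 ≤ C₁) {x y : En n} {L : ℝ} {g : ℝ → En n}
    (hg : IsQHGeodesic Ω x y L g)
    (hdiam : ∀ s t, 0 ≤ s → s ≤ t → t ≤ L → dist (g s) (g t) ≤ 100 * φ (C₁ * bdryDist Ω (g t)))
    {t : ℝ} (ht0 : 0 ≤ t) (htL : t ≤ L) :
    t ≤ (20 * n) ^ n * 400 * (400 * C₁) ^ (n - 1) *
      ∫ s in (0 : ℝ)..φ (C₁ * bdryDist Ω (g t)), etaIntegrand n φ s := by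
  have hc := hg.lipCurve
  set d := bdryDist Ω (g t) with hd
  have hd0 : 0 < d := bdryDist_pos hn hΩ (hc.mem t ht0 htL)
  set r₀ := φ (C₁ * d) with hr₀
  have hr₀0 : 0 < r₀ := lt_of_lt_of_le (by positivity) (hφ.le_apply (by positivity))
  set r : ℕ → ℝ := fun j => r₀ / 2 ^ j with hr
  have hrpos : ∀ j, 0 < r j := fun j => by positivity
  have hrsucc : ∀ j, r (j + 1) = r j / 2 := fun j => by simp only [hr, pow_succ]; field_simp
  set K := (20 * n : ℝ) ^ n * 400 * (400 * C₁) ^ (n - 1) with hK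
  have hK0 : 0 ≤ K := by positivity
  set S : ℕ → Set ℝ := fun j =>
    {s ∈ Icc 0 t | 200 * r (j + 1) < dist (g s) (g 0) ∧ dist (g s) (g 0) ≤ 200 * r j} with hS
  have hSvol : ∀ j, volume (S j) ≤
      ENNReal.ofReal (K * ∫ s in r (j + 1)..r j, etaIntegrand n φ s) := by
    intro j
    have hψ := hφ.inv_pos (hrpos j)
    have hψr := hφ.inv_le_self (hrpos j).le
    have hδ : gaugeInv φ (r j) / C₁ ≤ 200 * r j := by
      rw [div_le_iff₀ (by linarith)]; nlinarith [hrpos j]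
    refine (volume_le_of_bdryDist_ge hn hΩ hg (S := S j)
      (fun s hs => ⟨hs.1.1, hs.1.2.trans htL⟩) (div_pos hψ (by linarith)) hδ (g 0)
      (fun s hs => hs.2.2) ?_).trans (ENNReal.ofReal_le_ofReal ?_)
    · rintro s ⟨hs, h1, -⟩
      have h2 := hdiam 0 s le_rfl hs.1 (hs.2.trans htL)
      rw [dist_comm] at h2
      rw [hrsucc] at h1
      have h3 : gaugeInv φ (r j) < C₁ * bdryDist Ω (g s) :=
        hφ.inv_lt (hrpos j).le (mul_nonneg (by linarith) Metric.infDist_nonneg) (by linarith)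
      rw [div_le_iff₀ (by linarith)]; linarith
    · have h1 := mul_le_integral_etaIntegrand (n := n) hφ hconv (hrpos (j + 1))
        (show r (j + 1) ≤ r j by rw [hrsucc]; linarith [hrpos j])
      refine le_trans (le_of_eq ?_) (mul_le_mul_of_nonneg_left h1 hK0)
      rw [hrsucc, hK]
      -- R/δ is expressed by the left endpoint r_j/2 of the interval of integration, as in
      -- `mul_le_integral_etaIntegrand`; the other factor R = 200 r_j is 400 times the length of
      -- that interval.
      have e1 : 200 * r j / (gaugeInv φ (r j) / C₁) =
          400 * C₁ * (r j / 2 / gaugeInv φ (r j)) := by field_simp; ring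
      rw [e1, mul_pow (400 * C₁)]
      ring
  have hcover : Icc 0 t ⊆ (⋃ j, S j) ∪ {s ∈ Icc 0 t | g s = g 0} := by
    intro s hs
    by_cases hzero : g s = g 0
    · exact Or.inr ⟨hs, hzero⟩
    · left
      have hpos : 0 < dist (g s) (g 0) := dist_pos.mpr hzero
      have htop : dist (g s) (g 0) ≤ 200 * r₀ := by
        have h1 := hdiam 0 t le_rfl ht0 htL
        have h2 := hdiam s t hs.1 hs.2 htL
        have := dist_triangle_right (g s) (g 0) (g t)
        linarith
      obtain ⟨j, hj1, hj2⟩ := exists_nat_pow_near_of_lt_one (x := dist (g s) (g 0) / (200 * r₀))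
        (y := 1 / 2) (by positivity) ((div_le_one (by positivity)).mpr htop) (by norm_num) (by norm_num)
      refine mem_iUnion.mpr ⟨j, hs, ?_, ?_⟩
      · rw [lt_div_iff₀ (by positivity)] at hj1
        refine lt_of_le_of_lt (le_of_eq ?_) hj1
        simp only [hr, one_div, inv_pow]; ring
      · rw [div_le_iff₀ (by positivity)] at hj2
        refine hj2.trans (le_of_eq ?_)
        simp only [hr, one_div, inv_pow]; ring
  -- The shells miss only returns to the starting point, and local quasiconvexity excludes these.
  have hnull : volume {s ∈ Icc 0 t | g s = g 0} = 0 := by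
    refine Set.Subsingleton.measure_zero ?_ _
    have key : ∀ s ∈ {s ∈ Icc 0 t | g s = g 0}, s ≤ 0 := by
      rintro s ⟨hs, he⟩
      have := hg.arc_le_two_mul_dist hn hΩ le_rfl hs.1 (hs.2.trans htL)
        (by rw [he, dist_self]; exact div_nonneg Metric.infDist_nonneg (by norm_num))
      rw [he, dist_self] at this
      linarith
    exact fun s hs s' hs' =>
      (le_antisymm (key s hs) hs.1.1).trans (le_antisymm (key s' hs') hs'.1.1).symm
  have htot : ENNReal.ofReal t ≤ ENNReal.ofReal (K * ∫ s in (0 : ℝ)..r₀, etaIntegrand n φ s) := by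
    calc ENNReal.ofReal t = volume (Icc 0 t) := by rw [Real.volume_Icc, sub_zero]
      _ ≤ ∑' j, volume (S j) := by
          refine (measure_mono hcover).trans ((measure_union_le _ _).trans ?_)
          rw [hnull, add_zero]
          exact measure_iUnion_le _
      _ ≤ ∑' j, ENNReal.ofReal (K * ∫ s in r (j + 1)..r j, etaIntegrand n φ s) :=
          ENNReal.tsum_le_tsum hSvol
      _ ≤ _ := by
          refine ENNReal.tsum_le_of_sum_range_le fun m => ?_
          have hint0 : ∀ j, 0 ≤ ∫ s in r (j + 1)..r j, etaIntegrand n φ s := fun j => by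
            have h1 : r (j + 1) ≤ r j := by rw [hrsucc]; linarith [hrpos j]
            have := sub_le_integral_etaIntegrand (n := n) hφ hconv (hrpos _).le h1
            linarith
          rw [← ENNReal.ofReal_sum_of_nonneg fun j _ => mul_nonneg hK0 (hint0 j), ← Finset.mul_sum]
          refine ENNReal.ofReal_le_ofReal (mul_le_mul_of_nonneg_left ?_ hK0)
          have hsum : ∀ m, ∑ j ∈ Finset.range m, ∫ s in r (j + 1)..r j, etaIntegrand n φ s =
              (∫ s in (0 : ℝ)..r₀, etaIntegrand n φ s) - ∫ s in (0 : ℝ)..r m, etaIntegrand n φ s := by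
            intro m
            induction m with
            | zero => simp [hr]
            | succ m ih =>
              rw [Finset.sum_range_succ, ih, ← intervalIntegral.integral_add_adjacent_intervals
                (etaIntegrand_intervalIntegrable hconv le_rfl (hrpos (m + 1)).le)
                (etaIntegrand_intervalIntegrable hconv (hrpos (m + 1)).le (hrpos m).le)]
              ring
          rw [hsum]
          have := sub_le_integral_etaIntegrand (n := n) hφ hconv le_rfl (hrpos m).le
          have := hrpos m
          linarith
  have hint : 0 ≤ ∫ s in (0 : ℝ)..r₀, etaIntegrand n φ s := by
    have := sub_le_integral_etaIntegrand (n := n) hφ hconv le_rfl hr₀0.le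
    linarith
  exact (ENNReal.ofReal_le_ofReal_iff (mul_nonneg hK0 hint)).mp htot

theorem isLengthJohnWith_of_hasBallSeparation (hn : 1 ≤ n) {C₀ : ℝ} (hC₀ : 0 < C₀) :
    ∃ C : ℝ, 1 ≤ C ∧ ∀ φ : ℝ → ℝ, IsGauge φ → EtaConverges n φ →
      IsGauge (etaFun n φ C) ∧
      ∀ Ω : Set (En n), IsBoundedDomain Ω → HasBallSeparation C₀ Ω → IsLC2 φ Ω →
        IsLengthJohnWith C (etaFun n φ C) Ω := by
  set C₁ := (1 + C₀) ^ 2 with hC₁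
  have h1 : 1 ≤ C₁ := by rw [hC₁]; nlinarith
  set K := (20 * n : ℝ) ^ n * 400 * (400 * C₁) ^ (n - 1) with hK
  have hK0 : 0 ≤ K := by positivity
  have hC : 1 ≤ C₁ + K := by linarith
  refine ⟨C₁ + K, hC, fun φ hφ hconv => ⟨isGauge_etaFun hφ hconv hC, fun Ω hΩ hsep hlc => ?_⟩⟩
  obtain ⟨x₀, hx₀, hdiam⟩ := exists_center hn hΩ hC₀ hsep hφ hlc
  refine ⟨x₀, hx₀, fun x hx => ?_⟩
  obtain ⟨L, g, hg⟩ := exists_geodesic hn hΩ hx hx₀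
  have hc := hg.lipCurve
  have hmaps : ∀ t : unitInterval, (t : ℝ) * L ∈ Icc 0 L := fun t =>
    ⟨mul_nonneg t.2.1 hc.nonneg, mul_le_of_le_one_left hc.nonneg t.2.2⟩
  let γ : Path x x₀ :=
    { toFun := fun t => g (t * L)
      continuous_toFun := hc.continuousOn.comp_continuous (by fun_prop) hmaps
      source' := by simp [hc.source]
      target' := by simp [hc.target] }
  refine ⟨γ, fun t => hc.mem _ (hmaps t).1 (hmaps t).2, fun t => ?_⟩
  have hm : MonotoneOn (fun t : unitInterval => (t : ℝ) * L) (Iic t) := fun s _ t _ hst =>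
    mul_le_mul_of_nonneg_right hst hc.nonneg
  have e1 : eVariationOn γ (Iic t) ≤ eVariationOn g (Icc 0 L ∩ Icc 0 (t * L)) :=
    eVariationOn.comp_le_of_monotoneOn g (fun t : unitInterval => (t : ℝ) * L) hm
      (fun s hs => ⟨hmaps s, (hmaps s).1, mul_le_mul_of_nonneg_right hs hc.nonneg⟩)
  rw [hg.1.unitSpeed ⟨le_rfl, hc.nonneg⟩ (hmaps t), NNReal.coe_one, one_mul, sub_zero] at e1
  refine e1.trans (ENNReal.ofReal_le_ofReal ?_)
  have key := arc_length_le_integral hn hΩ hφ hconv h1 hg (hdiam x L g hg) (hmaps t).1 (hmaps t).2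
  set d := bdryDist Ω (g (t * L)) with hd
  have hd0 : 0 < d := bdryDist_pos hn hΩ (hc.mem _ (hmaps t).1 (hmaps t).2)
  have hγ : bdryDist Ω (γ t) = d := rfl
  rw [etaFun, hγ]
  refine key.trans ?_
  -- The constant enters twice, inside `etaFun` and as John constant.
  have h2 : C₁ * d ≤ (C₁ + K) * ((C₁ + K) * d) := by
    rw [← mul_assoc]
    refine mul_le_mul_of_nonneg_right ?_ hd0.le
    nlinarith
  have h3 := integral_etaIntegrand_mono (n := n) hφ hconv (hφ.nonneg (by positivity : 0 ≤ C₁ * d))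
    (hφ.mono (by positivity) h2)
  have h4 := sub_le_integral_etaIntegrand (n := n) hφ hconv le_rfl
    (hφ.nonneg (by positivity : 0 ≤ C₁ * d))
  have h5 := hφ.nonneg (by positivity : 0 ≤ C₁ * d)
  have h6 : 0 ≤ ∫ s in (0 : ℝ)..φ (C₁ * d), etaIntegrand n φ s := by linarith
  exact mul_le_mul (by linarith) h3 h6 (by linarith)

end QH

/-! ### Part (2): the geometry of domains made of chains of cubes -/

namespace QH
variable {n : ℕ}

/-! ### Chains of cubes -/

/-- An open axis-parallel box. -/
def Box (α β : Fin n → ℝ) : Set (En n) := {u | ∀ l, α l < u l ∧ u l < β l}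

theorem isOpen_box (α β : Fin n → ℝ) : IsOpen (Box α β) := by
  have : Box α β = ⋂ l, {u : En n | α l < u l ∧ u l < β l} := by
    ext u; simp only [Box, mem_ofPred_eq, mem_iInter]
  rw [this]
  refine isOpen_iInter_of_finite fun l => ?_
  have hc : Continuous fun u : En n => u l := by fun_prop
  exact (isOpen_lt continuous_const hc).inter (isOpen_lt hc continuous_const)

theorem convex_box (α β : Fin n → ℝ) : Convex ℝ (Box α β) := by
  intro u hu v hv p q hp hq hpq l
  simp only [PiLp.add_apply, PiLp.smul_apply, smul_eq_mul]
  have h1 := (convex_Ioo (α l) (β l)) (hu l) (hv l) hp hq hpq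
  simpa using h1

/-- An infinite chain of axis-parallel cubes with disjoint interiors, of decreasing sizes: a face
of each cube lies in a face of its predecessor, and consecutive sizes differ by a factor at most
two. -/
structure CubeChain (n : ℕ) where
  /-- The lower corner of the `i`-th cube. -/
  a : ℕ → Fin n → ℝ
  /-- The side length of the `i`-th cube. -/
  s : ℕ → ℝ
  /-- The coordinate in which the cubes `i` and `i + 1` abut. -/
  ax : ℕ → Fin n
  /-- The value of that coordinate on the common face. -/
  pl : ℕ → ℝ
  pos : ∀ i, 0 < s i
  anti : ∀ i, s (i + 1) ≤ s i
  half : ∀ i, s i ≤ 2 * s (i + 1)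
  abut : ∀ i, (a i (ax i) + s i = pl i ∧ a (i + 1) (ax i) = pl i) ∨
    (a i (ax i) = pl i ∧ a (i + 1) (ax i) + s (i + 1) = pl i)
  incl : ∀ i l, l ≠ ax i → a i l ≤ a (i + 1) l ∧ a (i + 1) l + s (i + 1) ≤ a i l + s i
  sep : ∀ i j, i ≠ j → ∃ k, a i k + s i ≤ a j k ∨ a j k + s j ≤ a i k

namespace CubeChain
variable (Q : CubeChain n)

/-- The `i`-th open cube. -/
def cube (i : ℕ) : Set (En n) := Box (Q.a i) (fun l => Q.a i l + Q.s i)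

/-- The `i`-th closed cube. -/
def ccube (i : ℕ) : Set (En n) := {u | ∀ l, Q.a i l ≤ u l ∧ u l ≤ Q.a i l + Q.s i}

/-- Lower corner of the box around the gate between the cubes `i` and `i + 1`. -/
def lo (i : ℕ) (l : Fin n) : ℝ := if l = Q.ax i then Q.pl i - Q.s (i + 1) else Q.a (i + 1) l

/-- Upper corner of the box around the gate between the cubes `i` and `i + 1`. -/
def hi (i : ℕ) (l : Fin n) : ℝ :=
  if l = Q.ax i then Q.pl i + Q.s (i + 1) else Q.a (i + 1) l + Q.s (i + 1)

/-- The box around the gate between the cubes `i` and `i + 1`. -/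
def gbox (i : ℕ) : Set (En n) := Box (Q.lo i) (Q.hi i)

/-- The open common face of the cubes `i` and `i + 1`. -/
def gate (i : ℕ) : Set (En n) :=
  {u | u (Q.ax i) = Q.pl i ∧ ∀ l, l ≠ Q.ax i → Q.a (i + 1) l < u l ∧ u l < Q.a (i + 1) l + Q.s (i + 1)}

/-- The domain formed by the open cubes and the gates. -/
def dom : Set (En n) := ⋃ i, Q.cube i ∪ Q.gbox i

variable {Q}

theorem mem_gbox {i : ℕ} {u : En n} : u ∈ Q.gbox i ↔
    (Q.pl i - Q.s (i + 1) < u (Q.ax i) ∧ u (Q.ax i) < Q.pl i + Q.s (i + 1)) ∧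
    ∀ l, l ≠ Q.ax i → Q.a (i + 1) l < u l ∧ u l < Q.a (i + 1) l + Q.s (i + 1) := by
  constructor
  · intro h
    refine ⟨by simpa [lo, hi] using h (Q.ax i), fun l hl => by simpa [lo, hi, hl] using h l⟩
  · rintro ⟨h1, h2⟩ l
    by_cases hl : l = Q.ax i
    · subst hl; simpa [lo, hi] using h1
    · simpa [lo, hi, hl] using h2 l hl

theorem gate_subset_gbox (i : ℕ) : Q.gate i ⊆ Q.gbox i := fun u hu => by
  have := Q.pos (i + 1)
  exact mem_gbox.mpr ⟨⟨by rw [hu.1]; linarith, by rw [hu.1]; linarith⟩, hu.2⟩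

theorem cube_subset_ccube (i : ℕ) : Q.cube i ⊆ Q.ccube i := fun _ hu l => ⟨(hu l).1.le, (hu l).2.le⟩

theorem cube_subset_dom (i : ℕ) : Q.cube i ⊆ Q.dom :=
  subset_iUnion_of_subset i subset_union_left

theorem gbox_subset_dom (i : ℕ) : Q.gbox i ⊆ Q.dom :=
  subset_iUnion_of_subset i subset_union_right

theorem gate_subset_dom (i : ℕ) : Q.gate i ⊆ Q.dom := (gate_subset_gbox i).trans (gbox_subset_dom i)

theorem isOpen_cube (i : ℕ) : IsOpen (Q.cube i) := isOpen_box _ _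

theorem isOpen_gbox (i : ℕ) : IsOpen (Q.gbox i) := isOpen_box _ _

theorem isOpen_dom : IsOpen Q.dom :=
  isOpen_iUnion fun i => (isOpen_cube i).union (isOpen_gbox i)

theorem mem_gbox_cases {i : ℕ} {u : En n} (hu : u ∈ Q.gbox i) :
    u ∈ Q.cube i ∨ u ∈ Q.gate i ∨ u ∈ Q.cube (i + 1) := by
  obtain ⟨⟨h1, h2⟩, h3⟩ := mem_gbox.mp hu
  have hle := Q.anti i
  have hc1 : (Q.a i (Q.ax i) < u (Q.ax i) ∧ u (Q.ax i) < Q.a i (Q.ax i) + Q.s i) → u ∈ Q.cube i := by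
    intro h l
    by_cases hl : l = Q.ax i
    · subst hl; exact h
    · exact ⟨(Q.incl i l hl).1.trans_lt (h3 l hl).1, (h3 l hl).2.trans_le (Q.incl i l hl).2⟩
  have hc2 : (Q.a (i + 1) (Q.ax i) < u (Q.ax i) ∧
      u (Q.ax i) < Q.a (i + 1) (Q.ax i) + Q.s (i + 1)) → u ∈ Q.cube (i + 1) := by
    intro h l
    by_cases hl : l = Q.ax i
    · subst hl; exact h
    · exact h3 l hl
  rcases lt_trichotomy (u (Q.ax i)) (Q.pl i) with h | h | h
  · rcases Q.abut i with ⟨e1, e2⟩ | ⟨e1, e2⟩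
    · exact Or.inl (hc1 ⟨by linarith, by linarith⟩)
    · exact Or.inr (Or.inr (hc2 ⟨by linarith, by linarith⟩))
  · exact Or.inr (Or.inl ⟨h, h3⟩)
  · rcases Q.abut i with ⟨e1, e2⟩ | ⟨e1, e2⟩
    · exact Or.inr (Or.inr (hc2 ⟨by linarith, by linarith⟩))
    · exact Or.inl (hc1 ⟨by linarith, by linarith⟩)

theorem gate_subset_ccube (i : ℕ) : Q.gate i ⊆ Q.ccube i := fun u hu l => by
  have := Q.pos i
  by_cases hl : l = Q.ax i
  · subst hl
    rw [hu.1]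
    rcases Q.abut i with ⟨e1, e2⟩ | ⟨e1, e2⟩ <;> constructor <;> linarith
  · have h1 := hu.2 l hl
    have h2 := Q.incl i l hl
    exact ⟨by linarith, by linarith⟩

theorem gate_subset_ccube_succ (i : ℕ) : Q.gate i ⊆ Q.ccube (i + 1) := fun u hu l => by
  have := Q.pos (i + 1)
  by_cases hl : l = Q.ax i
  · subst hl
    rw [hu.1]
    rcases Q.abut i with ⟨e1, e2⟩ | ⟨e1, e2⟩ <;> constructor <;> linarith
  · exact ⟨(hu.2 l hl).1.le, (hu.2 l hl).2.le⟩

theorem eq_of_mem_ccube_of_mem_cube {i j : ℕ} {u : En n} (hi : u ∈ Q.ccube i) (hj : u ∈ Q.cube j) :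
    i = j := by
  by_contra hij
  obtain ⟨k, h | h⟩ := Q.sep i j hij
  · have := (hi k).2; have := (hj k).1; linarith
  · have := (hi k).1; have := (hj k).2; linarith

theorem mem_gbox_ccube {i : ℕ} {u : En n} (hu : u ∈ Q.gbox i) : u ∈ Q.ccube i ∨ u ∈ Q.ccube (i + 1) := by
  rcases mem_gbox_cases hu with h | h | h
  · exact Or.inl (cube_subset_ccube i h)
  · exact Or.inl (gate_subset_ccube i h)
  · exact Or.inr (cube_subset_ccube _ h)

theorem eq_or_eq_of_mem_gbox_of_mem_cube {i j : ℕ} {u : En n} (hi : u ∈ Q.gbox i) (hj : u ∈ Q.cube j) :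
    j = i ∨ j = i + 1 := by
  rcases mem_gbox_ccube hi with h | h
  · exact Or.inl (eq_of_mem_ccube_of_mem_cube h hj).symm
  · exact Or.inr (eq_of_mem_ccube_of_mem_cube h hj).symm

variable (Q) in
/-- The center of the `i`-th cube. -/
noncomputable def center (i : ℕ) : En n := WithLp.toLp 2 fun l => Q.a i l + Q.s i / 2

theorem center_apply (i : ℕ) (l : Fin n) : Q.center i l = Q.a i l + Q.s i / 2 := rfl

theorem center_mem_cube (i : ℕ) : Q.center i ∈ Q.cube i := fun l => by
  have := Q.pos i
  rw [center_apply]; constructor <;> linarith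

theorem lineMap_mem_cube {i : ℕ} {u c : En n} (hu : u ∈ Q.ccube i) (hc : c ∈ Q.cube i) {t : ℝ}
    (h0 : 0 < t) (h1 : t ≤ 1) : u + t • (c - u) ∈ Q.cube i := fun l => by
  have e : (u + t • (c - u)) l = u l + t * (c l - u l) := by simp
  rw [e]
  have h2 := hu l
  have h3 := hc l
  constructor <;> nlinarith

theorem ccube_subset_closure_cube (i : ℕ) : Q.ccube i ⊆ closure (Q.cube i) := fun u hu => by
  have hc := center_mem_cube (Q := Q) i
  have ht : Filter.Tendsto (fun t : ℝ => u + t • (Q.center i - u)) (nhdsWithin 0 (Ioi 0)) (nhds u) := by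
    have : Continuous fun t : ℝ => u + t • (Q.center i - u) := by fun_prop
    have := this.tendsto 0
    simp only [zero_smul, add_zero] at this
    exact this.mono_left nhdsWithin_le_nhds
  refine mem_closure_of_tendsto ht ?_
  have : Ioo (0 : ℝ) 1 ∈ nhdsWithin 0 (Ioi 0) := Ioo_mem_nhdsGT one_pos
  filter_upwards [this] with t h
  exact lineMap_mem_cube hu hc h.1 h.2.le

/-- A closed cube is in the closure of its open cube and gate boxes are open, so the point can be
moved into the open cube. -/
theorem eq_or_eq_of_mem_gbox_of_mem_ccube {i j : ℕ} {u : En n} (hi : u ∈ Q.gbox i)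
    (hj : u ∈ Q.ccube j) : j = i ∨ j = i + 1 := by
  obtain ⟨v, hv1, hv2⟩ := mem_closure_iff.mp (ccube_subset_closure_cube j hj) _ (isOpen_gbox i) hi
  exact eq_or_eq_of_mem_gbox_of_mem_cube hv1 hv2

theorem mem_dom_ccube {i : ℕ} {u : En n} (hu : u ∈ Q.dom) (hi : u ∈ Q.ccube i) :
    u ∈ Q.cube i ∨ u ∈ Q.gate i ∨ ∃ m, i = m + 1 ∧ u ∈ Q.gate m := by
  obtain ⟨j, hj | hj⟩ := mem_iUnion.mp hu
  · rw [eq_of_mem_ccube_of_mem_cube hi hj]; exact Or.inl hj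
  · rcases mem_gbox_cases hj with h | h | h
    · rw [eq_of_mem_ccube_of_mem_cube hi h]; exact Or.inl h
    · rcases eq_or_eq_of_mem_gbox_of_mem_ccube hj hi with rfl | rfl
      · exact Or.inr (Or.inl h)
      · exact Or.inr (Or.inr ⟨j, rfl, h⟩)
    · rw [eq_of_mem_ccube_of_mem_cube hi h]; exact Or.inl h

theorem exists_mem_ccube {u : En n} (hu : u ∈ Q.dom) : ∃ i, u ∈ Q.ccube i := by
  obtain ⟨j, hj | hj⟩ := mem_iUnion.mp hu
  · exact ⟨j, cube_subset_ccube j hj⟩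
  · rcases mem_gbox_ccube hj with h | h
    exacts [⟨_, h⟩, ⟨_, h⟩]

/-- A connected subset of the domain that meets cubes on both sides of a gate meets the gate. -/
theorem inter_gate_nonempty {E : Set (En n)} (hE : IsPreconnected E) (hsub : E ⊆ Q.dom) {u v : En n}
    (hu : u ∈ E) (hv : v ∈ E) {i m j : ℕ} (hui : u ∈ Q.ccube i) (hvj : v ∈ Q.ccube j) (him : i ≤ m)
    (hmj : m < j) : (E ∩ Q.gate m).Nonempty := by
  by_contra hne
  rw [not_nonempty_iff_eq_empty] at hne
  have hno : ∀ w ∈ E, w ∉ Q.gate m := fun w hw hg => by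
    have : w ∈ E ∩ Q.gate m := ⟨hw, hg⟩
    rw [hne] at this; exact this
  -- Without the gate m the domain falls apart into the open sets `A` and `B`. The m-th gate box
  -- appears in neither, since off the gate it lies in the cubes m and m + 1.
  set A : Set (En n) := (⋃ k ∈ Iic m, Q.cube k) ∪ ⋃ k ∈ Iio m, Q.gbox k with hA
  set B : Set (En n) := (⋃ k ∈ Ioi m, Q.cube k) ∪ ⋃ k ∈ Ioi m, Q.gbox k with hB
  have hAo : IsOpen A := (isOpen_biUnion fun k _ => isOpen_cube k).union
    (isOpen_biUnion fun k _ => isOpen_gbox k)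
  have hBo : IsOpen B := (isOpen_biUnion fun k _ => isOpen_cube k).union
    (isOpen_biUnion fun k _ => isOpen_gbox k)
  have hAc : ∀ w ∈ A, ∃ k ≤ m, w ∈ Q.ccube k := by
    rintro w (h | h)
    · obtain ⟨k, hk, hw⟩ := mem_iUnion₂.mp h
      exact ⟨k, hk, cube_subset_ccube k hw⟩
    · obtain ⟨k, hk, hw⟩ := mem_iUnion₂.mp h
      rw [mem_Iio] at hk
      rcases mem_gbox_ccube hw with h | h
      exacts [⟨k, by omega, h⟩, ⟨k + 1, by omega, h⟩]
  have hBc : ∀ k ≤ m, ∀ w ∈ Q.ccube k, w ∉ B := by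
    rintro k hk w hw (h | h)
    · obtain ⟨k', hk', hw'⟩ := mem_iUnion₂.mp h
      rw [mem_Ioi] at hk'
      have := eq_of_mem_ccube_of_mem_cube hw hw'
      omega
    · obtain ⟨k', hk', hw'⟩ := mem_iUnion₂.mp h
      rw [mem_Ioi] at hk'
      have := eq_or_eq_of_mem_gbox_of_mem_ccube hw' hw
      omega
  have hAc' : ∀ k, m < k → ∀ w ∈ Q.ccube k, w ∉ A := by
    rintro k hk w hw (h | h)
    · obtain ⟨k', hk', hw'⟩ := mem_iUnion₂.mp h
      rw [mem_Iic] at hk'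
      have := eq_of_mem_ccube_of_mem_cube hw hw'
      omega
    · obtain ⟨k', hk', hw'⟩ := mem_iUnion₂.mp h
      rw [mem_Iio] at hk'
      have := eq_or_eq_of_mem_gbox_of_mem_ccube hw' hw
      omega
  have hcov : E ⊆ A ∪ B := by
    intro w hw
    obtain ⟨k, hk | hk⟩ := mem_iUnion.mp (hsub hw)
    · rcases le_or_gt k m with h | h
      · exact Or.inl (Or.inl (mem_biUnion (show k ∈ Iic m from h) hk))
      · exact Or.inr (Or.inl (mem_biUnion (show k ∈ Ioi m from h) hk))
    · rcases lt_trichotomy k m with h | h | h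
      · exact Or.inl (Or.inr (mem_biUnion (show k ∈ Iio m from h) hk))
      · subst h
        rcases mem_gbox_cases hk with h | h | h
        · exact Or.inl (Or.inl (mem_biUnion (show k ∈ Iic k from mem_Iic.mpr le_rfl) h))
        · exact absurd h (hno w hw)
        · exact Or.inr (Or.inl (mem_biUnion (show k + 1 ∈ Ioi k from Nat.lt_succ_self k) h))
      · exact Or.inr (Or.inr (mem_biUnion (show k ∈ Ioi m from h) hk))
  have hdis : E ∩ (A ∩ B) = ∅ := by
    ext w
    simp only [mem_inter_iff, mem_empty_iff_false, iff_false]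
    rintro ⟨-, h1, h2⟩
    obtain ⟨k, hk, hw⟩ := hAc w h1
    exact hBc k hk w hw h2
  rcases isPreconnected_iff_subset_of_disjoint.mp hE A B hAo hBo hcov hdis with h | h
  · exact hAc' j hmj v hvj (h hv)
  · exact hBc i him u hui (h hu)

theorem s_anti {i j : ℕ} (hij : i ≤ j) : Q.s j ≤ Q.s i := antitone_nat_of_succ_le Q.anti hij

theorem s_le_pow_mul (i k : ℕ) : Q.s i ≤ 2 ^ k * Q.s (i + k) := by
  induction k with
  | zero => simp
  | succ k ih =>
    have := Q.half (i + k)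
    rw [pow_succ, mul_assoc]
    exact ih.trans (mul_le_mul_of_nonneg_left this (by positivity))

/-- Cubes of side at least `δ` that meet a cube of radius `ρ` are few. -/
theorem card_le_of_meets {S : Finset ℕ} {δ ρ : ℝ} (hδ : 0 < δ) (hρ : 0 ≤ ρ) (z : En n)
    (hS : ∀ i ∈ S, δ ≤ Q.s i) (hm : ∀ i ∈ S, ∃ w ∈ Q.ccube i, ∀ l, |w l - z l| ≤ ρ) :
    (S.card : ℝ) ≤ (2 * (ρ / δ) + 2) ^ n := by
  choose! w hw hwz using hm
  -- Lower corner of a cube of side exactly δ inside the i-th cube and close to `w i`. These cubes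
  -- are disjoint and lie in the cube of side 2(ρ + δ) about z, so comparing volumes counts them.
  let b : ℕ → Fin n → ℝ := fun i l => max (Q.a i l) (w i l - δ)
  let T : ℕ → Set (Fin n → ℝ) := fun i => univ.pi fun l => Ioo (b i l) (b i l + δ)
  have hb : ∀ i ∈ S, ∀ l, Q.a i l ≤ b i l ∧ b i l + δ ≤ Q.a i l + Q.s i ∧
      z l - (ρ + δ) ≤ b i l ∧ b i l ≤ z l + ρ := by
    intro i hi l
    have h1 := hw i hi l
    have h2 := abs_le.mp (hwz i hi l)
    have h3 := hS i hi
    refine ⟨le_max_left _ _, ?_, ?_, ?_⟩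
    · rcases max_cases (Q.a i l) (w i l - δ) with ⟨e, -⟩ | ⟨e, -⟩ <;> simp only [b, e] <;> linarith
    · exact le_trans (by linarith) (le_max_right _ _)
    · exact max_le (by linarith) (by linarith)
  have hdis : (S : Set ℕ).PairwiseDisjoint T := by
    intro i hi j hj hij
    rw [Function.onFun, Set.disjoint_left]
    intro x hxi hxj
    obtain ⟨k, h | h⟩ := Q.sep i j hij
    · have h1 := (hxi k (mem_univ k)).2
      have h2 := (hxj k (mem_univ k)).1
      have := hb i hi k; have := hb j hj k
      linarith
    · have h1 := (hxi k (mem_univ k)).1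
      have h2 := (hxj k (mem_univ k)).2
      have := hb i hi k; have := hb j hj k
      linarith
  have hsub : (⋃ i ∈ S, T i) ⊆ univ.pi fun l => Ioo (z l - (ρ + δ)) (z l + (ρ + δ)) := by
    intro x hx
    obtain ⟨i, hi, hxi⟩ := mem_iUnion₂.mp hx
    intro l hl
    have h1 := hxi l hl
    have := hb i hi l
    exact ⟨by linarith [h1.1], by linarith [h1.2]⟩
  have hvol := measure_mono (μ := volume) hsub
  rw [measure_biUnion_finset hdis fun i _ => MeasurableSet.univ_pi fun l => measurableSet_Ioo] at hvol
  simp only [T, Real.volume_pi_Ioo, add_sub_cancel_left, Finset.prod_const, Finset.card_univ,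
    Fintype.card_fin, Finset.sum_const, nsmul_eq_mul] at hvol
  have e : ∀ l, z l + (ρ + δ) - (z l - (ρ + δ)) = 2 * (ρ + δ) := fun l => by ring
  simp only [e, Finset.prod_const, Finset.card_univ, Fintype.card_fin] at hvol
  rw [← ENNReal.ofReal_pow hδ.le, ← ENNReal.ofReal_pow (by positivity), ← ENNReal.ofReal_natCast,
    ← ENNReal.ofReal_mul (by positivity), ENNReal.ofReal_le_ofReal_iff (by positivity)] at hvol
  have h2 : (2 * (ρ / δ) + 2) ^ n * δ ^ n = (2 * (ρ + δ)) ^ n := by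
    rw [← mul_pow]; congr 1; field_simp
  rw [← h2] at hvol
  exact le_of_mul_le_mul_right hvol (by positivity)

end CubeChain
end QH

namespace QH
variable {n : ℕ} {Ω : Set (En n)}

/-! ### Charts of the domain of a chain -/

/-- The points of a box at distance at least `ρ` from its faces. -/
def Deep (α β : Fin n → ℝ) (ρ : ℝ) : Set (En n) := {u | ∀ l, α l + ρ ≤ u l ∧ u l + ρ ≤ β l}

theorem Deep.ball_subset {α β : Fin n → ℝ} {ρ : ℝ} {u : En n} (hu : u ∈ Deep α β ρ) :
    Metric.ball u ρ ⊆ Box α β := fun v hv l => by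
  have h1 := abs_lt.mp ((abs_sub_le_dist v u l).trans_lt hv)
  have h2 := hu l
  constructor <;> linarith [h1.1, h1.2]

theorem Deep.mono {α β α' β' : Fin n → ℝ} {ρ : ℝ} {u : En n} (hu : u ∈ Deep α β ρ)
    (h : ∀ l, α' l ≤ α l ∧ β l ≤ β' l) : u ∈ Deep α' β' ρ := fun l => by
  have := hu l; have := h l
  constructor <;> linarith

theorem Deep.of_le {α β : Fin n → ℝ} {ρ ρ' : ℝ} {u : En n} (hu : u ∈ Deep α β ρ)
    (h : ρ' ≤ ρ) : u ∈ Deep α β ρ' := fun l => by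
  have := hu l
  constructor <;> linarith

theorem Deep.lineMap {α β : Fin n → ℝ} {h ρ t : ℝ} {u p : En n} (hu : u ∈ Deep α β h)
    (hp : p ∈ Deep α β ρ) (h0 : 0 ≤ t) (h1 : t ≤ 1) :
    u + t • (p - u) ∈ Deep α β ((1 - t) * h + t * ρ) := fun l => by
  have e : (u + t • (p - u)) l = u l + t * (p l - u l) := by simp
  rw [e]
  have h2 := hu l
  have h3 := hp l
  constructor <;> nlinarith

theorem Deep.qhDist_le (hn : 1 ≤ n) (hΩ : IsBoundedDomain Ω) {α β : Fin n → ℝ} {ρ : ℝ} {u v : En n}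
    (hbox : Box α β ⊆ Ω) (hρ : 0 < ρ) (hu : u ∈ Deep α β ρ) (hv : v ∈ Deep α β ρ) :
    qhDist Ω u v ≤ ENNReal.ofReal (dist u v / ρ) := by
  refine qhDist_le_div hn hΩ hρ fun w hw => Subset.trans (Deep.ball_subset ?_) hbox
  rw [segment_eq_image'] at hw
  obtain ⟨t, ht, rfl⟩ := hw
  have := Deep.lineMap hu hv ht.1 ht.2
  rwa [show (1 - t) * ρ + t * ρ = ρ by ring] at this

/-- Along the segment towards a point of depth ρ the depth grows linearly, so the integral of its
reciprocal is only logarithmic in the initial depth. -/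
theorem Deep.climb (hn : 1 ≤ n) (hΩ : IsBoundedDomain Ω) {α β : Fin n → ℝ} {h ρ : ℝ} {u p : En n}
    (hbox : Box α β ⊆ Ω) (hh : 0 < h) (hρ : 0 < ρ) (hu : u ∈ Deep α β h) (hp : p ∈ Deep α β ρ) :
    qhDist Ω u p ≤ ENNReal.ofReal (2 * (dist u p / ρ) * (1 + Real.log (1 + ρ / h))) := by
  rcases eq_or_ne u p with rfl | hne
  · have := qhDist_le_div hn hΩ hh (u := u) (v := u) fun w hw => by
      rw [segment_same, mem_singleton_iff] at hw
      subst hw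
      exact (Deep.ball_subset hu).trans hbox
    simpa using this
  set T := dist u p with hT
  have hT0 : 0 < T := dist_pos.mpr hne
  -- With initial depth at most ρ, the depth at time s is at least h'/2 + ρs/(2T), which is
  -- increasing in s.
  set h' := min h ρ with hh'
  have hh'0 : 0 < h' := lt_min hh hρ
  have hdeep : ∀ s ∈ Icc 0 T, segCurve u p s ∈ Deep α β (h' / 2 + ρ / (2 * T) * s) := by
    intro s hs
    have ht0 : 0 ≤ s / T := div_nonneg hs.1 hT0.le
    have ht1 : s / T ≤ 1 := div_le_one_of_le₀ hs.2 hT0.le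
    refine Deep.of_le (Deep.lineMap hu hp ht0 ht1) ?_
    have e : ρ / (2 * T) * s = s / T * ρ / 2 := by field_simp
    rw [e]
    have h1 : h' ≤ h := min_le_left _ _
    have h2 : h' ≤ ρ := min_le_right _ _
    nlinarith
  have hpos : ∀ s ∈ Icc 0 T, 0 < h' / 2 + ρ / (2 * T) * s := fun s hs => by
    have : 0 ≤ ρ / (2 * T) * s := mul_nonneg (by positivity) hs.1
    linarith
  have hc : LipCurve Ω u p T (segCurve u p) := by
    refine lipCurve_segment fun w hw => ?_
    rw [segment_eq_image'] at hw
    obtain ⟨t, ht, rfl⟩ := hw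
    have := hdeep (t * T) ⟨mul_nonneg ht.1 hT0.le, mul_le_of_le_one_left hT0.le ht.2⟩
    have e : segCurve u p (t * T) = u + t • (p - u) := by
      rw [segCurve, ← hT, mul_div_cancel_right₀ _ hT0.ne']
    rw [e] at this
    exact hbox (Deep.ball_subset this (Metric.mem_ball_self
      (hpos _ ⟨mul_nonneg ht.1 hT0.le, mul_le_of_le_one_left hT0.le ht.2⟩)))
  refine (QH.qhDist_le hc).trans ?_
  calc qhLength Ω T (segCurve u p)
      ≤ ∫⁻ s in Icc 0 T, ENNReal.ofReal (1 / (h' / 2 + ρ / (2 * T) * s)) :=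
        setLIntegral_mono' measurableSet_Icc fun s hs => ENNReal.ofReal_le_ofReal
          (one_div_le_one_div_of_le (hpos s hs)
            (le_bdryDist_of_ball_subset hn hΩ ((Deep.ball_subset (hdeep s hs)).trans hbox)))
    _ = ENNReal.ofReal (Real.log (1 + ρ / (2 * T) * T / (h' / 2)) / (ρ / (2 * T))) :=
        lintegral_one_div_add_mul (by positivity) (by positivity) hT0.le
    _ ≤ _ := by
        refine ENNReal.ofReal_le_ofReal ?_
        have e1 : ρ / (2 * T) * T / (h' / 2) = ρ / h' := by field_simp
        have e2 : Real.log (1 + ρ / h') / (ρ / (2 * T)) = 2 * (T / ρ) * Real.log (1 + ρ / h') := by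
          field_simp
        rw [e1, e2]
        refine mul_le_mul_of_nonneg_left ?_ (by positivity)
        rcases min_cases h ρ with ⟨e, -⟩ | ⟨e, -⟩
        · rw [hh', e]; linarith
        · rw [hh', e, div_self hρ.ne']
          have h1 : Real.log (1 + 1) ≤ 1 := by
            have := Real.log_le_sub_one_of_pos (show (0 : ℝ) < 1 + 1 by norm_num); linarith
          have h2 : 0 ≤ Real.log (1 + ρ / h) := Real.log_nonneg (by
            have : 0 ≤ ρ / h := by positivity
            linarith)
          exact h1.trans (le_add_of_nonneg_right h2)

theorem exists_clamp {α : Fin n → ℝ} {σ ρ : ℝ} {u : En n} (hρ : 0 ≤ ρ) (hσ : 2 * ρ ≤ σ)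
    (hu : ∀ l, α l ≤ u l ∧ u l ≤ α l + σ) :
    ∃ p : En n, p ∈ Deep α (fun l => α l + σ) ρ ∧ dist u p ≤ n * ρ := by
  refine ⟨WithLp.toLp 2 fun l => max (α l + ρ) (min (u l) (α l + σ - ρ)), fun l => ?_,
    dist_le_card_mul hρ fun l => ?_⟩
  · change α l + ρ ≤ max _ _ ∧ max (α l + ρ) (min (u l) (α l + σ - ρ)) + ρ ≤ _
    refine ⟨le_max_left _ _, ?_⟩
    have : max (α l + ρ) (min (u l) (α l + σ - ρ)) ≤ α l + σ - ρ :=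
      max_le (by linarith) (min_le_right _ _)
    linarith
  · change |u l - max (α l + ρ) (min (u l) (α l + σ - ρ))| ≤ ρ
    have := hu l
    rcases max_cases (α l + ρ) (min (u l) (α l + σ - ρ)) with ⟨e, h1⟩ | ⟨e, h1⟩ <;>
    rcases min_cases (u l) (α l + σ - ρ) with ⟨e', h2⟩ | ⟨e', h2⟩ <;>
    rw [abs_le] <;> constructor <;> linarith

namespace CubeChain
variable {Q : CubeChain n}

theorem cube_succ_le_gbox (i : ℕ) (l : Fin n) :
    Q.lo i l ≤ Q.a (i + 1) l ∧ Q.a (i + 1) l + Q.s (i + 1) ≤ Q.hi i l := by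
  have := Q.pos (i + 1)
  rw [lo, hi]
  split_ifs with h
  · subst h
    rcases Q.abut i with ⟨-, e⟩ | ⟨-, e⟩ <;> constructor <;> linarith
  · exact ⟨le_rfl, le_rfl⟩

/-- α is the corner of the mirror image of the cube i + 1 in the plane of the gate. It fits into the
cube i and forms the other half of the gate box, so it is the place to change from one convex chart
to the next. -/
theorem exists_mirror (i : ℕ) : ∃ α : Fin n → ℝ,
    (∀ l, Q.a i l ≤ α l ∧ α l + Q.s (i + 1) ≤ Q.a i l + Q.s i) ∧
    (∀ l, Q.lo i l ≤ α l ∧ α l + Q.s (i + 1) ≤ Q.hi i l) ∧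
    ∀ u ∈ Q.gbox i, u ∈ Q.ccube i → ∀ l, α l ≤ u l ∧ u l ≤ α l + Q.s (i + 1) := by
  have hpos := Q.pos (i + 1)
  have hle := Q.anti i
  rcases Q.abut i with ⟨e1, e2⟩ | ⟨e1, e2⟩
  · refine ⟨fun l => if l = Q.ax i then Q.pl i - Q.s (i + 1) else Q.a (i + 1) l, fun l => ?_,
      fun l => ?_, fun u hu hc l => ?_⟩ <;> dsimp only
    · split_ifs with h
      · subst h; constructor <;> linarith
      · exact Q.incl i l h
    · rw [lo, hi]
      split_ifs with h
      · constructor <;> linarith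
      · exact ⟨le_rfl, le_rfl⟩
    · have h3 := mem_gbox.mp hu
      split_ifs with h
      · subst h
        have := (hc (Q.ax i)).2
        exact ⟨h3.1.1.le, by linarith⟩
      · exact ⟨(h3.2 l h).1.le, (h3.2 l h).2.le⟩
  · refine ⟨fun l => if l = Q.ax i then Q.pl i else Q.a (i + 1) l, fun l => ?_,
      fun l => ?_, fun u hu hc l => ?_⟩ <;> dsimp only
    · split_ifs with h
      · subst h; constructor <;> linarith
      · exact Q.incl i l h
    · rw [lo, hi]
      split_ifs with h
      · constructor <;> linarith
      · exact ⟨le_rfl, le_rfl⟩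
    · have h3 := mem_gbox.mp hu
      split_ifs with h
      · subst h
        have := (hc (Q.ax i)).1
        exact ⟨by linarith, h3.1.2.le⟩
      · exact ⟨(h3.2 l h).1.le, (h3.2 l h).2.le⟩

theorem cube_succ_subset_gbox (i : ℕ) : Q.cube (i + 1) ⊆ Q.gbox i := fun _ hu l =>
  ⟨(cube_succ_le_gbox i l).1.trans_lt (hu l).1, (hu l).2.trans_le (cube_succ_le_gbox i l).2⟩

theorem cube_inter_gbox_nonempty (i : ℕ) : (Q.cube i ∩ Q.gbox i).Nonempty := by
  obtain ⟨α, h1, h2, -⟩ := Q.exists_mirror i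
  have hpos := Q.pos (i + 1)
  refine ⟨WithLp.toLp 2 fun l => α l + Q.s (i + 1) / 2, fun l => ?_, fun l => ?_⟩
  · have := h1 l
    change _ < α l + Q.s (i + 1) / 2 ∧ α l + Q.s (i + 1) / 2 < _
    constructor <;> linarith
  · have := h2 l
    change _ < α l + Q.s (i + 1) / 2 ∧ α l + Q.s (i + 1) / 2 < _
    constructor <;> linarith

theorem isConnected_dom : IsConnected Q.dom := by
  refine IsConnected.iUnion_of_chain (fun i => ?_) fun i => ?_
  · exact IsConnected.union (cube_inter_gbox_nonempty i)
      ⟨⟨_, center_mem_cube i⟩, (convex_box _ _).isPreconnected⟩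
      ⟨(cube_inter_gbox_nonempty i).mono inter_subset_right, (convex_box _ _).isPreconnected⟩
  · exact ⟨Q.center (i + 1), Or.inr (cube_succ_subset_gbox i (center_mem_cube _)),
      Or.inl (center_mem_cube _)⟩

theorem isBoundedDomain (hb : Bornology.IsBounded Q.dom) : IsBoundedDomain Q.dom :=
  ⟨isOpen_dom, isConnected_dom, hb⟩

/-- Near a facet of its closed cube, a point of the domain sees only the gate. -/
theorem deep_gbox_of_near (hn : 2 ≤ n) {m : ℕ} {u u' : En n} {e : ℝ} (he : 0 < e)
    (hu : ∀ w, dist u w < 4 * e → w ∈ Q.dom) (hg : u' ∈ Q.gate m)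
    (hk : |u (Q.ax m) - Q.pl m| ≤ e) (hl : ∀ l, l ≠ Q.ax m → u l = u' l) :
    u ∈ Deep (Q.lo m) (Q.hi m) e := by
  have hpos := Q.pos (m + 1)
  -- moving `u'` to the rim of the gate would leave the domain
  have hrim : ∀ l, l ≠ Q.ax m → ∀ c, (c = Q.a (m + 1) l ∨ c = Q.a (m + 1) l + Q.s (m + 1)) →
      e ≤ |u l - c| := by
    intro l hlk c hc
    by_contra hlt
    push Not at hlt
    set v : En n := WithLp.toLp 2 fun j => if j = l then c else u' j with hv
    have hvj : ∀ j, v j = if j = l then c else u' j := fun j => rfl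
    have hdist : dist u v < 4 * e := by
      rw [EuclideanSpace.dist_eq, Real.sqrt_lt' (by positivity)]
      have hsum : ∑ j, dist (u j) (v j) ^ 2 ≤
          ∑ j, ((if j = l then e ^ 2 else 0) + if j = Q.ax m then e ^ 2 else 0) := by
        refine Finset.sum_le_sum fun j _ => ?_
        rw [Real.dist_eq, hvj]
        by_cases h1 : j = l
        · subst h1
          rw [if_pos rfl, if_pos rfl, if_neg hlk, add_zero]
          exact pow_le_pow_left₀ (abs_nonneg _) hlt.le 2
        · rw [if_neg h1, if_neg h1, zero_add]
          by_cases h2 : j = Q.ax m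
          · subst h2
            rw [if_pos rfl, hg.1]
            exact pow_le_pow_left₀ (abs_nonneg _) hk 2
          · rw [if_neg h2, hl j h2, sub_self]; simp
      rw [Finset.sum_add_distrib, Finset.sum_ite_eq' , Finset.sum_ite_eq'] at hsum
      simp only [Finset.mem_univ, if_true] at hsum
      nlinarith
    have hvd := hu v hdist
    have hvl : v l = c := by rw [hvj, if_pos rfl]
    have hvk : v (Q.ax m) = Q.pl m := by rw [hvj, if_neg (Ne.symm hlk), hg.1]
    have hvc : v ∈ Q.ccube (m + 1) := by
      have hg' := gate_subset_ccube_succ m hg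
      intro j
      rw [hvj]
      split_ifs with h
      · subst h; rcases hc with rfl | rfl <;> constructor <;> linarith
      · exact hg' j
    -- The point v lies on two facets of the cube m + 1, in the directions l and `Q.ax m`. It is
    -- thus not in the open cube, nor in the gate m + 1, whose points lie on facets in one direction
    -- only, nor in the gate m, which does not contain its rim.
    have hplane : Q.pl m = Q.a (m + 1) (Q.ax m) ∨
        Q.pl m = Q.a (m + 1) (Q.ax m) + Q.s (m + 1) := by
      rcases Q.abut m with ⟨-, h⟩ | ⟨-, h⟩
      exacts [Or.inl h.symm, Or.inr h.symm]
    rcases mem_dom_ccube hvd hvc with h | h | ⟨m', hm', h⟩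
    · have := h (Q.ax m)
      rw [hvk] at this
      rcases hplane with h' | h' <;> linarith [this.1, this.2]
    · have hnot : ∀ j c', v j = c' → (c' = Q.a (m + 1) j ∨ c' = Q.a (m + 1) j + Q.s (m + 1)) →
          j = Q.ax (m + 1) := by
        intro j c' h1 h2
        by_contra hj
        have h3 := h.2 j hj
        have h4 := Q.incl (m + 1) j hj
        rcases h2 with rfl | rfl <;> linarith [h3.1, h3.2]
      exact hlk ((hnot l c hvl hc).trans (hnot _ _ hvk hplane).symm)
    · obtain rfl : m = m' := by omega
      have := h.2 l hlk
      rw [hvl] at this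
      rcases hc with rfl | rfl <;> linarith [this.1, this.2]
  have hlat : ∀ l, l ≠ Q.ax m → Q.a (m + 1) l + e ≤ u l ∧ u l + e ≤ Q.a (m + 1) l + Q.s (m + 1) := by
    intro l hlk
    have h1 := hrim l hlk _ (Or.inl rfl)
    have h2 := hrim l hlk _ (Or.inr rfl)
    have h3 := hg.2 l hlk
    rw [← hl l hlk] at h3
    rw [abs_of_pos (by linarith)] at h1
    rw [abs_of_neg (by linarith)] at h2
    constructor <;> linarith
  -- A lateral coordinate exists because n ≥ 2.
  have hs : 2 * e ≤ Q.s (m + 1) := by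
    have : Nontrivial (Fin n) := Fin.nontrivial_iff_two_le.mpr hn
    obtain ⟨l, hlk⟩ := exists_ne (Q.ax m)
    have := hlat l hlk
    linarith
  intro l
  rw [lo, hi]
  split_ifs with h
  · subst h
    have := abs_le.mp hk
    constructor <;> linarith
  · exact hlat l h

/-- Every point of the domain lies deep in one of the cubes or gate boxes. -/
theorem exists_chart (hn : 2 ≤ n) (hb : Bornology.IsBounded Q.dom) {i : ℕ} {u : En n}
    (hu : u ∈ Q.dom) (hi : u ∈ Q.ccube i) :
    u ∈ Deep (Q.a i) (fun l => Q.a i l + Q.s i) (bdryDist Q.dom u / 4) ∨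
    u ∈ Deep (Q.lo i) (Q.hi i) (bdryDist Q.dom u / 4) ∨
    ∃ m, i = m + 1 ∧ u ∈ Deep (Q.lo m) (Q.hi m) (bdryDist Q.dom u / 4) := by
  set e := bdryDist Q.dom u / 4 with he
  have hd0 := bdryDist_pos (by omega) (isBoundedDomain hb) hu
  have he0 : 0 < e := by positivity
  have hball : ∀ w, dist u w < 4 * e → w ∈ Q.dom := fun w hw =>
    ball_bdryDist_subset hu isOpen_dom (by rw [Metric.mem_ball, dist_comm]; linarith)
  by_cases hall : ∀ l, Q.a i l + e ≤ u l ∧ u l + e ≤ Q.a i l + Q.s i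
  · exact Or.inl hall
  · right
    push Not at hall
    obtain ⟨k, hk⟩ := hall
    have hface : ∃ c, (c = Q.a i k ∨ c = Q.a i k + Q.s i) ∧ |u k - c| ≤ e := by
      have := hi k
      by_cases h1 : Q.a i k + e ≤ u k
      · exact ⟨_, Or.inr rfl, abs_le.mpr ⟨by linarith [hk h1], by linarith⟩⟩
      · exact ⟨_, Or.inl rfl, abs_le.mpr ⟨by linarith, by linarith⟩⟩
    obtain ⟨c, hc, hkc⟩ := hface
    -- The projection of u to the nearby facet is still within d(u) of u, hence in the domain; being
    -- on a facet, it must lie in a gate.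
    set u' : En n := WithLp.toLp 2 fun j => if j = k then c else u j with hu'
    have hu'j : ∀ j, u' j = if j = k then c else u j := fun j => rfl
    have hu'k : u' k = c := by rw [hu'j, if_pos rfl]
    have hu'd : u' ∈ Q.dom := by
      refine hball u' ?_
      rw [EuclideanSpace.dist_eq, Real.sqrt_lt' (by positivity)]
      have hsum : ∑ j, dist (u j) (u' j) ^ 2 = |u k - c| ^ 2 := by
        rw [Finset.sum_eq_single k]
        · rw [hu'k, Real.dist_eq]
        · intro j _ hj; rw [hu'j, if_neg hj, dist_self]; simp
        · simp
      rw [hsum]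
      have := pow_le_pow_left₀ (abs_nonneg _) hkc 2
      nlinarith
    have hpos := Q.pos i
    have hu'c : u' ∈ Q.ccube i := by
      intro j
      rw [hu'j]
      split_ifs with h
      · subst h; rcases hc with rfl | rfl <;> constructor <;> linarith
      · exact hi j
    have hax : ∀ m, u' ∈ Q.gate m → (∀ l, l ≠ Q.ax m → Q.a i l < u' l ∧ u' l < Q.a i l + Q.s i) →
        u ∈ Deep (Q.lo m) (Q.hi m) e := by
      intro m hg hin
      have hkm : k = Q.ax m := by
        by_contra hne
        have := hin k hne
        rw [hu'k] at this
        rcases hc with rfl | rfl <;> linarith [this.1, this.2]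
      refine deep_gbox_of_near hn he0 hball hg ?_ fun l hl => ?_
      · rw [← hkm, ← hg.1, ← hkm, hu'k]; exact hkc
      · rw [hu'j, if_neg (hkm ▸ hl)]
    rcases mem_dom_ccube hu'd hu'c with h | h | ⟨m, rfl, h⟩
    · have := h k
      rw [hu'k] at this
      rcases hc with rfl | rfl <;> linarith [this.1, this.2]
    · refine Or.inl (hax i h fun l hl => ?_)
      have h1 := h.2 l hl
      have h2 := Q.incl i l hl
      constructor <;> linarith
    · exact Or.inr ⟨m, rfl, hax m h h.2⟩

/-- A point of depth d/4 in a chart has d/2 at most equal to any side of it. For a gate box a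
lateral side is used, as the axial one is twice as long. -/
theorem bdryDist_le (hn : 2 ≤ n) (hb : Bornology.IsBounded Q.dom) {i : ℕ} {u : En n}
    (hu : u ∈ Q.dom) (hi : u ∈ Q.ccube i) : bdryDist Q.dom u ≤ 2 * Q.s i := by
  have hgb : ∀ m, u ∈ Deep (Q.lo m) (Q.hi m) (bdryDist Q.dom u / 4) →
      bdryDist Q.dom u ≤ 2 * Q.s (m + 1) := by
    intro m h
    have : Nontrivial (Fin n) := Fin.nontrivial_iff_two_le.mpr hn
    obtain ⟨l, hl⟩ := exists_ne (Q.ax m)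
    have := h l
    rw [lo, QH.CubeChain.hi, if_neg hl, if_neg hl] at this
    linarith
  rcases exists_chart hn hb hu hi with h | h | ⟨m, rfl, h⟩
  · have := h ⟨0, by omega⟩
    linarith
  · have := Q.anti i
    linarith [hgb i h]
  · exact hgb m h

end CubeChain
end QH

namespace QH.CubeChain
variable {n : ℕ} {Q : CubeChain n}

/-! ### Quasihyperbolic distances in small connected sets -/

/-- A connected set of small diameter meets only few cubes. -/
theorem lt_add_of_small {E : Set (En n)} (hE : IsPreconnected E) (hsub : E ⊆ Q.dom) {l : ℝ}
    (hl0 : 0 < l) (hl : ∀ u ∈ E, ∀ v ∈ E, dist u v ≤ l) {u v : En n} (hu : u ∈ E) (hv : v ∈ E)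
    {i j : ℕ} (hui : u ∈ Q.ccube i) (hvj : v ∈ Q.ccube j) (hls : l ≤ Q.s (i + 4 ^ n)) :
    j < i + 4 ^ n := by
  by_contra hij
  push Not at hij
  -- The set would meet 4^n + 1 cubes of side at least l, but with ρ = δ = l the count is at most (2
  -- + 2)^n.
  have h := card_le_of_meets (Q := Q) (S := Finset.Icc i (i + 4 ^ n)) hl0 hl0.le u
    (fun m hm => hls.trans (s_anti (Finset.mem_Icc.mp hm).2)) (fun m hm => by
      rw [Finset.mem_Icc] at hm
      rcases hm.2.trans hij |>.lt_or_eq with h | rfl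
      · obtain ⟨w, hw, hg⟩ := inter_gate_nonempty hE hsub hu hv hui hvj hm.1 h
        exact ⟨w, gate_subset_ccube m hg, fun k => (abs_sub_le_dist w u k).trans (hl w hw u hu)⟩
      · exact ⟨v, hvj, fun k => (abs_sub_le_dist v u k).trans (hl v hv u hu)⟩)
  rw [Nat.card_Icc, div_self hl0.ne'] at h
  have e : (2 * (1 : ℝ) + 2) ^ n = ((4 ^ n : ℕ) : ℝ) := by push_cast; norm_num
  rw [e, Nat.cast_le] at h
  omega

/-- Sides at most halve from one cube to the next, so the factor 2^(4^n) keeps the next 4^n cubes at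
least as large as l; earlier cubes are larger anyway. -/
theorem lt_add_and_lt_add_of_small {E : Set (En n)} (hE : IsPreconnected E) (hsub : E ⊆ Q.dom) {l : ℝ}
    (hl0 : 0 < l) (hl : ∀ u ∈ E, ∀ v ∈ E, dist u v ≤ l) {u v : En n} (hu : u ∈ E) (hv : v ∈ E)
    {i j : ℕ} (hui : u ∈ Q.ccube i) (hvj : v ∈ Q.ccube j) (hls : 2 ^ (4 ^ n) * l ≤ Q.s i) :
    j < i + 4 ^ n ∧ i < j + 4 ^ n := by
  have h2 : l ≤ Q.s (i + 4 ^ n) :=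
    le_of_mul_le_mul_left (hls.trans (s_le_pow_mul i (4 ^ n))) (by positivity)
  refine ⟨lt_add_of_small hE hsub hl0 hl hu hv hui hvj h2, ?_⟩
  by_contra hij
  push Not at hij
  have h3 : l ≤ Q.s i := by
    have : (1 : ℝ) ≤ 2 ^ (4 ^ n) := one_le_pow₀ (by norm_num)
    nlinarith
  exact absurd (lt_add_of_small hE hsub hl0 hl hv hu hvj hui (h3.trans (s_anti hij))) (by omega)

theorem dist_le_of_near {p q e e' : En n} {l : ℝ} (hp : dist e p ≤ n * l) (hq : dist e' q ≤ n * l)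
    (h : dist e e' ≤ l) : dist p q ≤ (2 * n + 1) * l := by
  have h1 := dist_triangle4 p e e' q
  rw [dist_comm p e] at h1
  linarith

/-- Deep points of the cubes along a connected set of small diameter are quasihyperbolically
close. -/
theorem qhDist_le_of_deep (hn : 1 ≤ n) (hb : Bornology.IsBounded Q.dom) {E : Set (En n)}
    (hE : IsPreconnected E) (hsub : E ⊆ Q.dom) {l : ℝ} (hl0 : 0 < l)
    (hl : ∀ u ∈ E, ∀ v ∈ E, dist u v ≤ l) {a b : ℕ} (hab : a ≤ b) (hs : 2 * l ≤ Q.s b)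
    {e p : En n} (he : e ∈ E) (hea : e ∈ Q.ccube a)
    (hp : p ∈ Deep (Q.a a) (fun k => Q.a a k + Q.s a) l) (hep : dist e p ≤ n * l)
    {e' q : En n} (he' : e' ∈ E) (heb : e' ∈ Q.ccube b)
    (hq : q ∈ Deep (Q.a b) (fun k => Q.a b k + Q.s b) l) (heq : dist e' q ≤ n * l) :
    qhDist Q.dom p q ≤ ENNReal.ofReal ((b - a + 1) * (2 * n + 1)) := by
  have hΩ := isBoundedDomain hb
  have hlink : ∀ {p q e e' : En n} {α β : Fin n → ℝ}, Box α β ⊆ Q.dom → p ∈ Deep α β l →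
      q ∈ Deep α β l → dist e p ≤ n * l → dist e' q ≤ n * l → e ∈ E → e' ∈ E →
      qhDist Q.dom p q ≤ ENNReal.ofReal (2 * n + 1) := by
    intro p q e e' α β hbox hp hq h1 h2 h3 h4
    refine (Deep.qhDist_le hn hΩ hbox hl0 hp hq).trans (ENNReal.ofReal_le_ofReal ?_)
    rw [div_le_iff₀ hl0]
    exact dist_le_of_near h1 h2 (hl e h3 e' h4)
  induction b, hab using Nat.le_induction generalizing e' q with
  | base =>
    refine (hlink (cube_subset_dom a) hp hq hep heq he he').trans (ENNReal.ofReal_le_ofReal ?_)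
    rw [sub_self, zero_add, one_mul]
  | succ b hab ih =>
    obtain ⟨g, hgE, hg⟩ := inter_gate_nonempty hE hsub he he' hea heb hab (Nat.lt_succ_self b)
    -- The crossing point of the gate is pushed to depth l inside the mirror cube; the result is
    -- deep in the cube b and in the gate box b alike, so each link stays in one convex chart.
    obtain ⟨α, h1, h2, h3⟩ := Q.exists_mirror b
    obtain ⟨r, hr, hgr⟩ := exists_clamp hl0.le hs
      (h3 g (gate_subset_gbox b hg) (gate_subset_ccube b hg))
    have hk1 := ih (hs.trans (Q.anti b)) hgE (gate_subset_ccube b hg) (Deep.mono hr h1) hgr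
    have hk2 := hlink (gbox_subset_dom b) (Deep.mono hr h2)
      (Deep.mono hq (cube_succ_le_gbox b)) hgr heq hgE he'
    refine (qhDist_triangle p r q).trans ((add_le_add hk1 hk2).trans ?_)
    have hab' : (a : ℝ) ≤ b := by exact_mod_cast hab
    rw [← ENNReal.ofReal_add (mul_nonneg (by linarith) (by positivity)) (by positivity)]
    refine ENNReal.ofReal_le_ofReal ?_
    push_cast
    linarith

/-- Every point of the domain climbs to a deep point of its cube. -/
theorem exists_deep_near (hn : 2 ≤ n) (hb : Bornology.IsBounded Q.dom) {i : ℕ} {u : En n}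
    (hu : u ∈ Q.dom) (hi : u ∈ Q.ccube i) {l : ℝ} (hl0 : 0 < l) (hs : 2 * l ≤ Q.s (i + 1)) :
    ∃ p, p ∈ Deep (Q.a i) (fun k => Q.a i k + Q.s i) l ∧ dist u p ≤ n * l ∧
      qhDist Q.dom u p ≤ ENNReal.ofReal (2 * n * (4 + Real.log (1 + l / bdryDist Q.dom u))) := by
  have hΩ := isBoundedDomain hb
  have hn1 : 1 ≤ n := by omega
  have hd := bdryDist_pos hn1 hΩ hu
  set d := bdryDist Q.dom u with hd'
  have hclimb : ∀ {α β : Fin n → ℝ} {p : En n}, Box α β ⊆ Q.dom → u ∈ Deep α β (d / 4) →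
      p ∈ Deep α β l → dist u p ≤ n * l →
      qhDist Q.dom u p ≤ ENNReal.ofReal (2 * n * (4 + Real.log (1 + l / d))) := by
    intro α β p hbox h1 h2 h3
    refine (Deep.climb hn1 hΩ hbox (by positivity) hl0 h1 h2).trans (ENNReal.ofReal_le_ofReal ?_)
    have h4 : dist u p / l ≤ n := by rwa [div_le_iff₀ hl0]
    have hld : 0 < l / d := by positivity
    have h5 : Real.log (1 + l / (d / 4)) ≤ 3 + Real.log (1 + l / d) := by
      have e1 : 1 + l / (d / 4) ≤ 4 * (1 + l / d) := by
        have : l / (d / 4) = 4 * (l / d) := by field_simp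
        rw [this]; linarith
      have e2 : 0 < l / (d / 4) := by positivity
      have e3 := Real.log_le_log (by linarith) e1
      rw [Real.log_mul (by norm_num) (by linarith)] at e3
      have e4 := Real.log_le_sub_one_of_pos (show (0 : ℝ) < 4 by norm_num)
      linarith
    have h6 : 0 ≤ Real.log (1 + l / (d / 4)) := Real.log_nonneg (by
      have : 0 < l / (d / 4) := by positivity
      linarith)
    have h7 : 0 ≤ dist u p / l := by positivity
    calc 2 * (dist u p / l) * (1 + Real.log (1 + l / (d / 4)))
        ≤ 2 * n * (1 + Real.log (1 + l / (d / 4))) := by gcongr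
      _ ≤ _ := by
        refine mul_le_mul_of_nonneg_left ?_ (by positivity)
        linarith
  rcases exists_chart hn hb hu hi with h | h | ⟨m, rfl, h⟩
  · obtain ⟨p, hp, hup⟩ := exists_clamp hl0.le (hs.trans (Q.anti i)) hi
    exact ⟨p, hp, hup, hclimb (cube_subset_dom i) h hp hup⟩
  · obtain ⟨α, h1, h2, h3⟩ := Q.exists_mirror i
    have hug : u ∈ Q.gbox i := Deep.ball_subset h (Metric.mem_ball_self (by positivity))
    obtain ⟨p, hp, hup⟩ := exists_clamp hl0.le hs (h3 u hug hi)
    exact ⟨p, Deep.mono hp h1, hup, hclimb (gbox_subset_dom i) h (Deep.mono hp h2) hup⟩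
  · obtain ⟨p, hp, hup⟩ := exists_clamp hl0.le (hs.trans (Q.anti (m + 1))) hi
    exact ⟨p, hp, hup, hclimb (gbox_subset_dom m) h (Deep.mono hp (cube_succ_le_gbox m)) hup⟩

/-- The constant in `qhDist_le_of_small`. -/
def smallConst (n : ℕ) : ℕ := 2 * 4 ^ n * (2 * n + 1) + 16 * n

/-- In a connected set of small diameter the quasihyperbolic distance is controlled by the
logarithms of the distances to the boundary. -/
theorem qhDist_le_of_small (hn : 2 ≤ n) (hb : Bornology.IsBounded Q.dom) {E : Set (En n)}
    (hE : IsPreconnected E) (hsub : E ⊆ Q.dom) {l : ℝ} (hl0 : 0 < l)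
    (hl : ∀ u ∈ E, ∀ v ∈ E, dist u v ≤ l) {z : En n} (hz : z ∈ E) {i : ℕ} (hzi : z ∈ Q.ccube i)
    (hs : 2 ^ (4 ^ n + 2) * l ≤ Q.s i) {u v : En n} (hu : u ∈ E) (hv : v ∈ E) :
    qhDist Q.dom u v ≤ ENNReal.ofReal (smallConst n * (1 + Real.log (1 + l / bdryDist Q.dom u) +
      Real.log (1 + l / bdryDist Q.dom v))) := by
  have hΩ := isBoundedDomain hb
  have hn1 : 1 ≤ n := by omega
  obtain ⟨iu, hiu⟩ := exists_mem_ccube (hsub hu)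
  obtain ⟨iv, hiv⟩ := exists_mem_ccube (hsub hv)
  wlog huv : iu ≤ iv generalizing u v iu iv
  · rw [qhDist_comm, add_right_comm]
    exact this hv hu iv hiv iu hiu (by omega)
  have hs' : 2 ^ (4 ^ n) * l ≤ Q.s i := by
    rw [pow_add] at hs
    have : 0 < 2 ^ (4 ^ n) * l := by positivity
    linarith
  have h1 := lt_add_and_lt_add_of_small hE hsub hl0 hl hz hu hzi hiu hs'
  have h2 := lt_add_and_lt_add_of_small hE hsub hl0 hl hz hv hzi hiv hs'
  have hsm : ∀ m, m ≤ i + 4 ^ n → 2 * l ≤ Q.s m := by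
    intro m hm
    have h3 := hs.trans (s_le_pow_mul i (4 ^ n + 1))
    rw [pow_succ (2 : ℝ) (4 ^ n + 1), mul_assoc] at h3
    exact (le_of_mul_le_mul_left h3 (by positivity)).trans (s_anti (by omega))
  obtain ⟨p, hp, hup, hkp⟩ := exists_deep_near hn hb (hsub hu) hiu hl0 (hsm _ (by omega))
  obtain ⟨q, hq, hvq, hkq⟩ := exists_deep_near hn hb (hsub hv) hiv hl0 (hsm _ (by omega))
  have hk := qhDist_le_of_deep hn1 hb hE hsub hl0 hl huv (hsm _ (by omega)) hu hiu hp hup hv hiv hq hvq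
  have hlog : ∀ w ∈ E, 0 ≤ Real.log (1 + l / bdryDist Q.dom w) := fun w hw => Real.log_nonneg (by
    have := bdryDist_pos hn1 hΩ (hsub hw)
    have : 0 < l / bdryDist Q.dom w := by positivity
    linarith)
  have hu0 := hlog u hu
  have hv0 := hlog v hv
  have huv' : (iu : ℝ) ≤ iv := by exact_mod_cast huv
  have hlt : (iv : ℝ) - iu + 1 ≤ 2 * 4 ^ n := by
    have : iv + 1 ≤ iu + 2 * 4 ^ n := by omega
    have : (iv : ℝ) + 1 ≤ iu + 2 * 4 ^ n := by exact_mod_cast this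
    linarith
  rw [qhDist_comm] at hkq
  refine (qhDist_triangle u p v).trans ((add_le_add hkp
    ((qhDist_triangle p q v).trans (add_le_add hk hkq))).trans ?_)
  rw [← ENNReal.ofReal_add (mul_nonneg (by linarith) (by positivity)) (by positivity),
    ← ENNReal.ofReal_add (by positivity) (add_nonneg (mul_nonneg (by linarith) (by positivity))
      (by positivity))]
  refine ENNReal.ofReal_le_ofReal ?_
  have h3 : ((iv : ℝ) - iu + 1) * (2 * n + 1) ≤ 2 * 4 ^ n * (2 * n + 1) :=
    mul_le_mul_of_nonneg_right hlt (by positivity)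
  have h4 : (smallConst n : ℝ) = 2 * 4 ^ n * (2 * n + 1) + 16 * n := by
    rw [smallConst]; push_cast; ring
  rw [h4]
  have h5 : (0 : ℝ) ≤ 2 * 4 ^ n * (2 * n + 1) + 14 * n := by positivity
  nlinarith [mul_nonneg h5 hu0, mul_nonneg h5 hv0]

end QH.CubeChain

namespace QH
variable {n : ℕ} {Ω : Set (En n)}

/-! ### Geodesics near the boundary -/

theorem setLIntegral_Icc_ofReal {h : ℝ → ℝ} (hc : Continuous h) (h0 : ∀ s, 0 ≤ h s) {a b : ℝ}
    (hab : a ≤ b) :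
    ∫⁻ s in Icc a b, ENNReal.ofReal (h s) = ENNReal.ofReal (∫ s in a..b, h s) := by
  rw [intervalIntegral.integral_of_le hab, ← integral_Icc_eq_integral_Ioc,
    ofReal_integral_eq_lintegral_ofReal (hc.integrableOn_Icc) (Filter.Eventually.of_forall h0)]

/-- A positive function whose reciprocal has an integral growing at most logarithmically in the
reciprocal itself cannot stay small. -/
theorem exists_large_of_integral_le_log {f : ℝ → ℝ} (hf : Continuous f) (hf0 : ∀ s, 0 < f s)
    {A B ρ : ℝ} (hA : 1 ≤ A) (hB : 0 < B) (hρ : 0 < ρ)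
    (h : ∀ τ ∈ Icc 0 ρ, ∫ s in (0 : ℝ)..τ, 1 / f s ≤ B + A * Real.log (1 + 2 * ρ / f τ)) :
    ∃ τ ∈ Icc 0 (ρ / 2), ρ / (2 * (B + A * Real.log (8 * A))) ≤ f τ := by
  set B' := B + A * Real.log (8 * A) with hB'
  have hlog : 0 ≤ Real.log (8 * A) := Real.log_nonneg (by linarith)
  have hB'0 : 0 < B' := by positivity
  have hfi : Continuous fun s => 1 / f s := continuous_const.div hf fun s => (hf0 s).ne'
  set G : ℝ → ℝ := fun τ => ∫ s in (0 : ℝ)..τ, 1 / f s with hG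
  have hGd : ∀ τ, HasDerivAt G (1 / f τ) τ := fun τ =>
    intervalIntegral.integral_hasDerivAt_right (hfi.intervalIntegrable _ _)
      (hfi.stronglyMeasurableAtFilter _ _) hfi.continuousAt
  -- Exponentiating the hypothesis gives 1 ≤ H + 2ρH/f, while H' = -H/(Af). So as long as H ≤ 1/2, H
  -- decreases at least at the rate 1/(4Aρ).
  set H : ℝ → ℝ := fun τ => Real.exp (-(G τ - B) / A) with hH
  have hHd : ∀ τ, HasDerivAt H (H τ * (-(1 / f τ) / A)) τ := fun τ =>
    ((((hGd τ).sub_const B).neg).div_const A).exp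
  have hH0 : ∀ τ, 0 < H τ := fun τ => Real.exp_pos _
  have hkey : ∀ τ ∈ Icc 0 ρ, 1 ≤ H τ + H τ * (2 * ρ) / f τ := by
    intro τ hτ
    have h1 := h τ hτ
    have hfτ := hf0 τ
    have h2 : (G τ - B) / A ≤ Real.log (1 + 2 * ρ / f τ) := by
      rw [div_le_iff₀ (by linarith)]; linarith
    have h3 := Real.exp_le_exp.mpr h2
    rw [Real.exp_log (by positivity)] at h3
    have h4 : H τ * Real.exp ((G τ - B) / A) = 1 := by
      rw [hH, ← Real.exp_add, neg_div, neg_add_cancel, Real.exp_zero]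
    calc (1 : ℝ) = H τ * Real.exp ((G τ - B) / A) := h4.symm
      _ ≤ H τ * (1 + 2 * ρ / f τ) := mul_le_mul_of_nonneg_left h3 (hH0 τ).le
      _ = _ := by ring
  have hanti : Antitone H := antitone_of_deriv_nonpos (fun τ => (hHd τ).differentiableAt) fun τ => by
    rw [(hHd τ).deriv]
    have := hf0 τ
    have : 0 ≤ 1 / f τ / A := by positivity
    have := mul_nonneg (hH0 τ).le this
    rw [neg_div]; linarith
  -- Otherwise the decrease over [ρ/2, ρ], at least 1/(8A), would make H negative.
  have hhalf : 1 / (8 * A) ≤ H (ρ / 2) := by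
    by_contra hlt
    push Not at hlt
    have h18 : 1 / (8 * A) ≤ 1 / 2 := one_div_le_one_div_of_le (by norm_num) (by linarith)
    have hder : ∀ τ ∈ Ioo (ρ / 2) ρ, deriv H τ ≤ -(1 / (4 * A * ρ)) := by
      intro τ hτ
      rw [(hHd τ).deriv]
      have h1 := hkey τ ⟨by linarith [hτ.1], hτ.2.le⟩
      have h2 : H τ ≤ 1 / 2 := (hanti hτ.1.le).trans (hlt.le.trans h18)
      have h3 : 1 / 2 ≤ H τ * (2 * ρ) / f τ := by linarith
      have hfτ := hf0 τ
      have e : H τ * (-(1 / f τ) / A) = -(H τ * (2 * ρ) / f τ * (1 / (2 * A * ρ))) := by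
        field_simp
      rw [e, neg_le_neg_iff]
      calc 1 / (4 * A * ρ) = 1 / 2 * (1 / (2 * A * ρ)) := by field_simp; norm_num
        _ ≤ _ := mul_le_mul_of_nonneg_right h3 (by positivity)
    have hmv := Convex.image_sub_le_mul_sub_of_deriv_le (convex_Icc (ρ / 2) ρ)
      (fun τ _ => (hHd τ).continuousAt.continuousWithinAt)
      (fun τ _ => (hHd τ).differentiableAt.differentiableWithinAt)
      (by rw [interior_Icc]; exact hder) (ρ / 2) ⟨le_rfl, by linarith⟩ ρ ⟨by linarith, le_rfl⟩
      (by linarith)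
    have e : -(1 / (4 * A * ρ)) * (ρ - ρ / 2) = -(1 / (8 * A)) := by field_simp; ring
    rw [e] at hmv
    linarith [hH0 ρ]
  have hGhalf : G (ρ / 2) ≤ B' := by
    have h1 := Real.log_le_log (by positivity) hhalf
    rw [hH, Real.log_exp, one_div, Real.log_inv, le_div_iff₀ (by linarith)] at h1
    rw [hB']; linarith
  obtain ⟨τ, hτ, hmax⟩ := isCompact_Icc.exists_isMaxOn (nonempty_Icc.mpr (show 0 ≤ ρ / 2 by linarith))
    hf.continuousOn
  refine ⟨τ, hτ, ?_⟩
  have h1 : ∫ _ in (0 : ℝ)..(ρ / 2), 1 / f τ ≤ G (ρ / 2) :=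
    intervalIntegral.integral_mono_on (by linarith) (by simp) (hfi.intervalIntegrable _ _)
      fun s hs => one_div_le_one_div_of_le (hf0 s) (hmax hs)
  rw [intervalIntegral.integral_const, smul_eq_mul, sub_zero] at h1
  have h2 := h1.trans hGhalf
  have := hf0 τ
  rw [mul_one_div, div_le_iff₀ this] at h2
  rw [div_le_iff₀ (by positivity)]
  linarith

/-- The bound obtained for the reciprocal density. -/
noncomputable def escapeConst (A M : ℝ) : ℝ :=
  A * (1 + Real.log (1 + 2 * M)) + A * Real.log (8 * A)

/-- `escapeConst A M` grows like log M, and M beats every power of log M. The exponent needed is 2A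
+ 1: the factor 2A comes from the two logarithms on the left, one more from the denominator on the
right. -/
theorem exists_escape_threshold {A : ℕ} (hA : 1 ≤ A) : ∃ M : ℝ, 1 ≤ M ∧
    A * (1 + 2 * Real.log (1 + 4 * escapeConst A M)) < Real.log (M / (2 * escapeConst A M)) := by
  have hA' : (1 : ℝ) ≤ A := by exact_mod_cast hA
  have h8 : 0 ≤ Real.log (8 * A) := Real.log_nonneg (by linarith)
  set k := 2 * A + 1 with hk
  set D : ℝ := 1 + 4 * A + 4 * A * Real.log (8 * A) + 4 * A with hD
  have hD0 : 0 < D := by positivity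
  have hε : (0 : ℝ) < 1 / (4 * Real.exp A * D ^ k) := by positivity
  have h1 := (Real.isLittleO_pow_log_id_atTop (n := k)).bound hε
  have h2 := Real.tendsto_log_atTop.eventually_ge_atTop 1
  obtain ⟨y, ⟨h1, h2⟩, hy⟩ := ((h1.and h2).and (Filter.eventually_ge_atTop (3 : ℝ))).exists
  have hy0 : 0 < y := by linarith
  refine ⟨(y - 1) / 2, by linarith, ?_⟩
  set M := (y - 1) / 2 with hM
  have hyM : 1 + 2 * M = y := by rw [hM]; ring
  have hE : escapeConst A M = A * (1 + Real.log y) + A * Real.log (8 * A) := by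
    rw [escapeConst, hyM]
  have hE0 : 0 < escapeConst A M := by rw [hE]; positivity
  set X := 1 + 4 * escapeConst A M with hX
  have hX0 : 0 < X := by positivity
  have hXD : X ≤ D * Real.log y := by
    rw [hX, hE, hD]
    have h3 : (0 : ℝ) ≤ 1 + 4 * A + 4 * A * Real.log (8 * A) := by positivity
    nlinarith [mul_le_mul_of_nonneg_left h2 h3]
  have h3 : Real.exp A * X ^ k ≤ y / 4 := by
    rw [Real.norm_of_nonneg (by positivity), id, Real.norm_of_nonneg hy0.le] at h1
    calc Real.exp A * X ^ k ≤ Real.exp A * (D * Real.log y) ^ k := by gcongr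
      _ = Real.exp A * D ^ k * Real.log y ^ k := by rw [mul_pow]; ring
      _ ≤ Real.exp A * D ^ k * (1 / (4 * Real.exp A * D ^ k) * y) := by gcongr
      _ = y / 4 := by field_simp
  have h4 : Real.exp A * X ^ (2 * A) < M / (2 * escapeConst A M) := by
    rw [lt_div_iff₀ (by positivity)]
    have h5 : Real.exp A * X ^ (2 * A) * (2 * escapeConst A M) ≤ Real.exp A * X ^ k := by
      rw [hk, pow_succ, ← mul_assoc (Real.exp A)]
      have h2X : 2 * escapeConst A M ≤ X := by rw [hX]; linarith
      exact mul_le_mul_of_nonneg_left h2X (by positivity)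
    have : y / 4 < M := by rw [hM]; linarith
    linarith
  have h5 := Real.log_lt_log (by positivity) h4
  rw [Real.log_mul (Real.exp_pos _).ne' (by positivity), Real.log_exp, Real.log_pow] at h5
  push_cast at h5
  linarith

namespace CubeChain

/-- A point of a geodesic much closer to the boundary than the size of its cube is near an
endpoint. -/
theorem exists_endpoint_near (hn : 2 ≤ n) : ∃ M : ℝ, 1 ≤ M ∧ ∀ Q : CubeChain n,
    Bornology.IsBounded Q.dom → ∀ (x y : En n) (L : ℝ) (g : ℝ → En n), IsQHGeodesic Q.dom x y L g →
    ∀ t ∈ Icc 0 L, ∀ i, g t ∈ Q.ccube i →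
    2 ^ (4 ^ n + 2) * (2 * (M * bdryDist Q.dom (g t))) ≤ Q.s i →
    t ≤ M * bdryDist Q.dom (g t) ∨ L - t ≤ M * bdryDist Q.dom (g t) := by
  have hA : 1 ≤ smallConst n := by rw [smallConst]; omega
  obtain ⟨M, hM1, hM⟩ := exists_escape_threshold hA
  refine ⟨M, hM1, fun Q hb x y L g hg t ht i hi hs => ?_⟩
  have hn1 : 1 ≤ n := by omega
  have hΩ := isBoundedDomain hb
  have hc := hg.lipCurve
  set A : ℝ := (smallConst n : ℝ) with hAdef
  have hA' : (1 : ℝ) ≤ A := by rw [hAdef]; exact_mod_cast hA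
  set h := bdryDist Q.dom (g t) with hh
  have hh0 : 0 < h := bdryDist_pos hn1 hΩ (hc.mem t ht.1 ht.2)
  set ρ := M * h with hρ
  have hρ0 : 0 < ρ := by positivity
  -- If both endpoints are far, the geodesic contains a window of radius ρ = M h about t. In it
  -- quasihyperbolic distances are logarithmic, which forces points a, b far from the boundary on
  -- both sides of t. They are then close to each other, although the geodesic between them passes
  -- the point g(t) close to the boundary.
  by_contra! hcon
  obtain ⟨hc1, hc2⟩ := hcon
  set E : Set (En n) := g '' Icc (t - ρ) (t + ρ) with hE
  have hsubI : Icc (t - ρ) (t + ρ) ⊆ Icc 0 L := fun s hs => ⟨by linarith [hs.1], by linarith [hs.2]⟩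
  have hEp : IsPreconnected E := isPreconnected_Icc.image g (hc.continuousOn.mono hsubI)
  have hEsub : E ⊆ Q.dom := by
    rintro _ ⟨s, hs, rfl⟩
    exact hc.mem s (hsubI hs).1 (hsubI hs).2
  have hEl : ∀ u ∈ E, ∀ v ∈ E, dist u v ≤ 2 * ρ := by
    rintro _ ⟨s, hs, rfl⟩ _ ⟨s', hs', rfl⟩
    refine (hc.lipschitzOnWith.dist_le_mul s (hsubI hs) s' (hsubI hs')).trans ?_
    rw [NNReal.coe_one, one_mul, Real.dist_eq]
    exact abs_sub_le_iff.mpr ⟨by linarith [hs.2, hs'.1], by linarith [hs'.2, hs.1]⟩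
  have hmemE : ∀ s ∈ Icc (t - ρ) (t + ρ), g s ∈ E := fun s hs => mem_image_of_mem g hs
  have htE : g t ∈ E := hmemE t ⟨by linarith, by linarith⟩
  have hk : ∀ u ∈ E, ∀ v ∈ E, qhDist Q.dom u v ≤ ENNReal.ofReal (A * (1 +
      Real.log (1 + 2 * ρ / bdryDist Q.dom u) + Real.log (1 + 2 * ρ / bdryDist Q.dom v))) :=
    fun u hu v hv => qhDist_le_of_small hn hb hEp hEsub (by positivity) hEl htE hi hs hu hv
  have hl : 2 * ρ / h = 2 * M := by rw [hρ]; field_simp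
  have hlog0 : ∀ c : ℝ, 0 < c → 0 ≤ Real.log (1 + c) := fun c hc => Real.log_nonneg (by linarith)
  have hdpos : ∀ u ∈ E, 0 < bdryDist Q.dom u := fun u hu => bdryDist_pos hn1 hΩ (hEsub hu)
  have hmem : ∀ (ε : ℝ), (ε = 1 ∨ ε = -1) → ∀ τ ∈ Icc 0 ρ, t + ε * τ ∈ Icc (t - ρ) (t + ρ) := by
    rintro ε (rfl | rfl) τ hτ <;> constructor <;> linarith [hτ.1, hτ.2]
  have side : ∀ ε : ℝ, (ε = 1 ∨ ε = -1) →
      ∃ τ ∈ Icc 0 ρ, ρ / (2 * escapeConst A M) ≤ bdryDist Q.dom (g (t + ε * τ)) := by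
    intro ε hε
    -- Clamping makes the distance to the boundary a positive continuous function on the whole line.
    set π : ℝ → ℝ := fun τ => max 0 (min τ ρ) with hπ
    have hπmem : ∀ τ, π τ ∈ Icc 0 ρ := fun τ =>
      ⟨le_max_left _ _, max_le hρ0.le (min_le_right _ _)⟩
    have hπid : ∀ τ ∈ Icc 0 ρ, π τ = τ := fun τ hτ => by
      rw [hπ]; dsimp only; rw [min_eq_left hτ.2, max_eq_right hτ.1]
    set f : ℝ → ℝ := fun τ => bdryDist Q.dom (g (t + ε * π τ)) with hf
    have hfc : Continuous f := by
      have h1 : Continuous fun τ => t + ε * π τ := by fun_prop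
      exact continuous_bdryDist.comp (hc.continuousOn.comp_continuous h1 fun τ =>
        hsubI (hmem ε hε _ (hπmem τ)))
    have hf0 : ∀ s, 0 < f s := fun s => hdpos _ (hmemE _ (hmem ε hε _ (hπmem s)))
    have hfi : Continuous fun s => 1 / f s := continuous_const.div hfc fun s => (hf0 s).ne'
    obtain ⟨τ, hτ, hτf⟩ := exists_large_of_integral_le_log hfc hf0 hA'
      (B := A * (1 + Real.log (1 + 2 * M)))
      (by have := hlog0 (2 * M) (by linarith); positivity) hρ0 (fun τ hτ => by
        have hkτ := hk _ htE _ (hmemE _ (hmem ε hε τ hτ))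
        rw [← hh, hl] at hkτ
        have hfτ : f τ = bdryDist Q.dom (g (t + ε * τ)) := by rw [hf]; dsimp only; rw [hπid τ hτ]
        have hlogτ := hlog0 (2 * ρ / bdryDist Q.dom (g (t + ε * τ)))
          (div_pos (by positivity) (hfτ ▸ hf0 τ))
        have hlogM := hlog0 (2 * M) (by linarith)
        have hint : ∫⁻ s in Icc 0 τ, ENNReal.ofReal (1 / f s) ≤ qhDist Q.dom (g t) (g (t + ε * τ)) := by
          have hcongr : ∫⁻ s in Icc 0 τ, ENNReal.ofReal (1 / f s) =
              ∫⁻ s in Icc 0 τ, ENNReal.ofReal (1 / bdryDist Q.dom (g (t + ε * s))) := by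
            refine setLIntegral_congr_fun measurableSet_Icc fun s hs => ?_
            simp only [hf]
            rw [hπid s ⟨hs.1, hs.2.trans hτ.2⟩]
          rw [hcongr]
          rcases hε with rfl | rfl
          · have h1 := hg.arc_le hn1 hΩ ht.1 (show t ≤ t + 1 * τ by linarith [hτ.1])
              (by linarith [hτ.2])
            rw [← qhLength_sub] at h1
            rw [show t + 1 * τ - t = τ by ring] at h1
            refine le_trans (le_of_eq ?_) h1
            rw [qhLength]
            simp only [one_mul, add_comm t]
          · have h1 := hg.arc_le hn1 hΩ (show 0 ≤ t + -1 * τ by linarith [hτ.2])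
              (show t + -1 * τ ≤ t by linarith [hτ.1]) ht.2
            rw [qhDist_comm] at h1
            refine le_trans (le_of_eq ?_) h1
            have h2 := setLIntegral_comp_sub_left
              (fun s => ENNReal.ofReal (1 / bdryDist Q.dom (g s))) 0 τ t
            rw [sub_zero] at h2
            rw [show t + -1 * τ = t - τ by ring, ← h2]
            simp only [neg_mul, one_mul, sub_eq_add_neg]
        rw [setLIntegral_Icc_ofReal hfi (fun s => (one_div_pos.mpr (hf0 s)).le) hτ.1] at hint
        have h3 := (ENNReal.ofReal_le_ofReal_iff (by positivity)).mp (hint.trans hkτ)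
        rw [hfτ]
        linarith)
    refine ⟨τ, ⟨hτ.1, by linarith [hτ.2]⟩, ?_⟩
    have hτ' : τ ∈ Icc 0 ρ := ⟨hτ.1, by linarith [hτ.2]⟩
    have hfτ : f τ = bdryDist Q.dom (g (t + ε * τ)) := by rw [hf]; dsimp only; rw [hπid τ hτ']
    rw [← hfτ]
    exact hτf
  obtain ⟨τ₁, hτ₁, h1⟩ := side (-1) (Or.inr rfl)
  obtain ⟨τ₂, hτ₂, h2⟩ := side 1 (Or.inl rfl)
  have hm1 := hmem (-1) (Or.inr rfl) τ₁ hτ₁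
  have hm2 := hmem 1 (Or.inl rfl) τ₂ hτ₂
  set a := t + -1 * τ₁ with ha
  set b := t + 1 * τ₂ with hb'
  have hat : a ≤ t := by rw [ha]; linarith [hτ₁.1]
  have htb : t ≤ b := by rw [hb']; linarith [hτ₂.1]
  have hE0 : 0 < escapeConst A M := by
    have := hlog0 (2 * M) (by linarith)
    have h8 : 0 ≤ Real.log (8 * A) := Real.log_nonneg (by linarith)
    rw [escapeConst]; positivity
  have hlogle : ∀ u ∈ E, ρ / (2 * escapeConst A M) ≤ bdryDist Q.dom u →
      Real.log (1 + 2 * ρ / bdryDist Q.dom u) ≤ Real.log (1 + 4 * escapeConst A M) := by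
    intro u hu hle
    have hd := hdpos u hu
    refine Real.log_le_log (by positivity) ?_
    rw [div_le_iff₀ (by positivity)] at hle
    have : 2 * ρ / bdryDist Q.dom u ≤ 4 * escapeConst A M := by
      rw [div_le_iff₀ hd]; linarith
    linarith
  have hupper := hk _ (hmemE a hm1) _ (hmemE b hm2)
  -- The arc from t to b starts at distance h from the boundary, and it is part of the minimizing
  -- arc from a to b.
  have hlower : ENNReal.ofReal (Real.log (1 + (b - t) / h)) ≤ qhDist Q.dom (g a) (g b) := by
    refine (hg.log_le hn1 hΩ ht.1 htb (hsubI hm2).2).trans ?_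
    refine le_trans ?_ (hg.arc_le hn1 hΩ (hsubI hm1).1 (hat.trans htb) (hsubI hm2).2)
    have h3 := qhDist_le (hc.sub ht.1 htb (hsubI hm2).2)
    rw [qhLength_sub] at h3
    exact h3.trans (lintegral_mono_set (Icc_subset_Icc_left hat))
  have hla := hlogle _ (hmemE a hm1) h1
  have hlb := hlogle _ (hmemE b hm2) h2
  have hda := hdpos _ (hmemE a hm1)
  have hdb := hdpos _ (hmemE b hm2)
  have hfin := (ENNReal.ofReal_le_ofReal_iff (by
    have := hlog0 (2 * ρ / bdryDist Q.dom (g a)) (by positivity)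
    have := hlog0 (2 * ρ / bdryDist Q.dom (g b)) (by positivity)
    positivity)).mp (hlower.trans hupper)
  have hlen : M / (2 * escapeConst A M) ≤ 1 + (b - t) / h := by
    have h3 : bdryDist Q.dom (g b) ≤ h + (b - t) := by
      have h4 := bdryDist_le_add (Ω := Q.dom) (g b) (g t)
      have h5 := hc.dist_le t b ht.1 htb (hsubI hm2).2
      rw [dist_comm] at h5
      linarith
    have h6 : ρ / (2 * escapeConst A M) = h * (M / (2 * escapeConst A M)) := by rw [hρ]; ring
    have h7 : h * (M / (2 * escapeConst A M)) ≤ h * (1 + (b - t) / h) := by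
      rw [mul_add, mul_div_cancel₀ _ hh0.ne', mul_one]; linarith
    exact le_of_mul_le_mul_left h7 hh0
  have hlog2 := Real.log_le_log (by positivity) hlen
  have : A * (1 + Real.log (1 + 2 * ρ / bdryDist Q.dom (g a)) +
      Real.log (1 + 2 * ρ / bdryDist Q.dom (g b))) ≤
      A * (1 + 2 * Real.log (1 + 4 * escapeConst A M)) :=
    mul_le_mul_of_nonneg_left (by linarith) (by linarith)
  linarith

end CubeChain
end QH

namespace QH.CubeChain
variable {n : ℕ} {Q : CubeChain n}

/-! ### Ball separation -/

theorem gate_nonempty (i : ℕ) : (Q.gate i).Nonempty := by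
  refine ⟨WithLp.toLp 2 fun l => if l = Q.ax i then Q.pl i else Q.center (i + 1) l, ?_, fun l hl => ?_⟩
  · change (if Q.ax i = Q.ax i then Q.pl i else _) = _
    rw [if_pos rfl]
  · change _ < (if l = Q.ax i then Q.pl i else Q.center (i + 1) l) ∧
      (if l = Q.ax i then Q.pl i else Q.center (i + 1) l) < _
    rw [if_neg hl]
    exact center_mem_cube (i + 1) l

theorem inter_ccube_nonempty {E : Set (En n)} (hE : IsPreconnected E) (hsub : E ⊆ Q.dom) {u v : En n}
    (hu : u ∈ E) (hv : v ∈ E) {i m j : ℕ} (hui : u ∈ Q.ccube i) (hvj : v ∈ Q.ccube j) (him : i ≤ m)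
    (hmj : m ≤ j) : ∃ w ∈ E, w ∈ Q.ccube m := by
  rcases hmj.lt_or_eq with h | rfl
  · obtain ⟨w, hw, hg⟩ := inter_gate_nonempty hE hsub hu hv hui hvj him h
    exact ⟨w, hw, gate_subset_ccube m hg⟩
  · exact ⟨v, hv, hvj⟩

theorem dist_le_of_mem_ccube {i : ℕ} {u v : En n} (hu : u ∈ Q.ccube i) (hv : v ∈ Q.ccube i) :
    dist u v ≤ n * Q.s i :=
  dist_le_card_mul (Q.pos i).le fun l => by
    have := hu l; have := hv l
    rw [abs_le]; constructor <;> linarith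

theorem exists_lipCurve_center {i : ℕ} {u : En n} (hu : u ∈ Q.dom) (hi : u ∈ Q.ccube i) :
    ∃ L f, LipCurve Q.dom u (Q.center i) L f ∧ L ≤ n * Q.s i := by
  refine ⟨_, _, lipCurve_segment (u := u) (v := Q.center i) ?_,
    dist_le_of_mem_ccube hi (cube_subset_ccube i (center_mem_cube i))⟩
  intro w hw
  rw [segment_eq_image'] at hw
  obtain ⟨t, ht, rfl⟩ := hw
  rcases ht.1.eq_or_lt with rfl | h0
  · simpa using hu
  · exact cube_subset_dom i (lineMap_mem_cube hi (center_mem_cube i) h0 ht.2)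

theorem exists_lipCurve_same {i : ℕ} {u v : En n} (hu : u ∈ Q.dom) (hi : u ∈ Q.ccube i)
    (hv : v ∈ Q.dom) (hvi : v ∈ Q.ccube i) :
    ∃ L f, LipCurve Q.dom u v L f ∧ L ≤ 2 * n * Q.s i := by
  obtain ⟨L₁, f₁, h₁, hL₁⟩ := exists_lipCurve_center hu hi
  obtain ⟨L₂, f₂, h₂, hL₂⟩ := exists_lipCurve_center hv hvi
  exact ⟨_, _, h₁.trans h₂.symm, by linarith⟩

theorem exists_lipCurve_chain {a b : ℕ} (hab : a ≤ b) {u v : En n} (hu : u ∈ Q.dom)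
    (ha : u ∈ Q.ccube a) (hv : v ∈ Q.dom) (hb : v ∈ Q.ccube b) :
    ∃ L f, LipCurve Q.dom u v L f ∧ L ≤ (b - a + 1) * (2 * n * Q.s a) := by
  induction b, hab using Nat.le_induction generalizing v with
  | base =>
    obtain ⟨L, f, h, hL⟩ := exists_lipCurve_same hu ha hv hb
    exact ⟨L, f, h, by rw [sub_self, zero_add, one_mul]; exact hL⟩
  | succ b hab ih =>
    obtain ⟨w, hw⟩ := Q.gate_nonempty b
    obtain ⟨L₁, f₁, h₁, hL₁⟩ := ih (gate_subset_dom b hw) (gate_subset_ccube b hw)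
    obtain ⟨L₂, f₂, h₂, hL₂⟩ := exists_lipCurve_same (gate_subset_dom b hw)
      (gate_subset_ccube_succ b hw) hv hb
    refine ⟨_, _, h₁.trans h₂, ?_⟩
    have h3 : 2 * n * Q.s (b + 1) ≤ 2 * n * Q.s a :=
      mul_le_mul_of_nonneg_left (s_anti (by omega)) (by positivity)
    push_cast
    linarith

theorem innerDist_le_of_near {N i j : ℕ} (hij : i ≤ j + N) (hji : j ≤ i + N) {u v : En n}
    (hu : u ∈ Q.dom) (hi : u ∈ Q.ccube i) (hv : v ∈ Q.dom) (hj : v ∈ Q.ccube j) :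
    innerDist Q.dom u v ≤ ENNReal.ofReal ((N + 1) * (2 * n * (2 ^ N * Q.s i))) := by
  have hpos := Q.pos i
  have h2 : (1 : ℝ) ≤ 2 ^ N := one_le_pow₀ (by norm_num)
  rcases le_total i j with h | h
  · obtain ⟨L, f, hf, hL⟩ := exists_lipCurve_chain h hu hi hv hj
    refine (innerDist_le hf).trans (ENNReal.ofReal_le_ofReal (hL.trans ?_))
    have : (j : ℝ) ≤ i + N := by exact_mod_cast hji
    have h3 : Q.s i ≤ 2 ^ N * Q.s i := le_mul_of_one_le_left hpos.le h2
    gcongr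
    linarith
  · obtain ⟨L, f, hf, hL⟩ := exists_lipCurve_chain h hv hj hu hi
    refine (innerDist_le hf.symm).trans (ENNReal.ofReal_le_ofReal (hL.trans ?_))
    have hij' : (i : ℝ) ≤ j + N := by exact_mod_cast hij
    have h3 : Q.s j ≤ 2 ^ N * Q.s i := by
      have := s_le_pow_mul (Q := Q) j (i - j)
      rw [Nat.add_sub_cancel' h] at this
      exact this.trans (mul_le_mul_of_nonneg_right
        (pow_le_pow_right₀ (by norm_num) (by omega)) hpos.le)
    have := Q.pos j
    gcongr
    linarith

/-- A geodesic that returns to a gate in whose middle it started stays within a bounded number of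
cubes. -/
theorem exists_excursion_bound (hn : 2 ≤ n) {K : ℝ} (hK : 1 ≤ K) : ∃ N : ℕ, 0 < N ∧ ∀ Q : CubeChain n,
    Bornology.IsBounded Q.dom → ∀ (x y : En n) (L : ℝ) (g : ℝ → En n), IsQHGeodesic Q.dom x y L g →
    ∀ a t b : ℝ, 0 ≤ a → a ≤ t → t ≤ b → b ≤ L → ∀ i j, g t ∈ Q.ccube i → g a ∈ Q.gate j →
    g b ∈ Q.gate j → Q.s j ≤ K * bdryDist Q.dom (g a) → Q.s j ≤ K * bdryDist Q.dom (g b) →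
    i < j + N ∧ j < i + N := by
  -- The two gate points have depth s_j/(4K) in the convex gate box and are at most n s_j apart, so
  -- C₁ bounds their quasihyperbolic distance.
  set C₁ : ℝ := 4 * n * K with hC₁
  refine ⟨⌈(8 * K * Real.exp C₁ ^ 2 + 2) ^ n⌉₊, Nat.ceil_pos.mpr (by positivity),
    fun Q hb x y L g hg a t b ha hat htb hbL i j hi hga hgb hda hdb => ?_⟩
  set N := ⌈(8 * K * Real.exp C₁ ^ 2 + 2) ^ n⌉₊ with hN
  have hn1 : 1 ≤ n := by omega
  have hΩ := isBoundedDomain hb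
  have hc := hg.lipCurve
  have hsj := Q.pos j
  have hdom : ∀ s ∈ Icc a b, g s ∈ Q.dom := fun s hs =>
    hc.mem s (ha.trans hs.1) (hs.2.trans hbL)
  have hdeep : ∀ u ∈ Q.gate j, Q.s j ≤ K * bdryDist Q.dom u →
      u ∈ Deep (Q.lo j) (Q.hi j) (Q.s j / (4 * K)) := by
    intro u hu hd
    have hd0 := bdryDist_pos hn1 hΩ (gate_subset_dom j hu)
    refine Deep.of_le (deep_gbox_of_near hn (e := bdryDist Q.dom u / 4) (by positivity)
      (fun w hw => ball_bdryDist_subset (gate_subset_dom j hu) isOpen_dom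
        (by rw [Metric.mem_ball, dist_comm]; linarith)) hu ?_ fun _ _ => rfl) ?_
    · rw [hu.1, sub_self, abs_zero]; positivity
    · rw [div_le_div_iff₀ (by positivity) (by norm_num)]; linarith
  have hk : qhDist Q.dom (g a) (g b) ≤ ENNReal.ofReal C₁ := by
    refine (Deep.qhDist_le hn1 hΩ (gbox_subset_dom j) (by positivity) (hdeep _ hga hda)
      (hdeep _ hgb hdb)).trans (ENNReal.ofReal_le_ofReal ?_)
    have := dist_le_of_mem_ccube (gate_subset_ccube j hga) (gate_subset_ccube j hgb)
    rw [div_le_iff₀ (by positivity), hC₁]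
    calc dist (g a) (g b) ≤ n * Q.s j := this
      _ = 4 * n * K * (Q.s j / (4 * K)) := by field_simp
  have hkτ : ∀ τ ∈ Icc a b, qhDist Q.dom (g a) (g τ) ≤ ENNReal.ofReal C₁ := by
    intro τ hτ
    refine le_trans ?_ ((hg.arc_le hn1 hΩ ha (hat.trans htb) hbL).trans hk)
    have h3 := qhDist_le (hc.sub ha hτ.1 (hτ.2.trans hbL))
    rw [qhLength_sub] at h3
    exact h3.trans (lintegral_mono_set (Icc_subset_Icc_right hτ.2))
  have hC₁0 : 0 ≤ C₁ := by positivity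
  have hexp : ∀ c : ℝ, 0 ≤ c → Real.log (1 + c) ≤ C₁ → 1 + c ≤ Real.exp C₁ := fun c hc h =>
    (Real.log_le_iff_le_exp (by linarith)).mp h
  have hda0 := bdryDist_pos hn1 hΩ (hdom a ⟨le_rfl, hat.trans htb⟩)
  have hdle := bdryDist_le hn hb (hdom a ⟨le_rfl, hat.trans htb⟩) (gate_subset_ccube j hga)
  have hlen : ∀ τ ∈ Icc a b, τ - a ≤ 2 * Q.s j * Real.exp C₁ := by
    intro τ hτ
    have h1 := (ENNReal.ofReal_le_ofReal_iff hC₁0).mp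
      ((hg.log_le hn1 hΩ ha hτ.1 (hτ.2.trans hbL)).trans (hkτ τ hτ))
    have h2 := hexp _ (div_nonneg (by linarith [hτ.1]) hda0.le) h1
    have h3 : (τ - a) / bdryDist Q.dom (g a) ≤ Real.exp C₁ := by linarith
    rw [div_le_iff₀ hda0] at h3
    have := mul_le_mul_of_nonneg_left hdle (Real.exp_pos C₁).le
    linarith
  -- On the whole excursion the distance to the boundary is at least a fixed multiple of s_j. So
  -- only cubes of comparable or larger size are visited, within a bounded multiple of s_j, and
  -- these can be counted.
  have hd : ∀ τ ∈ Icc a b, Q.s j ≤ K * Real.exp C₁ * bdryDist Q.dom (g τ) := by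
    intro τ hτ
    have hd0 := bdryDist_pos hn1 hΩ (hdom τ hτ)
    have h1 := (ENNReal.ofReal_le_ofReal_iff hC₁0).mp
      ((hg.log_le' hn1 hΩ ha hτ.1 (hτ.2.trans hbL)).trans (hkτ τ hτ))
    have h2 := hexp _ (div_nonneg (by linarith [hτ.1]) hd0.le) h1
    have h3 : bdryDist Q.dom (g τ) + (τ - a) ≤ Real.exp C₁ * bdryDist Q.dom (g τ) := by
      have := mul_le_mul_of_nonneg_right h2 hd0.le
      rwa [add_mul, one_mul, div_mul_cancel₀ _ hd0.ne'] at this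
    have h4 := bdryDist_le_add (Ω := Q.dom) (g a) (g τ)
    have h5 := hc.dist_le a τ ha hτ.1 (hτ.2.trans hbL)
    calc Q.s j ≤ K * bdryDist Q.dom (g a) := hda
      _ ≤ K * (Real.exp C₁ * bdryDist Q.dom (g τ)) := by gcongr; linarith
      _ = _ := by ring
  set E : Set (En n) := g '' Icc a t with hE
  have hsubI : Icc a t ⊆ Icc a b := Icc_subset_Icc_right htb
  have hEp : IsPreconnected E := isPreconnected_Icc.image g
    (hc.continuousOn.mono ((hsubI).trans (Icc_subset_Icc ha hbL)))
  have hEsub : E ⊆ Q.dom := by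
    rintro _ ⟨s, hs, rfl⟩
    exact hdom s (hsubI hs)
  have haE : g a ∈ E := mem_image_of_mem g ⟨le_rfl, hat⟩
  have htE : g t ∈ E := mem_image_of_mem g ⟨hat, le_rfl⟩
  have hcount : ∀ S : Finset ℕ, (∀ m ∈ S, ∃ w ∈ E, w ∈ Q.ccube m) → S.card ≤ N := by
    intro S hS
    have h := card_le_of_meets (Q := Q) (S := S) (δ := Q.s j / (2 * K * Real.exp C₁))
      (ρ := 2 * Q.s j * Real.exp C₁) (by positivity) (by positivity) (g a) (fun m hm => by
        obtain ⟨_, ⟨τ, hτ, rfl⟩, hw⟩ := hS m hm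
        have h1 := hd τ (hsubI hτ)
        have h2 := bdryDist_le hn hb (hdom τ (hsubI hτ)) hw
        rw [div_le_iff₀ (by positivity)]
        have h3 : K * Real.exp C₁ * bdryDist Q.dom (g τ) ≤ K * Real.exp C₁ * (2 * Q.s m) := by gcongr
        linarith) (fun m hm => by
        obtain ⟨_, ⟨τ, hτ, rfl⟩, hw⟩ := hS m hm
        refine ⟨_, hw, fun l => (abs_sub_le_dist _ _ l).trans ?_⟩
        rw [dist_comm]
        exact (hc.dist_le a τ ha hτ.1 ((hsubI hτ).2.trans hbL)).trans (hlen τ (hsubI hτ)))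
    have e : 2 * (2 * Q.s j * Real.exp C₁ / (Q.s j / (2 * K * Real.exp C₁))) + 2 =
        8 * K * Real.exp C₁ ^ 2 + 2 := by field_simp; ring
    rw [e] at h
    exact_mod_cast h.trans (Nat.le_ceil _)
  constructor
  · by_contra hij
    push Not at hij
    have := hcount (Finset.Icc j (j + N)) fun m hm => by
      rw [Finset.mem_Icc] at hm
      exact inter_ccube_nonempty hEp hEsub haE htE (gate_subset_ccube j hga) hi hm.1 (hm.2.trans hij)
    rw [Nat.card_Icc] at this
    omega
  · by_contra hij
    push Not at hij
    have := hcount (Finset.Icc i (i + N)) fun m hm => by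
      rw [Finset.mem_Icc] at hm
      exact inter_ccube_nonempty hEp hEsub htE haE hi (gate_subset_ccube j hga) hm.1 (hm.2.trans hij)
    rw [Nat.card_Icc] at this
    omega

/-- The domain of a chain of cubes has the ball separation property, with a constant depending
only on the dimension. -/
theorem exists_hasBallSeparation (hn : 2 ≤ n) : ∃ C₀ : ℝ, 0 < C₀ ∧ ∀ Q : CubeChain n,
    Bornology.IsBounded Q.dom → HasBallSeparation C₀ Q.dom := by
  obtain ⟨M, hM1, hM⟩ := exists_endpoint_near hn
  have h4 : (0 : ℕ) < 4 ^ n := by positivity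
  set K : ℝ := 2 ^ (4 ^ n + 2) * (2 * M) with hK
  have h2pow : (1 : ℝ) ≤ 2 ^ (4 ^ n + 2) := one_le_pow₀ (by norm_num)
  have hK1 : 1 ≤ K := by rw [hK]; nlinarith
  obtain ⟨N₂, hN₂0, hN₂⟩ := exists_excursion_bound hn hK1
  set N := N₂ + 4 ^ n with hN
  set D : ℝ := (N + 1) * (2 * n * 2 ^ N) with hD
  have hD0 : 0 ≤ D := by positivity
  refine ⟨M + D * K + 1, by positivity, fun Q hb x hx y hy L g hg z hz γ hγ => ?_⟩
  have hn1 : 1 ≤ n := by omega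
  have hΩ := isBoundedDomain hb
  have hc := hg.lipCurve
  obtain ⟨t, ht, rfl⟩ := hz
  have hzd := hc.mem t ht.1 ht.2
  have hd0 := bdryDist_pos hn1 hΩ hzd
  set d := bdryDist Q.dom (g t) with hd
  have hxγ : x ∈ range γ := ⟨0, γ.source⟩
  have hyγ : y ∈ range γ := ⟨1, γ.target⟩
  have hball : ∀ w ∈ range γ, ∀ r : ℝ, innerDist Q.dom (g t) w ≤ ENNReal.ofReal r →
      r < (M + D * K + 1) * d → (innerBall Q.dom (g t) ((M + D * K + 1) * d) ∩ range γ).Nonempty := by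
    intro w hw r h1 h2
    obtain ⟨τ, rfl⟩ := hw
    exact ⟨_, ⟨hγ τ, h1.trans_lt ((ENNReal.ofReal_lt_ofReal_iff (by positivity)).mpr h2)⟩, τ, rfl⟩
  have hMd : M * d < (M + D * K + 1) * d := by
    have : 0 ≤ D * K := by positivity
    nlinarith
  obtain ⟨i, hi⟩ := exists_mem_ccube hzd
  by_cases hs : 2 ^ (4 ^ n + 2) * (2 * (M * d)) ≤ Q.s i
  · rcases hM Q hb x y L g hg t ht i hi hs with h | h
    · refine hball x hxγ (M * d) ?_ hMd
      have := innerDist_le (hc.sub le_rfl ht.1 ht.2).symm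
      rw [hc.source] at this
      exact this.trans (ENNReal.ofReal_le_ofReal (by linarith))
    · refine hball y hyγ (M * d) ?_ hMd
      have := innerDist_le (hc.sub ht.1 ht.2 le_rfl)
      rw [hc.target] at this
      exact this.trans (ENNReal.ofReal_le_ofReal h)
  push Not at hs
  have hsK : Q.s i < K * d := by rw [hK]; linarith
  -- From here on the cube of z has side less than K d, so it is enough that γ visits a cube whose
  -- index differs from i by at most N.
  have hnear : ∀ w ∈ range γ, ∀ j, w ∈ Q.ccube j → i ≤ j + N → j ≤ i + N →
      (innerBall Q.dom (g t) ((M + D * K + 1) * d) ∩ range γ).Nonempty := by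
    intro w hw j hj h1 h2
    refine hball w hw _ (innerDist_le_of_near h1 h2 hzd hi (by obtain ⟨τ, rfl⟩ := hw; exact hγ τ) hj) ?_
    calc ((N : ℝ) + 1) * (2 * n * (2 ^ N * Q.s i)) = D * Q.s i := by rw [hD]; ring
      _ ≤ D * (K * d) := by gcongr
      _ < (M + D * K + 1) * d := by nlinarith
  obtain ⟨ix, hix⟩ := exists_mem_ccube hx
  obtain ⟨iy, hiy⟩ := exists_mem_ccube hy
  by_cases hxn : i ≤ ix + N ∧ ix ≤ i + N
  · exact hnear x hxγ ix hix hxn.1 hxn.2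
  by_cases hyn : i ≤ iy + N ∧ iy ≤ i + N
  · exact hnear y hyγ iy hiy hyn.1 hyn.2
  have hγp : IsPreconnected (range γ) := isPreconnected_range γ.continuous
  have hγsub : range γ ⊆ Q.dom := by rintro _ ⟨τ, rfl⟩; exact hγ τ
  by_cases hxy : ix ≤ i ∧ i ≤ iy
  · obtain ⟨w, hw, hwi⟩ := inter_ccube_nonempty hγp hγsub hxγ hyγ hix hiy hxy.1 hxy.2
    exact hnear w hw i hwi (by omega) (by omega)
  by_cases hyx : iy ≤ i ∧ i ≤ ix
  · obtain ⟨w, hw, hwi⟩ := inter_ccube_nonempty hγp hγsub hyγ hxγ hiy hix hyx.1 hyx.2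
    exact hnear w hw i hwi (by omega) (by omega)
  exfalso
  -- Remaining case: both endpoints lie beyond the same end of the index range i ± N. The geodesic
  -- then crosses the gate j, at N₂ steps from i, both before and after t.
  obtain ⟨j, hj, hcase⟩ : ∃ j, (j = i + N₂ ∨ i = j + N₂) ∧
      ((i ≤ j ∧ j + 4 ^ n ≤ ix ∧ j + 4 ^ n ≤ iy ∧ j < ix ∧ j < iy) ∨
        (ix + 4 ^ n ≤ j ∧ iy + 4 ^ n ≤ j ∧ j < i)) := by
    rcases le_or_gt i ix with h | h
    · refine ⟨i + N₂, Or.inl rfl, Or.inl ?_⟩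
      omega
    · refine ⟨i - N₂, Or.inr (by omega), Or.inr ?_⟩
      omega
  have hcross : ∀ w w' : En n, ∀ a b : ℝ, 0 ≤ a → a ≤ b → b ≤ L → w ∈ g '' Icc a b →
      w' ∈ g '' Icc a b → ∀ p q, w ∈ Q.ccube p → w' ∈ Q.ccube q → p ≤ j → j < q →
      ∃ τ ∈ Icc a b, g τ ∈ Q.gate j := by
    intro w w' a b ha hab hbL hw hw' p q hp hq h1 h2
    obtain ⟨_, ⟨τ, hτ, rfl⟩, hgτ⟩ := inter_gate_nonempty
      (isPreconnected_Icc.image g (hc.continuousOn.mono (Icc_subset_Icc ha hbL)))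
      (by rintro _ ⟨s, hs, rfl⟩; exact hc.mem s (ha.trans hs.1) (hs.2.trans hbL)) hw hw' hp hq h1 h2
    exact ⟨τ, hτ, hgτ⟩
  -- A crossing too close to the boundary would be near an endpoint, whose cube would then have
  -- index within 4^n of j. The summand 4^n in `N` excludes this.
  have hfar : ∀ τ ∈ Icc 0 L, g τ ∈ Q.gate j → Q.s j ≤ K * bdryDist Q.dom (g τ) := by
    intro τ hτ hgτ
    by_contra! hlt
    have hτ0 := bdryDist_pos hn1 hΩ (gate_subset_dom j hgτ)
    have hle : 2 ^ (4 ^ n + 2) * (2 * (M * bdryDist Q.dom (g τ))) ≤ Q.s j := by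
      rw [hK] at hlt; linarith
    have hle' : 2 ^ (4 ^ n) * (M * bdryDist Q.dom (g τ)) ≤ Q.s j := by
      rw [pow_add] at hle
      have : 0 < 2 ^ (4 ^ n) * (M * bdryDist Q.dom (g τ)) := by positivity
      linarith
    have hsmall : ∀ a b : ℝ, 0 ≤ a → b ≤ L → b - a ≤ M * bdryDist Q.dom (g τ) → τ ∈ Icc a b →
        ∀ s ∈ Icc a b, ∀ p, g s ∈ Q.ccube p → p < j + 4 ^ n ∧ j < p + 4 ^ n := by
      intro a b ha hbL hab hτ' s hs p hp
      refine lt_add_and_lt_add_of_small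
        (isPreconnected_Icc.image g (hc.continuousOn.mono (Icc_subset_Icc ha hbL)))
        (by rintro _ ⟨s, hs, rfl⟩; exact hc.mem s (ha.trans hs.1) (hs.2.trans hbL))
        (by positivity) ?_ (mem_image_of_mem g hτ') (mem_image_of_mem g hs)
        (gate_subset_ccube j hgτ) hp hle'
      rintro _ ⟨s, hs, rfl⟩ _ ⟨s', hs', rfl⟩
      refine (hc.lipschitzOnWith.dist_le_mul s ⟨ha.trans hs.1, hs.2.trans hbL⟩ s'
        ⟨ha.trans hs'.1, hs'.2.trans hbL⟩).trans ?_
      rw [NNReal.coe_one, one_mul, Real.dist_eq]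
      exact abs_sub_le_iff.mpr ⟨by linarith [hs.2, hs'.1], by linarith [hs'.2, hs.1]⟩
    rcases hM Q hb x y L g hg τ hτ j (gate_subset_ccube j hgτ) hle with h | h
    · have := hsmall 0 τ le_rfl hτ.2 (by linarith) ⟨hτ.1, le_rfl⟩ 0 ⟨le_rfl, hτ.1⟩ ix
        (by rw [hc.source]; exact hix)
      omega
    · have := hsmall τ L hτ.1 le_rfl h ⟨le_rfl, hτ.2⟩ L ⟨hτ.2, le_rfl⟩ iy
        (by rw [hc.target]; exact hiy)
      omega
  have h0 : x ∈ g '' Icc 0 t := ⟨0, ⟨le_rfl, ht.1⟩, hc.source⟩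
  have h1 : g t ∈ g '' Icc 0 t := ⟨t, ⟨ht.1, le_rfl⟩, rfl⟩
  have h2 : g t ∈ g '' Icc t L := ⟨t, ⟨le_rfl, ht.2⟩, rfl⟩
  have h3 : y ∈ g '' Icc t L := ⟨L, ⟨ht.2, le_rfl⟩, hc.target⟩
  have hgates : ∃ a ∈ Icc 0 t, ∃ b ∈ Icc t L, g a ∈ Q.gate j ∧ g b ∈ Q.gate j := by
    rcases hcase with h | h
    · obtain ⟨a, ha, hga⟩ := hcross _ _ 0 t le_rfl ht.1 ht.2 h1 h0 i ix hi hix h.1 h.2.2.2.1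
      obtain ⟨b, hb', hgb⟩ := hcross _ _ t L ht.1 ht.2 le_rfl h2 h3 i iy hi hiy h.1 h.2.2.2.2
      exact ⟨a, ha, b, hb', hga, hgb⟩
    · obtain ⟨a, ha, hga⟩ := hcross _ _ 0 t le_rfl ht.1 ht.2 h0 h1 ix i hix hi (by omega) h.2.2
      obtain ⟨b, hb', hgb⟩ := hcross _ _ t L ht.1 ht.2 le_rfl h3 h2 iy i hiy hi (by omega) h.2.2
      exact ⟨a, ha, b, hb', hga, hgb⟩
  obtain ⟨a, ha, b, hb', hga, hgb⟩ := hgates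
  have := hN₂ Q hb x y L g hg a t b ha.1 ha.2 hb'.1 hb'.2 i j hi hga hgb
    (hfar a ⟨ha.1, ha.2.trans ht.2⟩ hga) (hfar b ⟨ht.1.trans hb'.1, hb'.2⟩ hgb)
  omega

end QH.CubeChain

/-! ### LC-2 for chain domains, and a lower bound for their John gauges -/

namespace QH
variable {n : ℕ} {Q : CubeChain n} {φ μ : ℝ → ℝ}

/-! ### Connectivity and lengths of curves in the domain of a chain -/

/-- An open cube in the maximum norm. -/
def supBall (x : En n) (r : ℝ) : Set (En n) := {w | ∀ l, |w l - x l| < r}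

theorem ball_subset_supBall (x : En n) (r : ℝ) : Metric.ball x r ⊆ supBall x r := fun w hw l =>
  (abs_sub_le_dist w x l).trans_lt hw

theorem exists_mem_Ioo_le_abs {α β x r : ℝ} (h : 2 * r < β - α) (hr : 0 < r) :
    ∃ y ∈ Ioo α β, r ≤ |y - x| := by
  by_cases hx : x + r < β
  · refine ⟨max (x + r) ((α + β) / 2), ⟨lt_max_of_lt_right (by linarith), max_lt hx (by linarith)⟩, ?_⟩
    exact le_trans (by linarith [le_max_left (x + r) ((α + β) / 2)]) (le_abs_self _)
  · refine ⟨min (x - r) ((α + β) / 2), ⟨lt_min (by linarith) (by linarith),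
      min_lt_of_right_lt (by linarith)⟩, ?_⟩
    exact le_trans (by linarith [min_le_left (x - r) ((α + β) / 2)]) (neg_le_abs _)

/-- Removing a small cube does not disconnect a box. -/
theorem joinedIn_box_diff (hn : 2 ≤ n) {α β : Fin n → ℝ} {x : En n} {r : ℝ} (hr : 0 < r)
    (hside : ∀ l, 2 * r < β l - α l) {u v : En n} (hu : u ∈ Box α β \ supBall x r)
    (hv : v ∈ Box α β \ supBall x r) : JoinedIn (Box α β \ supBall x r) u v := by
  -- The complement of the cube is a union of half-spaces, each meeting the box in a convex set.
  -- Half-spaces for different coordinates overlap inside the box; opposite ones are linked through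
  -- another coordinate, where a side longer than 2r leaves room.
  have hconv : ∀ l (ε : ℝ), (ε = 1 ∨ ε = -1) → ∀ w ∈ Box α β, ∀ w' ∈ Box α β, r ≤ ε * (w l - x l) →
      r ≤ ε * (w' l - x l) → JoinedIn (Box α β \ supBall x r) w w' := by
    intro l ε hε w hw w' hw' h1 h2
    refine JoinedIn.of_segment_subset fun p hp => ⟨(convex_box α β).segment_subset hw hw' hp, fun hp' => ?_⟩
    obtain ⟨a, b, ha, hb, hab, rfl⟩ := hp
    have h3 := abs_lt.mp (hp' l)
    simp only [PiLp.add_apply, PiLp.smul_apply, smul_eq_mul] at h3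
    have h4 : r ≤ ε * (a * w l + b * w' l - x l) := by
      have e : ε * (a * w l + b * w' l - x l) =
          a * (ε * (w l - x l)) + b * (ε * (w' l - x l)) := by
        rw [show b = 1 - a by linarith]; ring
      rw [e]
      calc r = a * r + b * r := by rw [← add_mul, hab, one_mul]
        _ ≤ _ := by gcongr
    rcases hε with rfl | rfl <;> linarith [h3.1, h3.2]
  have hface : ∀ c : ℝ, r ≤ |c| → ∃ ε : ℝ, (ε = 1 ∨ ε = -1) ∧ r ≤ ε * c := by
    intro c hc
    rcases abs_cases c with ⟨e, -⟩ | ⟨e, -⟩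
    · exact ⟨1, Or.inl rfl, by linarith⟩
    · exact ⟨-1, Or.inr rfl, by linarith⟩
  have hout : ∀ w : En n, w ∉ supBall x r → ∃ l, r ≤ |w l - x l| := by
    intro w hw
    by_contra! h
    exact hw h
  let upd : En n → Fin n → ℝ → En n := fun w k c => WithLp.toLp 2 fun j => if j = k then c else w j
  have hupd : ∀ w k c j, upd w k c j = if j = k then c else w j := fun _ _ _ _ => rfl
  have hupdB : ∀ w ∈ Box α β, ∀ k c, c ∈ Ioo (α k) (β k) → upd w k c ∈ Box α β := by
    intro w hw k c hc j
    rw [hupd]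
    split_ifs with h
    · subst h; exact hc
    · exact hw j
  have hstep : ∀ l k, l ≠ k → ∀ w ∈ Box α β, ∀ w' ∈ Box α β, r ≤ |w l - x l| → r ≤ |w' k - x k| →
      JoinedIn (Box α β \ supBall x r) w w' := by
    intro l k hlk w hw w' hw' h1 h2
    obtain ⟨ε, hε, h3⟩ := hface _ h1
    obtain ⟨δ, hδ, h4⟩ := hface _ h2
    have hm := hupdB w hw k (w' k) (hw' k)
    have e1 : upd w k (w' k) l = w l := by rw [hupd, if_neg hlk]
    have e2 : upd w k (w' k) k = w' k := by rw [hupd, if_pos rfl]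
    exact (hconv l ε hε w hw _ hm h3 (by rw [e1]; exact h3)).trans
      (hconv k δ hδ _ hm w' hw' (by rw [e2]; exact h4) h4)
  obtain ⟨l, hl⟩ := hout u hu.2
  obtain ⟨k, hk⟩ := hout v hv.2
  by_cases hlk : l = k
  · subst hlk
    have : Nontrivial (Fin n) := Fin.nontrivial_iff_two_le.mpr hn
    obtain ⟨m, hm⟩ := exists_ne l
    obtain ⟨y, hy, hyr⟩ := exists_mem_Ioo_le_abs (x := x m) (hside m) hr
    have hw := hupdB v hv.1 m y hy
    have e1 : upd v m y l = v l := by rw [hupd, if_neg (Ne.symm hm)]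
    have e2 : upd v m y m = y := by rw [hupd, if_pos rfl]
    obtain ⟨δ, hδ, h4⟩ := hface _ hk
    exact (hstep l m (Ne.symm hm) u hu.1 _ hw hl (by rw [e2]; exact hyr)).trans
      (hconv l δ hδ _ hw v hv.1 (by rw [e1]; exact h4) h4)
  · exact hstep l k hlk u hu.1 v hv.1 hl hk

namespace CubeChain

/-- Let N be the maximum norm ball of radius r. If a cube of side at most 8r meets N, the whole tail
from it on lies in B(x, φ(Kr)) by `hT`. So on the way from a point outside that ball back to the
cube 0, all cubes that meet N are large, and so are the gate boxes, and N disconnects none of them.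
Outside N every such point is thus joined to the cube 0. -/
theorem isLC2 (hn : 2 ≤ n) (hφ : IsGauge φ) {K₁ K : ℝ} (hK : 8 * K₁ ≤ K) (hK₁ : 0 ≤ K₁)
    (hKn : 2 * n < K)
    (hT : ∀ i j, i ≤ j → ∀ u ∈ Q.ccube i, ∀ v ∈ Q.ccube j, dist u v ≤ φ (K₁ * Q.s i) / 2) :
    IsLC2 (fun r => φ (K * r)) Q.dom := by
  intro x r hr a ha b hb
  have hK0 : 0 < K := lt_of_le_of_lt (by positivity) hKn
  set N := supBall x r with hN
  set good : ℕ → Prop := fun i => ∀ j ≤ i, ∀ w ∈ Q.ccube j, w ∈ N → 8 * r < Q.s j with hgood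
  have hgood_mono : ∀ i j, i ≤ j → good j → good i := fun i j hij h k hk => h k (hk.trans hij)
  have hfar : ∀ w, w ∉ Metric.ball x (φ (K * r)) → ∀ p, w ∈ Q.ccube p → good p := by
    intro w hw p hp j hj w' hw' hN'
    by_contra! hs
    refine hw ?_
    have h1 := hT j p hj w' hw' w hp
    have h2 : φ (K₁ * Q.s j) ≤ φ (K * r) := by
      refine hφ.mono (mul_nonneg hK₁ (Q.pos j).le) ?_
      calc K₁ * Q.s j ≤ K₁ * (8 * r) := by gcongr
        _ = 8 * K₁ * r := by ring
        _ ≤ K * r := by gcongr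
    have h3 : dist w' x ≤ n * r := dist_le_card_mul hr.le fun l => (hN' l).le
    have h4 := hφ.le_self (K * r) (by positivity)
    have h5 : 2 * n * r < K * r := by gcongr
    rw [Metric.mem_ball]
    have h6 := dist_triangle w w' x
    rw [dist_comm w w'] at h6
    linarith
  have hbox : ∀ i, good (i + 1) → ∀ u ∈ Q.gbox i \ N, ∀ v ∈ Q.gbox i \ N, JoinedIn (Q.dom \ N) u v := by
    intro i hi u hu v hv
    by_cases hmeet : (Q.gbox i ∩ N).Nonempty
    · obtain ⟨w, hw, hwN⟩ := hmeet
      have hs : 2 * r < Q.s (i + 1) := by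
        rcases mem_gbox_ccube hw with h | h
        · have := hi i (by omega) w h hwN
          have := Q.half i
          linarith
        · have := hi (i + 1) le_rfl w h hwN
          linarith
      refine (joinedIn_box_diff hn hr (fun l => ?_) hu hv).mono (sdiff_subset_sdiff_left (gbox_subset_dom i))
      have := cube_succ_le_gbox (Q := Q) i l
      linarith
    · refine JoinedIn.of_segment_subset fun w hw => ?_
      have h := (convex_box _ _).segment_subset hu.1 hv.1 hw
      exact ⟨gbox_subset_dom i h, fun hN' => hmeet ⟨w, h, hN'⟩⟩
  have hcube : good 0 → ∀ u ∈ Q.cube 0 \ N, ∀ v ∈ Q.cube 0 \ N, JoinedIn (Q.dom \ N) u v := by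
    intro h0 u hu v hv
    by_cases hmeet : (Q.cube 0 ∩ N).Nonempty
    · obtain ⟨w, hw, hwN⟩ := hmeet
      have hs := h0 0 le_rfl w (cube_subset_ccube 0 hw) hwN
      refine (joinedIn_box_diff hn hr (fun l => ?_) hu hv).mono (sdiff_subset_sdiff_left (cube_subset_dom 0))
      rw [add_sub_cancel_left]
      linarith
    · refine JoinedIn.of_segment_subset fun w hw => ?_
      have h := (convex_box _ _).segment_subset hu.1 hv.1 hw
      exact ⟨cube_subset_dom 0 h, fun hN' => hmeet ⟨w, h, hN'⟩⟩
  have hlink : ∀ i, good (i + 1) → ∃ p ∈ Q.cube i \ N, p ∈ Q.gbox i := by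
    intro i hi
    obtain ⟨α, h1, h2, -⟩ := Q.exists_mirror i
    have hpos := Q.pos (i + 1)
    have hin : ∀ p : En n, (∀ l, α l < p l ∧ p l < α l + Q.s (i + 1)) → p ∈ Q.cube i ∧ p ∈ Q.gbox i :=
      fun p hp => ⟨fun l => ⟨(h1 l).1.trans_lt (hp l).1, (hp l).2.trans_le (h1 l).2⟩,
        fun l => ⟨(h2 l).1.trans_lt (hp l).1, (hp l).2.trans_le (h2 l).2⟩⟩
    set p : En n := WithLp.toLp 2 fun l => α l + Q.s (i + 1) / 2 with hp
    have hpl : ∀ l, p l = α l + Q.s (i + 1) / 2 := fun l => rfl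
    have hpin := hin p fun l => by rw [hpl]; constructor <;> linarith
    by_cases hpN : p ∈ N
    · have hs : 2 * r < Q.s (i + 1) := by
        have := hi i (by omega) p (cube_subset_ccube i hpin.1) hpN
        have := Q.half i
        linarith
      have h0 : 0 < n := by omega
      let k : Fin n := ⟨0, h0⟩
      obtain ⟨y, hy, hyr⟩ := exists_mem_Ioo_le_abs (α := α k) (β := α k + Q.s (i + 1)) (x := x k)
        (by linarith) hr
      set q : En n := WithLp.toLp 2 fun l => if l = k then y else p l with hq
      have hql : ∀ l, q l = if l = k then y else p l := fun l => rfl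
      have hqin := hin q fun l => by
        rw [hql]
        split_ifs with h
        · subst h; exact hy
        · rw [hpl]; constructor <;> linarith
      refine ⟨q, ⟨hqin.1, fun hqN => ?_⟩, hqin.2⟩
      have := hqN k
      rw [hql, if_pos rfl] at this
      linarith
    · exact ⟨p, ⟨hpin.1, hpN⟩, hpin.2⟩
  have hbase : ∀ i, good i → ∀ u ∈ Q.cube i \ N, ∀ v ∈ Q.cube 0 \ N, JoinedIn (Q.dom \ N) u v := by
    intro i
    induction i with
    | zero => exact hcube
    | succ i ih =>
      intro hi u hu v hv
      obtain ⟨p, hp, hpg⟩ := hlink i hi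
      exact (hbox i hi u ⟨cube_succ_subset_gbox i hu.1, hu.2⟩ p ⟨hpg, hp.2⟩).trans
        (ih (hgood_mono i (i + 1) (by omega) hi) p hp v hv)
  have hall : ∀ u ∈ Q.dom \ Metric.ball x (φ (K * r)), ∀ v ∈ Q.cube 0 \ N, JoinedIn (Q.dom \ N) u v := by
    intro u hu v hv
    have huN : u ∉ N := by
      intro h
      refine hu.2 ?_
      have h3 : dist u x ≤ n * r := dist_le_card_mul hr.le fun l => (h l).le
      have h4 := hφ.le_self (K * r) (by positivity)
      have h5 : 2 * n * r < K * r := by gcongr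
      rw [Metric.mem_ball]
      have : 0 ≤ (n : ℝ) * r := by positivity
      linarith
    have hcubes : ∀ i, u ∈ Q.cube i → JoinedIn (Q.dom \ N) u v := fun i hi =>
      hbase i (hfar u hu.2 i (cube_subset_ccube i hi)) u ⟨hi, huN⟩ v hv
    obtain ⟨i, hi | hi⟩ := mem_iUnion.mp hu.1
    · exact hcubes i hi
    · rcases mem_gbox_cases hi with h | h | h
      · exact hcubes i h
      · have hg := hfar u hu.2 (i + 1) (gate_subset_ccube_succ i h)
        obtain ⟨p, hp, hpg⟩ := hlink i hg
        exact (hbox i hg u ⟨hi, huN⟩ p ⟨hpg, hp.2⟩).trans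
          (hbase i (hgood_mono i (i + 1) (by omega) hg) p hp v hv)
      · exact hcubes (i + 1) h
  obtain ⟨v, hv⟩ : (Q.cube 0 \ N).Nonempty := by
    obtain ⟨i, hi⟩ := exists_mem_ccube ha.1
    have h0 := hgood_mono 0 i (by omega) (hfar a ha.2 i hi)
    by_cases hc : Q.center 0 ∈ N
    · have hs := h0 0 le_rfl _ (cube_subset_ccube 0 (center_mem_cube 0)) hc
      have hn0 : 0 < n := by omega
      let k : Fin n := ⟨0, hn0⟩
      obtain ⟨y, hy, hyr⟩ := exists_mem_Ioo_le_abs (α := Q.a 0 k) (β := Q.a 0 k + Q.s 0) (x := x k)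
        (by linarith) hr
      set q : En n := WithLp.toLp 2 fun l => if l = k then y else Q.center 0 l with hq
      have hql : ∀ l, q l = if l = k then y else Q.center 0 l := fun l => rfl
      refine ⟨q, fun l => ?_, fun hqN => ?_⟩
      · rw [hql]
        split_ifs with h
        · subst h; exact hy
        · exact center_mem_cube 0 l
      · have := hqN k
        rw [hql, if_pos rfl] at this
        linarith
    · exact ⟨_, center_mem_cube 0, hc⟩
  exact ((hall a ha v hv).trans (hall b hb v hv).symm).mono
    (sdiff_subset_sdiff_right (ball_subset_supBall x r))

/-- A curve from a far cube to the center is at least as long as every `4 ^ n`-th cube on its way. -/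
theorem exists_sum_le_of_isLengthJohnWith (hn : 2 ≤ n) (hb : Bornology.IsBounded Q.dom)
    (hμ : IsGauge μ) {C : ℝ} (hC : 0 < C) (h : IsLengthJohnWith C μ Q.dom) :
    ∃ i₀ : ℕ, ∀ m, i₀ ≤ m → ∀ r : ℕ,
      ∑ q ∈ Finset.range r, Q.s (m + (q + 1) * 4 ^ n) ≤ μ (C * (2 * Q.s m)) := by
  obtain ⟨x₀, hx₀, hJ⟩ := h
  obtain ⟨i₀, hi₀⟩ := exists_mem_ccube hx₀
  refine ⟨i₀, fun m hm r => ?_⟩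
  obtain ⟨γ, hγ, hlen⟩ := hJ _ (cube_subset_dom (m + r * 4 ^ n) (center_mem_cube _))
  -- The curve starts in the cube m + r 4^n and is followed towards smaller indices, 4^n cubes at a
  -- time.
  have key : ∀ p ≤ r, ∃ t : unitInterval, γ t ∈ Q.ccube (m + (r - p) * 4 ^ n) ∧
      ENNReal.ofReal (∑ q ∈ Finset.Ico (r - p) r, Q.s (m + (q + 1) * 4 ^ n)) ≤
        eVariationOn γ (Iic t) := by
    intro p
    induction p with
    | zero =>
      intro _
      refine ⟨0, ?_, by simp⟩
      rw [γ.source]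
      exact cube_subset_ccube _ (center_mem_cube _)
    | succ p ih =>
      intro hp
      obtain ⟨t, ht, hvar⟩ := ih (by omega)
      have h4 : 0 < 4 ^ n := by positivity
      obtain ⟨k, hk⟩ : ∃ k, k = r - (p + 1) := ⟨_, rfl⟩
      have hk1 : r - p = k + 1 := by omega
      rw [← hk]
      rw [hk1] at ht hvar
      have hidx : m + (k + 1) * 4 ^ n = m + k * 4 ^ n + 4 ^ n := by ring
      have hcont : Continuous γ := γ.continuous
      obtain ⟨_, ⟨t', ht', rfl⟩, hgt⟩ := inter_ccube_nonempty (m := m + k * 4 ^ n)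
        ((isPreconnected_Icc (a := t) (b := 1)).image γ hcont.continuousOn)
        (by rintro _ ⟨s, -, rfl⟩; exact hγ s)
        ⟨1, ⟨t.2.2, le_rfl⟩, γ.target⟩ (mem_image_of_mem γ ⟨le_rfl, t.2.2⟩) hi₀ ht
        (by omega) (by omega)
      refine ⟨t', hgt, ?_⟩
      -- An arc shorter than the side of the smaller of the two cubes has too small a diameter to
      -- link cubes whose indices differ by 4^n.
      have hstep : ENNReal.ofReal (Q.s (m + (k + 1) * 4 ^ n)) ≤ eVariationOn γ (Icc t t') := by
        by_contra! hlt
        have hpos := Q.pos (m + (k + 1) * 4 ^ n)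
        have := lt_add_of_small (Q := Q) (l := Q.s (m + (k + 1) * 4 ^ n))
          ((isPreconnected_Icc (a := t) (b := t')).image γ hcont.continuousOn)
          (by rintro _ ⟨s, -, rfl⟩; exact hγ s) hpos
          (by
            rintro _ ⟨s, hs, rfl⟩ _ ⟨s', hs', rfl⟩
            have h1 := (eVariationOn.edist_le γ hs hs').trans hlt.le
            rwa [edist_dist, ENNReal.ofReal_le_ofReal_iff hpos.le] at h1)
          (mem_image_of_mem γ ⟨ht'.1, le_rfl⟩) (mem_image_of_mem γ ⟨le_rfl, ht'.1⟩) hgt ht (by rw [hidx])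
        omega
      have hunion : eVariationOn γ (Iic t) + eVariationOn γ (Icc t t') ≤ eVariationOn γ (Iic t') :=
        (eVariationOn.add_le_union γ fun x hx y hy => hx.trans hy.1).trans
          (eVariationOn.mono γ (union_subset (Iic_subset_Iic.mpr ht'.1) Icc_subset_Iic_self))
      refine le_trans ?_ ((add_le_add hvar hstep).trans hunion)
      rw [← Finset.sum_Ioo_add_eq_sum_Ico (by omega : k < r)]
      rw [ENNReal.ofReal_add (Finset.sum_nonneg fun q _ => (Q.pos _).le) (Q.pos _).le]
      rfl
  obtain ⟨t, ht, hvar⟩ := key r le_rfl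
  rw [Nat.sub_self, zero_mul, add_zero] at ht
  rw [Nat.sub_self, ← Finset.range_eq_Ico] at hvar
  have h1 := hvar.trans (hlen t)
  have hd := bdryDist_le hn hb (hγ t) ht
  have hd0 : 0 ≤ bdryDist Q.dom (γ t) := Metric.infDist_nonneg
  have h2 : μ (C * bdryDist Q.dom (γ t)) ≤ μ (C * (2 * Q.s m)) :=
    hμ.mono (by positivity) (by gcongr)
  have h3 : 0 ≤ μ (C * bdryDist Q.dom (γ t)) := hμ.nonneg (by positivity)
  exact ((ENNReal.ofReal_le_ofReal_iff h3).mp h1).trans h2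

end CubeChain
end QH

/-! ### Gray code paths and the explicit chains -/

namespace QH

/-! ### Chains filling cubical blocks -/

/-- A zigzag in `0, …, m - 1` that rests for one step at each end. -/
def zigzag (m T : ℕ) : ℕ := if T / m % 2 = 0 then T % m else m - 1 - T % m

theorem zigzag_lt {m : ℕ} (hm : 0 < m) (T : ℕ) : zigzag m T < m := by
  have := Nat.mod_lt T hm
  rw [zigzag]; split_ifs <;> omega

theorem zigzag_of_lt {m T : ℕ} (h : T < m) : zigzag m T = T := by
  rw [zigzag, Nat.div_eq_of_lt h, if_pos (by norm_num), Nat.mod_eq_of_lt h]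

theorem zigzag_inj {m T T' : ℕ} (hm : 0 < m) (h : T / m = T' / m) (hz : zigzag m T = zigzag m T') :
    T = T' := by
  have h1 := Nat.mod_lt T hm
  have h2 := Nat.mod_lt T' hm
  have h3 : T % m = T' % m := by
    rw [zigzag, zigzag, h] at hz
    split_ifs at hz <;> omega
  rw [← Nat.div_add_mod T m, ← Nat.div_add_mod T' m, h, h3]

theorem zigzag_succ_of_dvd {m T : ℕ} (hm : 0 < m) (h : m ∣ T + 1) : zigzag m (T + 1) = zigzag m T := by
  obtain ⟨q, hq⟩ := h
  obtain ⟨p, rfl⟩ : ∃ p, q = p + 1 := ⟨q - 1, by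
    rcases Nat.eq_zero_or_pos q with rfl | h
    · omega
    · omega⟩
  have hT : T = m * p + (m - 1) := by
    have : m * (p + 1) = m * p + m := by ring
    omega
  have e1 : (T + 1) / m = p + 1 := by rw [hq, Nat.mul_div_cancel_left _ hm]
  have e2 : (T + 1) % m = 0 := by rw [hq, Nat.mul_mod_right]
  have e3 : T / m = p := by
    rw [hT, Nat.mul_add_div hm, Nat.div_eq_of_lt (by omega), add_zero]
  have e4 : T % m = m - 1 := by rw [hT, Nat.mul_add_mod, Nat.mod_eq_of_lt (by omega)]
  rw [zigzag, zigzag, e1, e2, e3, e4]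
  split_ifs <;> omega

theorem zigzag_succ_of_not_dvd {m T : ℕ} (hm : 0 < m) (h : ¬ m ∣ T + 1) :
    zigzag m (T + 1) = zigzag m T + 1 ∨ zigzag m T = zigzag m (T + 1) + 1 := by
  have hr := Nat.mod_lt T hm
  have hdm := Nat.div_add_mod T m
  have hne : T % m + 1 < m := by
    by_contra hge
    have : T % m + 1 = m := by omega
    exact h ⟨T / m + 1, by rw [mul_add, mul_one]; omega⟩
  have hT : T + 1 = m * (T / m) + (T % m + 1) := by omega
  have e1 : (T + 1) / m = T / m := by
    conv_lhs => rw [hT]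
    rw [Nat.mul_add_div hm, Nat.div_eq_of_lt hne, add_zero]
  have e2 : (T + 1) % m = T % m + 1 := by
    conv_lhs => rw [hT]
    rw [Nat.mul_add_mod, Nat.mod_eq_of_lt hne]
  rw [zigzag, zigzag, e1, e2]
  split_ifs <;> omega

/-- The coordinates of the reflected `m`-ary Gray code. -/
def gray (m t l : ℕ) : ℕ := zigzag m (t / m ^ l)

theorem gray_lt {m : ℕ} (hm : 0 < m) (t l : ℕ) : gray m t l < m := zigzag_lt hm _

theorem gray_zero {m : ℕ} (hm : 0 < m) (l : ℕ) : gray m 0 l = 0 := by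
  rw [gray, Nat.zero_div, zigzag_of_lt hm]

theorem gray_inj {n m t t' : ℕ} (hm : 0 < m) (ht : t < m ^ n) (ht' : t' < m ^ n)
    (h : ∀ l < n, gray m t l = gray m t' l) : t = t' := by
  have key : ∀ k ≤ n, t / m ^ (n - k) = t' / m ^ (n - k) := by
    intro k
    induction k with
    | zero => intro _; rw [Nat.sub_zero, Nat.div_eq_of_lt ht, Nat.div_eq_of_lt ht']
    | succ k ih =>
      intro hk
      have e : n - k = n - (k + 1) + 1 := by omega
      have h1 := ih (by omega)
      rw [e, pow_succ, ← Nat.div_div_eq_div_mul, ← Nat.div_div_eq_div_mul] at h1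
      exact zigzag_inj hm h1 (h _ (by omega))
  have := key n le_rfl
  simpa using this

/-- l is the exponent of the largest power of m dividing t + 1. The zigzags below l are at a turning
point and rest, the l-th moves, and the quotients above l do not change. -/
theorem exists_gray_succ {n m t : ℕ} (hm : 2 ≤ m) (ht : t + 1 < m ^ n) :
    ∃ l < n, (gray m (t + 1) l = gray m t l + 1 ∨ gray m t l = gray m (t + 1) l + 1) ∧
      ∀ k < n, k ≠ l → gray m (t + 1) k = gray m t k := by
  have hm0 : 0 < m := by omega
  have hex : ∃ l, ¬ m ^ (l + 1) ∣ t + 1 := by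
    refine ⟨n, fun h => ?_⟩
    have h1 := Nat.le_of_dvd (by omega) h
    have h2 : m ^ n ≤ m ^ (n + 1) := Nat.pow_le_pow_right hm0 (by omega)
    omega
  classical
  set l := Nat.find hex with hl
  have hnot := Nat.find_spec hex
  have hdvd : ∀ k ≤ l, m ^ k ∣ t + 1 := by
    intro k hk
    rcases k with _ | k
    · simp
    · by_contra h
      have := Nat.find_min' hex h
      omega
  have hln : l < n := by
    by_contra hge
    have := Nat.le_of_dvd (by omega) (hdvd n (by omega))
    omega
  have hsd : ∀ k ≤ l, (t + 1) / m ^ k = t / m ^ k + 1 := fun k hk => by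
    rw [Nat.succ_div, if_pos (hdvd k hk)]
  have hdd : ∀ k ≤ l, (m ∣ t / m ^ k + 1 ↔ m ^ (k + 1) ∣ t + 1) := fun k hk => by
    rw [← hsd k hk, Nat.dvd_div_iff_mul_dvd (hdvd k hk), pow_succ]
  refine ⟨l, hln, ?_, fun k hk hkl => ?_⟩
  · rw [gray, gray, hsd l le_rfl]
    exact zigzag_succ_of_not_dvd hm0 fun h => hnot ((hdd l le_rfl).mp h)
  · rw [gray, gray]
    rcases lt_or_gt_of_ne hkl with h | h
    · rw [hsd k h.le]
      exact zigzag_succ_of_dvd hm0 ((hdd k h.le).mpr (hdvd (k + 1) h))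
    · rw [Nat.succ_div, if_neg, add_zero]
      intro hd
      exact hnot ((pow_dvd_pow m h).trans hd)

/-- As m is odd, every lower zigzag has completed an even number of sweeps at this time and is back
at 0. -/
theorem gray_last {m : ℕ} (hm : m % 2 = 1) (k l : ℕ) :
    gray m ((m - 1) * m ^ k) l = if l < k then 0 else if l = k then m - 1 else 0 := by
  have hm0 : 0 < m := by omega
  rw [gray]
  split_ifs with h1 h2
  · obtain ⟨d, rfl⟩ : ∃ d, k = l + 1 + d := ⟨k - (l + 1), by omega⟩
    have e : (m - 1) * m ^ (l + 1 + d) / m ^ l = m * ((m - 1) * m ^ d) := by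
      rw [show (m - 1) * m ^ (l + 1 + d) = m ^ l * (m * ((m - 1) * m ^ d)) by ring,
        Nat.mul_div_cancel_left _ (by positivity)]
    rw [e, zigzag, Nat.mul_div_cancel_left _ hm0, Nat.mul_mod_right, if_pos]
    have : (m - 1) % 2 = 0 := by omega
    rw [Nat.mul_mod, this, zero_mul, Nat.zero_mod]
  · subst h2
    rw [Nat.mul_div_cancel _ (by positivity), zigzag_of_lt (by omega)]
  · rw [Nat.div_eq_of_lt, zigzag_of_lt hm0]
    calc (m - 1) * m ^ k < m * m ^ k := by gcongr; omega
      _ = m ^ (k + 1) := by ring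
      _ ≤ m ^ l := Nat.pow_le_pow_right hm0 (by omega)

/-- The number of cells visited in a block with `m` cells per side. -/
def blockLen (n m : ℕ) : ℕ := (m - 1) * m ^ (n - 1) + 1

theorem blockLen_le {n m : ℕ} (hn : 1 ≤ n) (hm : 0 < m) : blockLen n m ≤ m ^ n := by
  obtain ⟨k, rfl⟩ : ∃ k, n = k + 1 := ⟨n - 1, by omega⟩
  obtain ⟨q, rfl⟩ : ∃ q, m = q + 1 := ⟨m - 1, by omega⟩
  rw [blockLen, Nat.add_sub_cancel, Nat.add_sub_cancel, pow_succ, mul_comm]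
  have : 0 < (q + 1) ^ k := by positivity
  have e : (q + 1) ^ k * (q + 1) = (q + 1) ^ k * q + (q + 1) ^ k := by ring
  omega

/-- The block and the position in the block of the `i`-th cell. -/
def state (N : ℕ → ℕ) : ℕ → ℕ × ℕ
  | 0 => (0, 0)
  | i + 1 => if (state N i).2 + 1 < N (state N i).1 then ((state N i).1, (state N i).2 + 1)
      else ((state N i).1 + 1, 0)

theorem state_snd_lt {N : ℕ → ℕ} (hN : ∀ k, 0 < N k) (i : ℕ) : (state N i).2 < N (state N i).1 := by
  induction i with
  | zero => exact hN 0
  | succ i ih =>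
    rw [state]
    split_ifs with h
    · exact h
    · exact hN _

/-- Different indices therefore have different states, which makes the cubes distinct. -/
theorem state_eq {N : ℕ → ℕ} (hN : ∀ k, 0 < N k) (i : ℕ) :
    i = ∑ k ∈ Finset.range (state N i).1, N k + (state N i).2 := by
  induction i with
  | zero => simp [state]
  | succ i ih =>
    have := state_snd_lt hN i
    rw [state]
    split_ifs with h
    · dsimp only; omega
    · dsimp only; rw [Finset.sum_range_succ]; omega

theorem state_fst_mono {N : ℕ → ℕ} : Monotone fun i => (state N i).1 :=
  monotone_nat_of_le_succ fun i => by
    rw [state]; split_ifs <;> simp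

theorem state_start_add {N : ℕ → ℕ} (hN : ∀ k, 0 < N k) (k t : ℕ) (ht : t < N k) :
    state N (∑ j ∈ Finset.range k, N j + t) = (k, t) := by
  have hstep : ∀ k, state N (∑ j ∈ Finset.range k, N j) = (k, 0) →
      ∀ t < N k, state N (∑ j ∈ Finset.range k, N j + t) = (k, t) := by
    intro k hk t
    induction t with
    | zero => intro _; exact hk
    | succ t ih =>
      intro ht
      rw [← add_assoc, state, ih (by omega), if_pos ht]
  have hstart : ∀ k, state N (∑ j ∈ Finset.range k, N j) = (k, 0) := by
    intro k
    induction k with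
    | zero => rfl
    | succ k ih =>
      have h0 := hN k
      have := hstep k ih (N k - 1) (by omega)
      rw [Finset.sum_range_succ]
      obtain ⟨q, hq⟩ : ∃ q, N k = q + 1 := ⟨N k - 1, by omega⟩
      rw [hq, Nat.add_sub_cancel] at this
      rw [hq, ← add_assoc, state, this, if_neg (by dsimp only; omega)]
  exact hstep k (hstart k) t ht

theorem sum_state {N : ℕ → ℕ} (hN : ∀ k, 0 < N k) (f : ℕ → ℝ) (K : ℕ) :
    ∑ i ∈ Finset.range (∑ j ∈ Finset.range K, N j), f (state N i).1 =
      ∑ k ∈ Finset.range K, N k * f k := by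
  induction K with
  | zero => simp
  | succ K ih =>
    rw [Finset.sum_range_succ, Finset.sum_range_add, ih, Finset.sum_range_succ]
    congr 1
    rw [Finset.sum_congr rfl fun t ht => by
      rw [state_start_add hN K t (Finset.mem_range.mp ht)]]
    simp

/-- Lower end of the `k`-th block, when the blocks have `m k` cells of size `2⁻ᵏ` per side. -/
noncomputable def blockStart (m : ℕ → ℕ) (k : ℕ) : ℝ := ∑ j ∈ Finset.range k, m j * (1 / 2) ^ j

theorem blockStart_succ (m : ℕ → ℕ) (k : ℕ) :
    blockStart m (k + 1) = blockStart m k + m k * (1 / 2) ^ k := Finset.sum_range_succ _ _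

theorem blockStart_mono (m : ℕ → ℕ) : Monotone (blockStart m) :=
  monotone_nat_of_le_succ fun k => by
    rw [blockStart_succ]
    have : (0 : ℝ) ≤ m k * (1 / 2) ^ k := by positivity
    linarith

/-- Lower corner of the `t`-th cube of the `k`-th block. -/
noncomputable def blockCorner (n : ℕ) (m : ℕ → ℕ) (p : ℕ × ℕ) (l : ℕ) : ℝ :=
  (if l = n - 1 then blockStart m p.1 else 0) + (1 / 2) ^ p.1 * gray (m p.1) p.2 l

theorem blockCorner_bounds {n : ℕ} {m : ℕ → ℕ} (hm : ∀ k, m k % 2 = 1) (p : ℕ × ℕ) (l : ℕ) :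
    (if l = n - 1 then blockStart m p.1 else 0) ≤ blockCorner n m p l ∧
    blockCorner n m p l + (1 / 2) ^ p.1 ≤
      (if l = n - 1 then blockStart m p.1 else 0) + m p.1 * (1 / 2) ^ p.1 := by
  have h1 := gray_lt (m := m p.1) (by have := hm p.1; omega) p.2 l
  have h2 : (gray (m p.1) p.2 l : ℝ) + 1 ≤ m p.1 := by exact_mod_cast h1
  have h3 : (0 : ℝ) < (1 / 2) ^ p.1 := by positivity
  have h4 : (0 : ℝ) ≤ gray (m p.1) p.2 l := by positivity
  rw [blockCorner]
  constructor
  · have := mul_nonneg h3.le h4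
    linarith
  · have := mul_le_mul_of_nonneg_right h2 h3.le
    linarith

theorem blockCorner_sep {n : ℕ} (hn : 1 ≤ n) {m : ℕ → ℕ} (hm : ∀ k, m k % 2 = 1) {p q : ℕ × ℕ}
    (hp : p.2 < blockLen n (m p.1)) (hq : q.2 < blockLen n (m q.1)) (hpq : p ≠ q) (hle : p.1 ≤ q.1) :
    ∃ l < n, blockCorner n m p l + (1 / 2) ^ p.1 ≤ blockCorner n m q l ∨
      blockCorner n m q l + (1 / 2) ^ q.1 ≤ blockCorner n m p l := by
  rcases hle.lt_or_eq with h | h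
  · refine ⟨n - 1, by omega, Or.inl ?_⟩
    have h1 := (blockCorner_bounds (n := n) hm p (n - 1)).2
    have h2 := (blockCorner_bounds (n := n) hm q (n - 1)).1
    rw [if_pos rfl] at h1 h2
    rw [← blockStart_succ] at h1
    exact h1.trans ((blockStart_mono m h).trans h2)
  · obtain ⟨k, t⟩ := p
    obtain ⟨k', t'⟩ := q
    dsimp only at h hp hq ⊢
    subst h
    have hm0 : 0 < m k := by have := hm k; omega
    have hne : t ≠ t' := fun e => hpq (by rw [e])
    have : ∃ l < n, gray (m k) t l ≠ gray (m k) t' l := by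
      by_contra! hall
      exact hne (gray_inj hm0 (hp.trans_le (blockLen_le hn hm0)) (hq.trans_le (blockLen_le hn hm0)) hall)
    obtain ⟨l, hl, hgl⟩ := this
    refine ⟨l, hl, ?_⟩
    have h3 : (0 : ℝ) < (1 / 2) ^ k := by positivity
    rw [blockCorner, blockCorner]
    dsimp only
    rcases lt_or_gt_of_ne hgl with h | h
    · left
      have : (gray (m k) t l : ℝ) + 1 ≤ gray (m k) t' l := by exact_mod_cast h
      have := mul_le_mul_of_nonneg_left this h3.le
      linarith
    · right
      have : (gray (m k) t' l : ℝ) + 1 ≤ gray (m k) t l := by exact_mod_cast h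
      have := mul_le_mul_of_nonneg_left this h3.le
      linarith

/-- Cubes in `n`-space that abut in the coordinate `k` on the plane at height `c`, the face of the
second being contained in that of the first. -/
def Abuts {n : ℕ} (a a' : Fin n → ℝ) (s s' : ℝ) (k : Fin n) (c : ℝ) : Prop :=
  ((a k + s = c ∧ a' k = c) ∨ (a k = c ∧ a' k + s' = c)) ∧
    ∀ l, l ≠ k → a l ≤ a' l ∧ a' l + s' ≤ a l + s

theorem exists_abuts_blockCorner {n : ℕ} (hn : 1 ≤ n) {m : ℕ → ℕ} (hm : ∀ k, m k % 2 = 1)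
    {k t : ℕ} (ht : t + 1 < blockLen n (m k)) :
    ∃ l c, Abuts (fun l : Fin n => blockCorner n m (k, t) l)
      (fun l : Fin n => blockCorner n m (k, t + 1) l) ((1 / 2) ^ k) ((1 / 2) ^ k) l c := by
  have hm1 := hm k
  have hm2 : 2 ≤ m k := by
    by_contra h
    have : m k = 1 := by omega
    rw [blockLen, this] at ht
    simp at ht
  obtain ⟨l, hl, hor, hoth⟩ := exists_gray_succ (n := n) hm2
    (ht.trans_le (blockLen_le hn (by omega)))
  refine ⟨⟨l, hl⟩, ?_⟩
  have hrest : ∀ j : Fin n, j ≠ ⟨l, hl⟩ →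
      blockCorner n m (k, t) j ≤ blockCorner n m (k, t + 1) j ∧
      blockCorner n m (k, t + 1) j + (1 / 2) ^ k ≤ blockCorner n m (k, t) j + (1 / 2) ^ k := by
    intro j hj
    have := hoth j j.2 fun e => hj (Fin.ext e)
    rw [blockCorner, blockCorner, this]
    exact ⟨le_rfl, le_rfl⟩
  rcases hor with h | h
  · refine ⟨blockCorner n m (k, t) l + (1 / 2) ^ k, Or.inl ⟨rfl, ?_⟩, hrest⟩
    simp only [blockCorner, h]
    push_cast; ring
  · refine ⟨blockCorner n m (k, t) l, Or.inr ⟨rfl, ?_⟩, hrest⟩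
    simp only [blockCorner, h]
    push_cast; ring

/-- The path leaves a block in the top layer, with all other coordinates 0, directly below the
first, smaller cube of the next block. This is why blocks are not filled completely and why the `m
k` are odd. -/
theorem exists_abuts_blockCorner_last {n : ℕ} (hn : 1 ≤ n) {m : ℕ → ℕ} (hm : ∀ k, m k % 2 = 1)
    {k t : ℕ} (ht : t + 1 = blockLen n (m k)) :
    ∃ l c, Abuts (fun l : Fin n => blockCorner n m (k, t) l)
      (fun l : Fin n => blockCorner n m (k + 1, 0) l) ((1 / 2) ^ k) ((1 / 2) ^ (k + 1)) l c := by
  have ht' : t = (m k - 1) * m k ^ (n - 1) := by rw [blockLen] at ht; omega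
  have hm1 := hm k
  have hg : ∀ l < n, gray (m k) t l = if l = n - 1 then m k - 1 else 0 := by
    intro l hl
    rw [ht', gray_last hm1]
    split_ifs <;> omega
  have hg0 : ∀ l, gray (m (k + 1)) 0 l = 0 := fun l => gray_zero (by have := hm (k + 1); omega) l
  have hpos : (0 : ℝ) < (1 / 2) ^ k := by positivity
  refine ⟨⟨n - 1, by omega⟩, blockStart m (k + 1), Or.inl ⟨?_, ?_⟩, fun l hl => ?_⟩
  · have hcast : ((m k - 1 : ℕ) : ℝ) = m k - 1 := by
      rw [Nat.cast_sub (by omega), Nat.cast_one]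
    simp only [blockCorner, if_true, hg (n - 1) (by omega), hcast]
    rw [blockStart_succ]; ring
  · simp only [blockCorner, if_true, hg0]
    simp
  · have hl' : (l : ℕ) ≠ n - 1 := fun e => hl (Fin.ext e)
    simp only [blockCorner, if_neg hl', hg0, hg l l.2]
    refine ⟨by simp, ?_⟩
    rw [pow_succ]
    simp only [Nat.cast_zero, mul_zero, zero_add]
    linarith

/-- The chain of cubes that fills, one after the other, blocks with `m k` cubes of size `2⁻ᵏ` per
side. -/
theorem exists_cubeChain {n : ℕ} (hn : 1 ≤ n) (m : ℕ → ℕ) (hm : ∀ k, m k % 2 = 1) :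
    ∃ Q : CubeChain n,
      (∀ i, Q.s i = (1 / 2) ^ (state (fun k => blockLen n (m k)) i).1) ∧
      ∀ i k, k = (state (fun k => blockLen n (m k)) i).1 → ∀ u ∈ Q.ccube i, ∀ l : Fin n,
        (if (l : ℕ) = n - 1 then blockStart m k else 0) ≤ u l ∧
        u l ≤ (if (l : ℕ) = n - 1 then blockStart m k else 0) + m k * (1 / 2) ^ k := by
  set N : ℕ → ℕ := fun k => blockLen n (m k) with hN
  have hN0 : ∀ k, 0 < N k := fun k => Nat.succ_pos _
  have hlt := state_snd_lt hN0
  have hstep : ∀ i, ∃ l c, Abuts (fun l : Fin n => blockCorner n m (state N i) l)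
      (fun l : Fin n => blockCorner n m (state N (i + 1)) l) ((1 / 2) ^ (state N i).1)
      ((1 / 2) ^ (state N (i + 1)).1) l c := by
    intro i
    have hi := hlt i
    rw [state]
    generalize state N i = p at hi ⊢
    obtain ⟨k, t⟩ := p
    dsimp only at hi ⊢
    split_ifs with h
    · exact exists_abuts_blockCorner hn hm h
    · exact exists_abuts_blockCorner_last hn hm (by simp only [hN] at h hi; omega)
  have hhalf : ∀ i, (state N (i + 1)).1 = (state N i).1 ∨ (state N (i + 1)).1 = (state N i).1 + 1 := by
    intro i
    rw [state]
    split_ifs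
    · exact Or.inl rfl
    · exact Or.inr rfl
  choose ax pl hab using hstep
  refine ⟨⟨fun i l => blockCorner n m (state N i) l, fun i => (1 / 2) ^ (state N i).1, ax, pl,
    fun i => by positivity, fun i => ?_, fun i => ?_, fun i => (hab i).1, fun i => (hab i).2,
    fun i j hij => ?_⟩, fun i => rfl, ?_⟩
  · exact pow_le_pow_of_le_one (by norm_num) (by norm_num) (state_fst_mono (Nat.le_succ i))
  · have hpos : (0 : ℝ) < (1 / 2) ^ (state N i).1 := by positivity
    rcases hhalf i with h | h
    · rw [h]; linarith
    · rw [h, pow_succ]; linarith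
  · have hne : state N i ≠ state N j := fun e => hij (by
      rw [state_eq hN0 i, state_eq hN0 j, e])
    rcases le_total (state N i).1 (state N j).1 with h | h
    · obtain ⟨l, hl, hs⟩ := blockCorner_sep hn hm (hlt i) (hlt j) hne h
      exact ⟨⟨l, hl⟩, hs⟩
    · obtain ⟨l, hl, hs⟩ := blockCorner_sep hn hm (hlt j) (hlt i) hne.symm h
      exact ⟨⟨l, hl⟩, hs.symm⟩
  · rintro i k rfl u hu l
    have h1 := blockCorner_bounds (n := n) hm (state N i) l
    have h2 := hu l
    exact ⟨h1.1.trans h2.1, h2.2.trans h1.2⟩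

end QH

namespace QH
variable {n : ℕ} {φ μ : ℝ → ℝ}

/-! ### Sharpness -/

/-- For a gauge `φ` there is a power of two comparable to `φ (κ 2⁻ᵏ) / (κ 2⁻ᵏ)`. -/
theorem _root_.IsGauge.exists_pow (hφ : IsGauge φ) {κ : ℝ} (hκ : 0 < κ) (k : ℕ) :
    ∃ e : ℕ, κ * (2 ^ e * (1 / 2) ^ k) ≤ φ (κ * (1 / 2) ^ k) ∧
      φ (κ * (1 / 2) ^ k) < 2 * κ * (2 ^ e * (1 / 2) ^ k) := by
  have hδ : (0 : ℝ) < (1 / 2) ^ k := by positivity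
  set δ : ℝ := (1 / 2) ^ k with hδ'
  set x := φ (κ * δ) / (κ * δ) with hx
  have hκδ : 0 < κ * δ := by positivity
  have hx1 : 1 ≤ x := by rw [hx, one_le_div hκδ]; exact hφ.le_self _ hκδ
  have hφx : φ (κ * δ) = x * (κ * δ) := by rw [hx, div_mul_cancel₀ _ hκδ.ne']
  have hfl : ⌊x⌋₊ ≠ 0 := (Nat.floor_pos.mpr hx1).ne'
  refine ⟨Nat.log 2 ⌊x⌋₊, ?_, ?_⟩
  · have h1 : ((2 ^ Nat.log 2 ⌊x⌋₊ : ℕ) : ℝ) ≤ x :=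
      (Nat.cast_le.mpr (Nat.pow_log_le_self 2 hfl)).trans (Nat.floor_le (by linarith))
    push_cast at h1
    rw [hφx]
    calc κ * (2 ^ Nat.log 2 ⌊x⌋₊ * δ) = 2 ^ Nat.log 2 ⌊x⌋₊ * (κ * δ) := by ring
      _ ≤ _ := by gcongr
  · have h1 := (Nat.floor_lt (by linarith)).mp (Nat.lt_pow_succ_log_self (b := 2) (by norm_num) ⌊x⌋₊)
    push_cast at h1
    rw [hφx]
    calc x * (κ * δ) < 2 ^ (Nat.log 2 ⌊x⌋₊ + 1) * (κ * δ) := by gcongr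
      _ = _ := by rw [pow_succ]; ring

/-- From s ≥ a ≥ φ(c) it follows that φ⁻¹(s) ≥ c. -/
theorem integral_etaIntegrand_le (hφ : IsGauge φ) (hc : EtaConverges n φ) {a b c : ℝ} (ha : 0 < a)
    (hab : a ≤ b) (hc0 : 0 < c) (hφa : φ c ≤ a) :
    ∫ s in a..b, etaIntegrand n φ s ≤ (b - a) * (b / c) ^ (n - 1) := by
  have := intervalIntegral.integral_mono_on hab
    (etaIntegrand_intervalIntegrable hc ha.le (ha.le.trans hab))
    (intervalIntegrable_const (c := (b / c) ^ (n - 1))) fun s hs => by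
      have hs0 : 0 < s := ha.trans_le hs.1
      have h1 := hφ.inv_pos hs0
      have h2 : c ≤ gaugeInv φ s := by
        by_contra! hlt
        have := hφ.strictMonoOn h1.le hc0.le hlt
        rw [hφ.apply_inv hs0.le] at this
        linarith [hs.1]
      rw [etaIntegrand]
      have hsb := hs.2
      have hb0 : 0 ≤ b := ha.le.trans hab
      gcongr
  rwa [intervalIntegral.integral_const, smul_eq_mul] at this

/-- A chain of cubes adapted to a gauge: it stays in small balls, but is as long as the packing of
cubes of the admissible sizes allows. -/
theorem exists_cubeChain_of_isGauge (hn : 2 ≤ n) (hφ : IsGauge φ) :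
    ∃ (Q : CubeChain n) (B : ℕ → ℕ),
      (∀ i j, i ≤ j → ∀ u ∈ Q.ccube i, ∀ v ∈ Q.ccube j, dist u v ≤ φ (12 * n * Q.s i) / 2) ∧
      (∀ k, k ≤ B k) ∧ (∀ k, Q.s (B k) = (1 / 2) ^ k) ∧
      (EtaConverges n φ → ∀ k K, k ≤ K →
        ∫ s in (0 : ℝ)..φ (12 * n * (1 / 2) ^ k), etaIntegrand n φ s ≤
          (∫ s in (0 : ℝ)..2 * φ (12 * n * (1 / 2) ^ K), etaIntegrand n φ s) +
          12 * n * 4 ^ (n - 1) * ∑ i ∈ Finset.Ico (B k) (B K), Q.s i) := by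
  set κ : ℝ := 12 * n with hκ
  have hnpos : (0 : ℝ) < n := by exact_mod_cast (by omega : 0 < n)
  have hκ0 : 0 < κ := by positivity
  choose e he1 he2 using fun k => hφ.exists_pow hκ0 k
  set δ : ℕ → ℝ := fun k => (1 / 2) ^ k with hδ
  have hδ0 : ∀ k, 0 < δ k := fun k => by positivity
  have hδs : ∀ k, δ (k + 1) = δ k / 2 := fun k => by simp only [hδ, pow_succ]; ring
  set ρ : ℕ → ℝ := fun k => 2 ^ e k * (1 / 2) ^ k with hρ
  have hρ0 : ∀ k, 0 < ρ k := fun k => by positivity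
  have hesucc : ∀ k, e (k + 1) ≤ e k + 1 := by
    intro k
    have h1 := (he1 (k + 1)).trans (hφ.mono (by positivity) (show κ * (1 / 2) ^ (k + 1) ≤ κ * (1 / 2) ^ k by
      rw [pow_succ]; have : 0 < κ * (1 / 2) ^ k := by positivity
      linarith))
    have h2 := h1.trans_lt (he2 k)
    have h3 : (2 : ℝ) ^ e (k + 1) < 2 ^ (e k + 2) := by
      have hpos : 0 < κ * (1 / 2) ^ k := by positivity
      have e1 : κ * (2 ^ e (k + 1) * (1 / 2) ^ (k + 1)) = 2 ^ e (k + 1) / 2 * (κ * (1 / 2) ^ k) := by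
        rw [pow_succ (1 / 2 : ℝ)]; ring
      have e2 : 2 * κ * (2 ^ e k * (1 / 2) ^ k) = 2 * 2 ^ e k * (κ * (1 / 2) ^ k) := by ring
      rw [e1, e2] at h2
      have := lt_of_mul_lt_mul_right h2 hpos.le
      rw [pow_add]; linarith
    have := (pow_lt_pow_iff_right₀ (by norm_num : (1 : ℝ) < 2)).mp h3
    omega
  have hρs : ∀ k, ρ (k + 1) = 2 ^ e (k + 1) * (1 / 2) ^ k / 2 := fun k => by
    simp only [hρ, pow_succ]; ring
  -- The scale ρ_k is comparable to φ(κ2⁻ᵏ)/κ. If it drops, it at least halves, and a block of side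
  -- about 2ρ_k is affordable. If it does not, its interval of integration is empty and a single
  -- cube suffices.
  set m : ℕ → ℕ := fun k => if e (k + 1) ≤ e k then 2 * 2 ^ e k + 1 else 1 with hm
  have hmodd : ∀ k, m k % 2 = 1 := fun k => by
    simp only [hm]; split_ifs <;> omega
  have hcase : ∀ k, (m k = 2 * 2 ^ e k + 1 ∧ ρ (k + 1) ≤ ρ k / 2) ∨ (m k = 1 ∧ ρ (k + 1) = ρ k) := by
    intro k
    by_cases h : e (k + 1) ≤ e k
    · refine Or.inl ⟨if_pos h, ?_⟩
      rw [hρs]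
      have : (2 : ℝ) ^ e (k + 1) ≤ 2 ^ e k := pow_le_pow_right₀ (by norm_num) h
      simp only [hρ]
      gcongr
    · refine Or.inr ⟨if_neg h, ?_⟩
      have : e (k + 1) = e k + 1 := by have := hesucc k; omega
      rw [hρs, this]
      simp only [hρ, pow_succ]; ring
  have hρanti : ∀ k, ρ (k + 1) ≤ ρ k := fun k => by
    have := hρ0 k
    rcases hcase k with ⟨-, h⟩ | ⟨-, h⟩ <;> linarith
  -- V_k bounds the extent of all blocks from the k-th on: its decrease pays for the width of the
  -- k-th block, 2ρ_k + δ_k or δ_k.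
  set V : ℕ → ℝ := fun k => 4 * ρ k + 2 * δ k with hV
  have hwidth : ∀ k, m k * δ k ≤ V k - V (k + 1) := by
    intro k
    simp only [hV]
    rw [hδs]
    rcases hcase k with ⟨h1, h2⟩ | ⟨h1, h2⟩
    · rw [h1]
      have : ((2 * 2 ^ e k + 1 : ℕ) : ℝ) * δ k = 2 * ρ k + δ k := by
        push_cast; simp only [hρ, hδ]; ring
      rw [this]
      linarith
    · rw [h1, h2, Nat.cast_one]
      linarith
  have hVanti : Antitone V := antitone_nat_of_succ_le fun k => by
    have := hwidth k
    have : 0 ≤ m k * δ k := mul_nonneg (Nat.cast_nonneg _) (hδ0 k).le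
    linarith
  have hV0 : ∀ k, 0 ≤ V k := fun k => by
    have := hρ0 k; have := hδ0 k
    simp only [hV]; positivity
  have hBV : Antitone fun k => blockStart m k + V k := antitone_nat_of_succ_le fun k => by
    have := hwidth k
    rw [blockStart_succ]
    simp only [hδ] at this
    linarith
  -- With κ = 12n this makes n V_k, a bound for the diameter of the tail, at most φ(κ2⁻ᵏ)/2.
  have hVφ : ∀ k, κ * V k ≤ 6 * φ (κ * (1 / 2) ^ k) := by
    intro k
    have h1 := he1 k
    have h2 := hφ.le_apply (t := κ * (1 / 2) ^ k) (by positivity)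
    simp only [hV, hρ, hδ]
    linarith
  obtain ⟨Q, hs, hQ⟩ := exists_cubeChain (n := n) (by omega) m hmodd
  set N : ℕ → ℕ := fun k => blockLen n (m k) with hN
  have hN0 : ∀ k, 0 < N k := fun k => Nat.succ_pos _
  set B : ℕ → ℕ := fun k => ∑ j ∈ Finset.range k, N j with hB
  have hBstate : ∀ k, (state N (B k)).1 = k := fun k => by
    have := state_start_add hN0 k 0 (hN0 k)
    rw [add_zero] at this
    simp only [hB, this]
  have hBmono : Monotone B := monotone_nat_of_le_succ fun k => by
    simp only [hB, Finset.sum_range_succ]; omega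
  refine ⟨Q, B, fun i j hij u hu v hv => ?_, fun k => ?_, fun k => ?_, fun hc => ?_⟩
  · rw [hs]
    set k := (state N i).1 with hk
    set k' := (state N j).1 with hk'
    have hkk : k ≤ k' := state_fst_mono hij
    have hu' := hQ i k hk u hu
    have hv' := hQ j k' hk' v hv
    have hw1 := hwidth k
    have hw2 := hwidth k'
    have h1 := hVanti hkk
    have h2 := hV0 (k + 1)
    have h3 := hV0 (k' + 1)
    have h4 := blockStart_mono m hkk
    have h5 := hBV (show k ≤ k' + 1 by omega)
    have h6 := hBV hkk
    dsimp only at h5 h6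
    have h7 := blockStart_succ m k'
    simp only [hδ] at hw1 hw2
    have hdist : dist u v ≤ n * V k := by
      refine dist_le_card_mul (hV0 k) fun l => ?_
      have hul := hu' l
      have hvl := hv' l
      rw [abs_le]
      split_ifs at hul hvl
      · constructor <;> linarith
      · constructor <;> linarith
    have := hVφ k
    rw [hκ] at this ⊢
    linarith
  · induction k with
    | zero => exact Nat.zero_le _
    | succ k ih =>
      have := hN0 k
      simp only [hB, Finset.sum_range_succ] at ih ⊢
      omega
  · rw [hs, hBstate]
  -- On this interval φ⁻¹(s) ≥ κ2^(-k-1), so the integrand is at most (4·2^e)^(n-1); the block has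
  -- at least 2·2^e·(2^e)^(n-1) cubes of side δ_k.
  · have hblock : ∀ k, ∫ s in 2 * κ * ρ (k + 1)..2 * κ * ρ k, etaIntegrand n φ s ≤
        κ * 4 ^ (n - 1) * (N k * δ k) := by
      intro k
      have hpos := hρ0 (k + 1)
      have hposk := hρ0 k
      have hδk := hδ0 k
      rcases hcase k with ⟨h1, h2⟩ | ⟨h1, h2⟩
      · refine (integral_etaIntegrand_le hφ hc (c := κ * (1 / 2) ^ (k + 1)) (by positivity)
          (by gcongr; exact hρanti k) (by positivity) (he2 (k + 1)).le).trans ?_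
        have e1 : 2 * κ * ρ k / (κ * (1 / 2) ^ (k + 1)) = 4 * 2 ^ e k := by
          simp only [hρ, pow_succ]; field_simp; norm_num
        rw [e1, mul_pow]
        have h3 : (2 : ℝ) * 2 ^ e k * (2 ^ e k) ^ (n - 1) ≤ N k := by
          simp only [hN, blockLen, h1]
          push_cast
          have : ((2 : ℝ) ^ e k) ^ (n - 1) ≤ (2 * 2 ^ e k + 1) ^ (n - 1) := by
            gcongr
            have : (0 : ℝ) < 2 ^ e k := by positivity
            linarith
          have h4 : (2 : ℝ) * 2 ^ e k * (2 ^ e k) ^ (n - 1) ≤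
            2 * 2 ^ e k * (2 * 2 ^ e k + 1) ^ (n - 1) := by gcongr
          linarith
        calc (2 * κ * ρ k - 2 * κ * ρ (k + 1)) * (4 ^ (n - 1) * (2 ^ e k) ^ (n - 1))
            ≤ (2 * κ * ρ k) * (4 ^ (n - 1) * (2 ^ e k) ^ (n - 1)) := by
              gcongr
              have : 0 < 2 * κ * ρ (k + 1) := by positivity
              linarith
          _ = κ * 4 ^ (n - 1) * (2 * 2 ^ e k * (2 ^ e k) ^ (n - 1) * δ k) := by
              simp only [hρ, hδ]; ring
          _ ≤ _ := by gcongr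
      · rw [h2, intervalIntegral.integral_same]
        positivity
    have hint : ∀ {a b : ℝ}, 0 ≤ a → 0 ≤ b → IntervalIntegrable (etaIntegrand n φ) volume a b :=
      fun ha hb => etaIntegrand_intervalIntegrable hc ha hb
    have hsum : ∀ K, ∑ i ∈ Finset.range (B K), Q.s i = ∑ k ∈ Finset.range K, N k * δ k := by
      intro K
      rw [← sum_state hN0 δ K]
      exact Finset.sum_congr rfl fun i _ => hs i
    have hchain : ∀ k K, k ≤ K → ∫ s in (0 : ℝ)..2 * κ * ρ k, etaIntegrand n φ s ≤
        (∫ s in (0 : ℝ)..2 * κ * ρ K, etaIntegrand n φ s) +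
        κ * 4 ^ (n - 1) * ∑ i ∈ Finset.Ico (B k) (B K), Q.s i := by
      intro k K hkK
      induction K, hkK using Nat.le_induction with
      | base => simp
      | succ K hkK ih =>
        have h0 : 0 ≤ 2 * κ * ρ K := by have := hρ0 K; positivity
        have h1 : 0 ≤ 2 * κ * ρ (K + 1) := by have := hρ0 (K + 1); positivity
        have h2 := intervalIntegral.integral_add_adjacent_intervals (hint le_rfl h1) (hint h1 h0)
        have h3 := hblock K
        have h4 : ∑ i ∈ Finset.Ico (B k) (B (K + 1)), Q.s i =
            ∑ i ∈ Finset.Ico (B k) (B K), Q.s i + N K * δ K := by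
          rw [← Finset.sum_Ico_consecutive _ (hBmono hkK) (hBmono (Nat.le_succ K)),
            Finset.sum_Ico_eq_sub _ (hBmono (Nat.le_succ K)), hsum, hsum, Finset.sum_range_succ]
          ring
        rw [h4, mul_add]
        linarith
    intro k K hkK
    have h1 := integral_etaIntegrand_mono hφ hc (hφ.nonneg (t := κ * (1 / 2) ^ k) (by positivity))
      (he2 k).le
    have h2 := integral_etaIntegrand_mono (n := n) hφ hc (a := 2 * κ * ρ K)
      (b := 2 * φ (κ * (1 / 2) ^ K)) (by have := hρ0 K; positivity)
      (by have := he1 K; simp only [hρ]; linarith)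
    have h3 := hchain k K hkK
    exact h1.trans (h3.trans (by linarith))

namespace CubeChain
variable {Q : CubeChain n}

/-- Sides decrease, so N consecutive ones sum to at most N times the first. This recovers the full
sum from the sparse one that bounds lengths of curves. -/
theorem sum_Ico_le {N : ℕ} (hN : 0 < N) (a b : ℕ) : ∃ r, ∑ i ∈ Finset.Ico a b, Q.s i ≤
    N * (Q.s a + ∑ q ∈ Finset.range r, Q.s (a + (q + 1) * N)) := by
  have hblock : ∀ c, ∑ p ∈ Finset.range N, Q.s (c + p) ≤ N * Q.s c := fun c => by
    have := Finset.sum_le_card_nsmul (Finset.range N) (fun p => Q.s (c + p)) (Q.s c)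
      fun p _ => s_anti (by omega)
    simpa using this
  have key : ∀ r, ∑ i ∈ Finset.range ((r + 1) * N), Q.s (a + i) ≤
      N * (Q.s a + ∑ q ∈ Finset.range r, Q.s (a + (q + 1) * N)) := by
    intro r
    induction r with
    | zero => simpa using hblock a
    | succ r ih =>
      rw [add_mul _ 1, one_mul, Finset.sum_range_add, Finset.sum_range_succ]
      have := hblock (a + (r + 1) * N)
      simp only [← add_assoc] at this ⊢
      rw [mul_add] at ih ⊢
      rw [mul_add]
      linarith
  refine ⟨b - a, ?_⟩
  rw [Finset.sum_Ico_eq_sum_range]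
  refine le_trans (Finset.sum_le_sum_of_subset_of_nonneg (Finset.range_subset_range.mpr ?_)
    fun i _ _ => (Q.pos _).le) (key (b - a))
  nlinarith

theorem isBounded_dom {D : ℝ} (h : ∀ j, ∀ u ∈ Q.ccube 0, ∀ v ∈ Q.ccube j, dist u v ≤ D) :
    Bornology.IsBounded Q.dom := by
  refine (Metric.isBounded_closedBall (x := Q.center 0) (r := D)).subset fun v hv => ?_
  obtain ⟨j, hj⟩ := exists_mem_ccube hv
  rw [Metric.mem_closedBall, dist_comm]
  exact h j _ (cube_subset_ccube 0 (center_mem_cube 0)) v hj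

end CubeChain

/-- The sums of sides beyond the cube `B k` are bounded by μ at scale 2⁻ᵏ, uniformly in K. As K
tends to infinity, the remaining integral tends to 0, and the integral up to φ(κ2⁻ᵏ) is bounded by a
multiple of μ. Choosing k dyadically passes from 2⁻ᵏ to t. -/
theorem exists_etaFun_le (hn : 2 ≤ n) (hφ : IsGauge φ) (hc : EtaConverges n φ) {Q : CubeChain n}
    (hb : Bornology.IsBounded Q.dom) {B : ℕ → ℕ} (hB : ∀ k, k ≤ B k)
    (hs : ∀ k, Q.s (B k) = (1 / 2) ^ k)
    (hI : ∀ k K, k ≤ K →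
      ∫ s in (0 : ℝ)..φ (12 * n * (1 / 2) ^ k), etaIntegrand n φ s ≤
        (∫ s in (0 : ℝ)..2 * φ (12 * n * (1 / 2) ^ K), etaIntegrand n φ s) +
        12 * n * 4 ^ (n - 1) * ∑ i ∈ Finset.Ico (B k) (B K), Q.s i)
    (hμ : IsGauge μ) (hJ : IsLengthJohn μ Q.dom) :
    ∃ C : ℝ, 1 ≤ C ∧ ∀ t : ℝ, 0 < t → t ≤ 1 → etaFun n φ C⁻¹ t ≤ μ (C * t) := by
  obtain ⟨c, hc0, hJc⟩ := hJ
  obtain ⟨i₀, hi₀⟩ := CubeChain.exists_sum_le_of_isLengthJohnWith hn hb hμ hc0 hJc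
  set κ : ℝ := 12 * n with hκ
  have hn1 : (1 : ℝ) ≤ n := by exact_mod_cast (by omega : 1 ≤ n)
  have hκ1 : 1 ≤ κ := by rw [hκ]; linarith
  have hκ0 : 0 < κ := by linarith
  set F : ℝ → ℝ := fun x => ∫ s in (0 : ℝ)..x, etaIntegrand n φ s with hF
  set C₁ : ℝ := 1 + 2 * c with hC₁
  set D : ℝ := κ * 4 ^ (n - 1) * (4 ^ n : ℕ) * 2 with hD
  have hD0 : 0 ≤ D := by positivity
  have hbound : ∀ k, i₀ ≤ k → F (φ (κ * (1 / 2) ^ k)) ≤ D * μ (C₁ * (1 / 2) ^ k) := by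
    intro k hk
    have hδ : (0 : ℝ) < (1 / 2) ^ k := by positivity
    have hsum : ∀ K, κ * 4 ^ (n - 1) * ∑ i ∈ Finset.Ico (B k) (B K), Q.s i ≤
        D * μ (C₁ * (1 / 2) ^ k) := by
      intro K
      obtain ⟨r, hr⟩ := CubeChain.sum_Ico_le (Q := Q) (show 0 < 4 ^ n by positivity) (B k) (B K)
      have h1 := hi₀ (B k) (hk.trans (hB k)) r
      rw [hs] at hr h1
      have h2 : μ (c * (2 * (1 / 2) ^ k)) ≤ μ (C₁ * (1 / 2) ^ k) :=
        hμ.mono (by positivity) (by rw [hC₁]; linarith)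
      have h3 : (1 / 2 : ℝ) ^ k ≤ μ (C₁ * (1 / 2) ^ k) := by
        refine le_trans ?_ (hμ.le_apply (by positivity))
        rw [hC₁]
        have : 0 ≤ 2 * c * (1 / 2) ^ k := by positivity
        linarith
      calc κ * 4 ^ (n - 1) * ∑ i ∈ Finset.Ico (B k) (B K), Q.s i
          ≤ κ * 4 ^ (n - 1) * ((4 ^ n : ℕ) * (2 * μ (C₁ * (1 / 2) ^ k))) := by
            gcongr
            refine hr.trans ?_
            gcongr
            linarith
        _ = _ := by rw [hD]; ring
    have hx0 : Filter.Tendsto (fun K : ℕ => 2 * φ (κ * (1 / 2) ^ K)) Filter.atTop (nhds 0) := by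
      have h1 : Filter.Tendsto (fun K : ℕ => κ * (1 / 2 : ℝ) ^ K) Filter.atTop
          (nhdsWithin 0 (Ici 0)) := by
        refine tendsto_nhdsWithin_iff.mpr ⟨?_, Filter.Eventually.of_forall fun K => ?_⟩
        · have := (tendsto_pow_atTop_nhds_zero_of_lt_one (r := (1 / 2 : ℝ)) (by norm_num)
            (by norm_num)).const_mul κ
          rwa [mul_zero] at this
        · have : (0 : ℝ) ≤ κ * (1 / 2) ^ K := by positivity
          exact this
      have h2 := ((hφ.continuousOn 0 (mem_Ici.mpr le_rfl)).tendsto.comp h1).const_mul 2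
      rw [hφ.map_zero, mul_zero] at h2
      exact h2
    have hlim : Filter.Tendsto (fun K : ℕ => F (2 * φ (κ * (1 / 2) ^ K))) Filter.atTop (nhds 0) := by
      have hcont := intervalIntegral.continuousOn_primitive_interval' (a := 0)
        (etaIntegrand_intervalIntegrable hc (le_refl (0 : ℝ)) zero_le_one) left_mem_uIcc
      rw [uIcc_of_le zero_le_one] at hcont
      have h1 := (hcont 0 ⟨le_rfl, zero_le_one⟩).tendsto
      rw [intervalIntegral.integral_same] at h1
      refine h1.comp (tendsto_nhdsWithin_iff.mpr ⟨hx0, ?_⟩)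
      filter_upwards [hx0.eventually_lt_const one_pos] with K hK
      have := hφ.nonneg (t := κ * (1 / 2) ^ K) (by positivity)
      exact ⟨by linarith, hK.le⟩
    have hlim' := hlim.add_const (D * μ (C₁ * (1 / 2) ^ k))
    rw [zero_add] at hlim'
    refine ge_of_tendsto hlim' ?_
    filter_upwards [Filter.eventually_ge_atTop k] with K hK
    exact (hI k K hK).trans (add_le_add le_rfl (hsum K))
  -- The term 2^i₀ forces k ≥ i₀ for all t ≤ 1, so that the cube `B k` comes after that of the John
  -- center; D and 2C₁ absorb the factors outside and inside μ.
  set C : ℝ := 1 + 2 ^ i₀ + D + 2 * C₁ with hC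
  have hC₁0 : 0 < C₁ := by positivity
  have hC1 : 1 ≤ C := by
    have : (0 : ℝ) < 2 ^ i₀ := by positivity
    rw [hC]; linarith
  have hC0 : 0 < C := by linarith
  refine ⟨C, hC1, fun t ht ht1 => ?_⟩
  set x := C⁻¹ * t / κ with hx
  have hx0 : 0 < x := by positivity
  have hxC : x ≤ C⁻¹ := by
    rw [hx, div_le_iff₀ hκ0]
    have : 0 < C⁻¹ := by positivity
    nlinarith
  have hx1 : x ≤ 1 := hxC.trans (inv_le_one_of_one_le₀ hC1)
  obtain ⟨k, hk1, hk2⟩ := exists_nat_pow_near_of_lt_one hx0 hx1 (by norm_num : (0 : ℝ) < 1 / 2)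
    (by norm_num)
  have hki : i₀ ≤ k := by
    by_contra! hlt
    have h1 : (1 / 2 : ℝ) ^ i₀ ≤ (1 / 2) ^ (k + 1) :=
      pow_le_pow_of_le_one (by norm_num) (by norm_num) (by omega)
    have h2 : C⁻¹ ≤ (1 / 2 : ℝ) ^ i₀ := by
      rw [one_div, inv_pow]
      refine inv_anti₀ (by positivity) ?_
      rw [hC]; linarith
    linarith
  have h1 : F (φ (C⁻¹ * t)) ≤ F (φ (κ * (1 / 2) ^ k)) := by
    refine integral_etaIntegrand_mono hφ hc (hφ.nonneg (by positivity)) (hφ.mono (by positivity) ?_)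
    rw [hx, div_le_iff₀ hκ0] at hk2
    linarith
  have h2 : μ (C₁ * (1 / 2) ^ k) ≤ μ (C * t) := by
    refine hμ.mono (by positivity) ?_
    have h3 : (1 / 2 : ℝ) ^ k ≤ 2 * x := by rw [pow_succ] at hk1; linarith
    have h4 : x ≤ t := by
      rw [hx, div_le_iff₀ hκ0]
      have : C⁻¹ * t ≤ 1 * t := by gcongr; exact inv_le_one_of_one_le₀ hC1
      nlinarith
    have h5 : 2 * C₁ ≤ C := by
      have : (0 : ℝ) < 2 ^ i₀ := by positivity
      rw [hC]; linarith
    calc C₁ * (1 / 2) ^ k ≤ C₁ * (2 * t) := by gcongr; linarith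
      _ = 2 * C₁ * t := by ring
      _ ≤ C * t := by gcongr
  have h3 : 0 ≤ μ (C * t) := hμ.nonneg (by positivity)
  have h4 : D ≤ C := by
    have : (0 : ℝ) < 2 ^ i₀ := by positivity
    rw [hC]; linarith
  calc etaFun n φ C⁻¹ t = C⁻¹ * F (φ (C⁻¹ * t)) := rfl
    _ ≤ C⁻¹ * (C * μ (C * t)) := by
        gcongr
        refine h1.trans ((hbound k hki).trans ?_)
        exact mul_le_mul h4 h2 (hμ.nonneg (by positivity)) hC0.le
    _ = μ (C * t) := by field_simp

/-- Domains of chains of cubes show that the length John gauge is best possible. -/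
theorem exists_sharp_domain (hn : 2 ≤ n) : ∃ C₀ K : ℝ, 0 < C₀ ∧ 1 ≤ K ∧
    ∀ φ : ℝ → ℝ, IsGauge φ → EtaConverges n φ →
      ∃ Ω : Set (En n),
        IsBoundedDomain Ω ∧ HasBallSeparation C₀ Ω ∧ IsLC2 (fun r => φ (K * r)) Ω ∧
        ∀ μ : ℝ → ℝ, IsGauge μ → IsLengthJohn μ Ω →
          ∃ C : ℝ, 1 ≤ C ∧ ∀ t : ℝ, 0 < t → t ≤ 1 → etaFun n φ C⁻¹ t ≤ μ (C * t) := by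
  obtain ⟨C₀, hC₀, hsep⟩ := CubeChain.exists_hasBallSeparation hn
  have hn1 : (2 : ℝ) ≤ n := by exact_mod_cast hn
  refine ⟨C₀, 8 * (12 * n), hC₀, by linarith, fun φ hφ hc => ?_⟩
  obtain ⟨Q, B, hT, hB, hs, hI⟩ := exists_cubeChain_of_isGauge hn hφ
  have hb : Bornology.IsBounded Q.dom := CubeChain.isBounded_dom fun j => hT 0 j (Nat.zero_le j)
  exact ⟨Q.dom, CubeChain.isBoundedDomain hb, hsep Q hb,
    CubeChain.isLC2 hn hφ le_rfl (by positivity) (by linarith) hT,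
    fun μ hμ hJ => exists_etaFun_le hn hφ hc hb hB hs (hI hc) hμ hJ⟩

end QH

theorem theorem6p2 (n : ℕ) (hn : 1 ≤ n) :
    -- the diam-to-length estimate, with a constant depending only on `n` and on the ball
    -- separation constant
    (∀ C₀ : ℝ, 0 < C₀ → ∃ C : ℝ, 1 ≤ C ∧
      ∀ φ : ℝ → ℝ, IsGauge φ → EtaConverges n φ →
        IsGauge (etaFun n φ C) ∧
        ∀ Ω : Set (En n), IsBoundedDomain Ω → HasBallSeparation C₀ Ω → IsLC2 φ Ω →
          IsLengthJohnWith C (etaFun n φ C) Ω) ∧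
    -- sharpness: for every gauge `φ` some domain of this kind, with constants depending only on
    -- `n`, forces every gauge for which it is length John to dominate `η` up to constants
    (2 ≤ n → ∃ C₀ K : ℝ, 0 < C₀ ∧ 1 ≤ K ∧
      ∀ φ : ℝ → ℝ, IsGauge φ → EtaConverges n φ →
        ∃ Ω : Set (En n),
          IsBoundedDomain Ω ∧ HasBallSeparation C₀ Ω ∧ IsLC2 (fun r => φ (K * r)) Ω ∧
          ∀ μ : ℝ → ℝ, IsGauge μ → IsLengthJohn μ Ω →
            ∃ C : ℝ, 1 ≤ C ∧ ∀ t : ℝ, 0 < t → t ≤ 1 → etaFun n φ C⁻¹ t ≤ μ (C * t)) :=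
  ⟨fun _ hC₀ => QH.isLengthJohnWith_of_hasBallSeparation hn hC₀, QH.exists_sharp_domain⟩
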